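/- Let $\tilde{\mathcal K}_3=\{e^{(1)},e^{(2)},e^{(3)}\}\subset\mathbb R^{2\times2}_{sym}$ with $$e^{(1)}=\tfrac12\begin{pmatrix}1&-\sqrt3\\-\sqrt3&-1\end{pmatrix},\quad e^{(2)}=\begin{pmatrix}-1&0\\0&1\end{pmatrix},\quad e^{(3)}=\tfrac12\begin{pmatrix}1&\sqrt3\\\sqrt3&-1\end{pmatrix},$$ let $Q_j$, $j\in\{1,2,3\}$, be the rotation of $\mathbb R^2$ by the angle $\frac{2\pi}{3}(j-1)$, and let $\tilde{\mathcal N}=\{Q_j(e_1+e_2),\,Q_j(e_1-e_2): j\in\{1,2,3\}\}$, where $e_1,e_2$ is the standard basis. For a bounded Lipschitz domain (open, connected set) $\Omega\subset\mathbb R^2$, $\epsilon>0$ and $v\in W^{1,2}(\Omega;\mathbb R^2)$ put $$F_\epsilon(v;\Omega)=\int_\Omega \operatorname{dist}^2(e(v),\tilde{\mathcal K}_3)\,dx+\epsilon\,|D^2v|(\Omega)\in[0,\infty],\qquad e(v)=\tfrac12(\nabla v+(\nabla v)^t),$$ where $|D^2v|(\Omega)$ is the total variation of the distributional derivative of $\nabla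 v$ ($+\infty$ if it is not a finite measure). Boundary values are meant in the sense of traces. A point of $\partial\Omega$ is called regular if $\partial\Omega$ is of class $C^3$ near it; $\nu$ denotes the outer unit normal at regular points; $\Omega$ is piecewise $C^3$ if all but finitely many points of $\partial\Omega$ are regular. (a) Let $\Omega\subset\mathbb R^2$ be a bounded, piecewise $C^3$ Lipschitz domain and let $\Gamma\subset\partial\Omega$ be nonempty and relatively open such that for every regular point $x\in\Gamma$ the normal $\nu(x)$ is not a scalar multiple of any element of $\tilde{\mathcal N}$. Then there are constants $c,C>0$ depending only on $\Omega$ and $\Gamma$ such that for all $\epsilon>0$ $$c\,\min\{1,\epsilon(|\log\epsilon|+1)\}\le \inf_{v\in W^{1,2}(\Omega;\mathbb R^2),\ v|_\Gamma=0}F_\epsilon(v;\Omega)\le C\,\min\{1,\epsilon(|\log\epsilon|+1)\}.$$ (b) For every $n\in\tilde{\mathcal N}$ there exist a bounded polygonal Lipschitz domain $\Omega\subset\mathbb R^2$ (its boundary is a finite union of segments) that has a side with outer unit normal $n/|n|$, and constants $c,C>0$ depending only on $\Omega$, such that for all $\epsilon>0$ $$c\,\min\{\epsilon,1\}\le \inf_{v\in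 W^{1,2}(\Omega;\mathbb R^2),\ v|_{\partial\Omega}=0}F_\epsilon(v;\Omega)\le C\,\min\{\epsilon,1\}.$$ -/

import Mathlib

open MeasureTheory Set Filter Topology
open scoped ENNReal ContDiff Matrix

attribute [local instance] Matrix.frobeniusNormedAddCommGroup

namespace HexRhombic

/-- The Euclidean plane. -/
abbrev Plane : Type := EuclideanSpace ℝ (Fin 2)

/-- Real `2 × 2` matrices, with the Frobenius (Euclidean) norm. -/
abbrev Mat : Type := Matrix (Fin 2) (Fin 2) ℝ

/-- The `k`-th standard unit vector. -/
noncomputable def unitVec (k : Fin 2) : Plane := EuclideanSpace.single k (1 : ℝ)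

/-- Counterclockwise rotation of a vector by `90°`. -/
noncomputable def perp (ν : Plane) : Plane := !₂[-(ν 1), ν 0]

/-! ### Wells and austenite-martensite normals -/

/-- The three martensitic strains `e⁽¹⁾, e⁽²⁾, e⁽³⁾`. -/
noncomputable def wells : Set Mat :=
  {(1 / 2 : ℝ) • !![1, -√3; -√3, -1], !![-1, 0; 0, 1], (1 / 2 : ℝ) • !![1, √3; √3, -1]}

/-- The rotation matrix `Q(φ)`. -/
noncomputable def rotMatrix (φ : ℝ) : Mat :=
  !![Real.cos φ, -Real.sin φ; Real.sin φ, Real.cos φ]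

/-- The rotations `Q₁, Q₂, Q₃` by `0, 2π/3, 4π/3`, indexed from zero. -/
noncomputable def Q (j : Fin 3) : Mat := rotMatrix (2 * Real.pi / 3 * (j : ℕ))

/-- The six (not normalized) austenite-martensite normals `Q_j (e₁ ± e₂)`. -/
noncomputable def amNormals : Set Plane :=
  {n | ∃ j : Fin 3, n = WithLp.toLp 2 (Q j *ᵥ ![1, 1]) ∨ n = WithLp.toLp 2 (Q j *ᵥ ![1, -1])}

/-! ### Domains -/

/-- `∂Ω` is of class `C³` near `x ∈ ∂Ω`, with `Ω` on one side, and `ν` is the outer unit normal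
at `x`: in the orthonormal frame `(perp ν, ν)` centred at `x`, the set `Ω` is near `x` the region
strictly below the graph of a `C³` function which vanishes to first order at `0`. -/
def IsRegularWithNormal (Ω : Set Plane) (x ν : Plane) : Prop :=
  ‖ν‖ = 1 ∧ ∃ g : ℝ → ℝ, ContDiff ℝ 3 g ∧ g 0 = 0 ∧ deriv g 0 = 0 ∧
    ∃ r > 0, ∀ y ∈ Metric.ball x r,
      (y ∈ Ω ↔ inner ℝ (y - x) ν < g (inner ℝ (y - x) (perp ν)))

/-- Regular boundary points: those near which `∂Ω` is of class `C³`. -/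
def IsRegularPoint (Ω : Set Plane) (x : Plane) : Prop := ∃ ν, IsRegularWithNormal Ω x ν

/-- Bounded Lipschitz domains: bounded, open, connected, and near each boundary point the region
strictly below the graph of a Lipschitz function in some orthonormal frame. -/
structure IsLipschitzDomain (Ω : Set Plane) : Prop where
  isOpen : IsOpen Ω
  isConnected : IsConnected Ω
  isBounded : Bornology.IsBounded Ω
  graph : ∀ x ∈ frontier Ω, ∃ ν : Plane, ‖ν‖ = 1 ∧ ∃ (L : NNReal) (g : ℝ → ℝ), LipschitzWith L g ∧
    ∃ r > 0, ∀ y ∈ Metric.ball x r,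
      (y ∈ Ω ↔ inner ℝ (y - x) ν < g (inner ℝ (y - x) (perp ν)))

/-- Bounded piecewise `C³` (Lipschitz) domains: all but finitely many boundary points are
regular. -/
structure IsPiecewiseC3Domain (Ω : Set Plane) : Prop extends IsLipschitzDomain Ω where
  finite_irregular : {x ∈ frontier Ω | ¬ IsRegularPoint Ω x}.Finite

/-- Bounded polygonal (Lipschitz) domains: the boundary is a finite union of segments. -/
structure IsPolygonalDomain (Ω : Set Plane) : Prop extends IsLipschitzDomain Ω where
  frontier_eq : ∃ S : Set (Plane × Plane), S.Finite ∧
    frontier Ω = ⋃ p ∈ S, segment ℝ p.1 p.2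

/-- `Ω` has a (nondegenerate) side along which `n`, normalized, is the outer normal. -/
def HasSideWithNormal (Ω : Set Plane) (n : Plane) : Prop :=
  ∃ a b : Plane, a ≠ b ∧ segment ℝ a b ⊆ frontier Ω ∧
    ∀ x ∈ openSegment ℝ a b, IsRegularWithNormal Ω x (‖n‖⁻¹ • n)

/-- `Γ` is a relatively open subset of `∂Ω`. -/
def IsRelOpenBoundary (Ω Γ : Set Plane) : Prop := ∃ U : Set Plane, IsOpen U ∧ Γ = U ∩ frontier Ω

/-! ### Sobolev functions and traces -/

/-- Scalar test functions in `C_c^∞(Ω)`. -/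
structure IsTest (Ω : Set Plane) (φ : Plane → ℝ) : Prop where
  smooth : ContDiff ℝ ∞ φ
  compact : HasCompactSupport φ
  support : tsupport φ ⊆ Ω

/-- An element of `W^{1,2}(Ω; ℝ²)`: a square integrable function on `Ω` with a square integrable
weak gradient, `grad x i j` being the weak partial derivative `∂ⱼ vᵢ` (values outside `Ω` are
irrelevant). -/
structure W12 (Ω : Set Plane) where
  toFun : Plane → Plane
  grad : Plane → Mat
  memLp : MemLp toFun 2 (volume.restrict Ω)
  grad_memLp : ∀ i j, MemLp (fun x => grad x i j) 2 (volume.restrict Ω)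
  weak_grad : ∀ φ : Plane → ℝ, IsTest Ω φ → ∀ i j : Fin 2,
    ∫ x in Ω, toFun x i * fderiv ℝ φ x (unitVec j) = -∫ x in Ω, grad x i j * φ x

/-- `T ∈ L²(∂Ω, ℋ¹)` is the boundary trace of `v`: some functions in `C_c^∞(ℝ²; ℝ²)` converge to
`v` in `W^{1,2}(Ω)` while their restrictions to `∂Ω` converge to `T` in `L²(∂Ω, ℋ¹)`. -/
def W12.HasTrace {Ω : Set Plane} (v : W12 Ω) (T : Plane → Plane) : Prop :=
  MemLp T 2 ((μH[1] : Measure Plane).restrict (frontier Ω)) ∧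
  ∃ w : ℕ → Plane → Plane, (∀ k, ContDiff ℝ ∞ (w k) ∧ HasCompactSupport (w k)) ∧
    Tendsto (fun k => eLpNorm (fun x => w k x - v.toFun x) 2 (volume.restrict Ω)) atTop (𝓝 0) ∧
    (∀ i j : Fin 2, Tendsto (fun k => eLpNorm
      (fun x => fderiv ℝ (w k) x (unitVec j) i - v.grad x i j) 2 (volume.restrict Ω))
      atTop (𝓝 0)) ∧
    Tendsto (fun k => eLpNorm (fun x => w k x - T x) 2
      ((μH[1] : Measure Plane).restrict (frontier Ω))) atTop (𝓝 0)

/-- `v = 0` on `Γ ⊆ ∂Ω` in the sense of traces. -/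
def W12.VanishesOn {Ω : Set Plane} (v : W12 Ω) (Γ : Set Plane) : Prop :=
  ∃ T : Plane → Plane, v.HasTrace T ∧ ∀ᵐ x ∂((μH[1] : Measure Plane).restrict Γ), T x = 0

/-! ### The energy -/

/-- The symmetric part of a matrix. -/
noncomputable def symPart (A : Mat) : Mat := (1 / 2 : ℝ) • (A + Aᵀ)

/-- Test tensor fields in `C_c^∞(Ω; ℝ^{2×2×2})` with pointwise Euclidean norm at most one. -/
structure IsTestField (Ω : Set Plane) (Φ : Plane → Fin 2 → Fin 2 → Fin 2 → ℝ) : Prop where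
  isTest : ∀ i j k, IsTest Ω (fun x => Φ x i j k)
  le_one : ∀ x, ∑ i, ∑ j, ∑ k, Φ x i j k ^ 2 ≤ 1

/-- The total variation `|D²v|(Ω) ∈ [0, ∞]` of the distributional derivative of `∇v`. -/
noncomputable def W12.hessianVariation {Ω : Set Plane} (v : W12 Ω) : ℝ≥0∞ :=
  ⨆ (Φ : Plane → Fin 2 → Fin 2 → Fin 2 → ℝ) (_ : IsTestField Ω Φ),
    ENNReal.ofReal (∫ x in Ω, ∑ i, ∑ j, ∑ k,
      v.grad x i j * fderiv ℝ (fun y => Φ y i j k) x (unitVec k))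

/-- `F_ε(v, Ω) = ∫_Ω dist²(e(v), wells) dx + ε |D²v|(Ω)`, with values in `[0, ∞]`. -/
noncomputable def W12.energy {Ω : Set Plane} (ε : ℝ) (v : W12 Ω) : ℝ≥0∞ :=
  (∫⁻ x in Ω, ENNReal.ofReal (Metric.infDist (symPart (v.grad x)) wells ^ 2)) +
    ENNReal.ofReal ε * v.hessianVariation

/-- The infimum of `F_ε(v, Ω)` over all `v ∈ W^{1,2}(Ω; ℝ²)` with `v = 0` on `Γ`. -/
noncomputable def minEnergy (Ω Γ : Set Plane) (ε : ℝ) : ℝ≥0∞ :=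
  ⨅ (v : W12 Ω) (_ : v.VanishesOn Γ), v.energy ε

/-- `m ∼ f`: two-sided bounds, uniform in `ε > 0`. -/
def ScalesLike (m : ℝ → ℝ≥0∞) (f : ℝ → ℝ) : Prop :=
  ∃ c C : ℝ, 0 < c ∧ 0 < C ∧ ∀ ε : ℝ, 0 < ε →
    ENNReal.ofReal (c * f ε) ≤ m ε ∧ m ε ≤ ENNReal.ofReal (C * f ε)

end HexRhombic

/-! Lower bounds. For a unit vector τ the number τ·(∇v)τ depends only on e(v), is the τ-derivative
of v·τ, and varies in direction τ by at most |D²v|. On a well it is minus a product of two linear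
forms in the normal ν of τ, which vanish only at the two austenite-martensite normals of that well
(`quad_wellOf`). If ν is parallel to none of the six normals, then |τ·(∇v)τ| ≥ c₀ − misfit
everywhere, the misfit being the distance of e(v) to the wells.

On the other hand v = 0 on Γ. At depth t below Γ, v·τ is of order t up to the misfit, so smooth
averages of τ·(∇v)τ over a tangential length M t are small once M is large. A box of thickness t and
length M t therefore carries variation of order t or, together with its neighbourhood, elastic
energy of order t² (`W12.box_lower`). At depth t_k = 4^(-k) t₀ there is room for 4^k such boxes,
which gives c ≤ (variation in layer k) + C 4^k (elastic energy). The layers are disjoint, so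
summation over k ≤ K gives c (K + 1) ≤ |D²v| + C 4^K (elastic energy), and 4^K ≈ 1/ε produces ε |log
ε| (`lower_of_dyadic`, `minEnergy_ge_log`).

No Korn inequality is needed: v·τ = v·(τ + ν) − v·ν, and each v·ξ on the right is recovered by
integrating its own ξ-derivative, a quadratic form of e(v), along ξ from the boundary. Everything is
phrased by duality with test functions; the zero trace enters once, as an integration by parts
across Γ (`W12.integral_inner_fderiv_of_trace`).

For the linear lower bound in (b), a strip around a chord of a convex domain suffices: v·τ vanishes
at both ends, so τ·(∇v)τ has mean zero along the chord, while its modulus stays near or above c₀;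
hence it must vary (`minEnergy_ge_linear`).

Upper bounds. The triangle with outer normals Q_j(e₁ + σ e₂), σ = ±1, carries a continuous piecewise
affine field that vanishes outside it. On six outer pieces the strain is a well; on the remaining
core the gradient is skew, and the core is the whole triangle multiplied by −(2 − √3). Adding
shrunken copies in the successive cores pushes the bad area to zero while the variations form a
geometric series (`exists_nested_patch`). This gives the bound C ε on such triangles, hence (b).

For a general Lipschitz domain, two such triangles form a parallelogram, and a Whitney decomposition
into parallelograms is used. Generation k has at most C 2^k cells, each of variation of order
2^(-k), so every generation costs the same; stopping after about |log ε| generations leaves a collar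
of area of order ε (`exists_whitney_patch`, `minEnergy_le_log`). -/

namespace HexRhombic

/-! ### Integrals along segments -/

/-- The integral of `θ` along the segment from `x + a • ξ` to `x + b • ξ`, in the parameter. -/
noncomputable def lineInt (θ : Plane → ℝ) (ξ : Plane) (a b : ℝ) (x : Plane) : ℝ :=
  ∫ r in a..b, θ (x + r • ξ)

/-- The segment integral is the convolution of θ with a finite measure, the image of Lebesgue
measure on the parameter interval under r ↦ −rξ, and so inherits the smoothness of θ. -/
theorem contDiff_lineInt {θ : Plane → ℝ} (hθ : ContDiff ℝ ∞ θ) (hc : HasCompactSupport θ)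
    (ξ : Plane) {a b : ℝ} (hab : a ≤ b) : ContDiff ℝ ∞ (lineInt θ ξ a b) := by
  have hcont : Continuous fun r : ℝ => -(r • ξ) := by fun_prop
  let μ : Measure Plane := (volume.restrict (Ioc a b)).map fun r : ℝ => -(r • ξ)
  have hμ : IsFiniteMeasure μ := Measure.isFiniteMeasure_map _ _
  have key : lineInt θ ξ a b =
      convolution (fun _ : Plane => (1 : ℝ)) θ (ContinuousLinearMap.mul ℝ ℝ) μ := by
    funext x
    rw [lineInt, intervalIntegral.integral_of_le hab, convolution,
      integral_map hcont.aemeasurable]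
    · simp
    · exact Continuous.aestronglyMeasurable (by
        have := hθ.continuous
        fun_prop)
  rw [key]
  exact hc.contDiff_convolution_right (n := ⊤) _ (integrable_const 1).locallyIntegrable hθ

theorem fderiv_lineInt {θ : Plane → ℝ} (hθ : ContDiff ℝ ∞ θ) (hc : HasCompactSupport θ)
    (ξ : Plane) {a b : ℝ} (hab : a ≤ b) (x : Plane) :
    fderiv ℝ (lineInt θ ξ a b) x ξ = θ (x + b • ξ) - θ (x + a • ξ) := by
  have hd := ((contDiff_lineInt hθ hc ξ hab).differentiable (by simp)) x
  rw [← hd.lineDeriv_eq_fderiv, lineDeriv]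
  have hcont : Continuous fun r : ℝ => θ (x + r • ξ) := by
    have := hθ.continuous
    fun_prop
  -- Moving x along ξ only slides the window of integration, so the derivative is a difference of
  -- endpoint values.
  have h1 : (fun t : ℝ => lineInt θ ξ a b (x + t • ξ)) =
      fun t => (∫ r in (0 : ℝ)..(b + t), θ (x + r • ξ)) -
        ∫ r in (0 : ℝ)..(a + t), θ (x + r • ξ) := by
    funext t
    rw [intervalIntegral.integral_interval_sub_left (hcont.intervalIntegrable _ _)
      (hcont.intervalIntegrable _ _), lineInt,
      ← intervalIntegral.integral_comp_add_right (fun r => θ (x + r • ξ))]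
    congr 1
    funext r
    congr 1
    module
  rw [h1]
  have hF : ∀ c : ℝ, HasDerivAt (fun t : ℝ => ∫ r in (0 : ℝ)..(c + t), θ (x + r • ξ))
      (θ (x + c • ξ)) 0 := by
    intro c
    have h2 := hcont.integral_hasStrictDerivAt 0 (c + 0)
    have h3 := h2.hasDerivAt.comp_const_add c 0
    simpa using h3
  exact ((hF b).sub (hF a)).deriv

theorem abs_lineInt_le {θ : Plane → ℝ} {B : ℝ} (hB : ∀ y, |θ y| ≤ B) (ξ : Plane) {a b : ℝ}
    (hab : a ≤ b) (x : Plane) : |lineInt θ ξ a b x| ≤ B * (b - a) := by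
  have := intervalIntegral.norm_integral_le_of_norm_le_const (a := a) (b := b) (C := B)
    (f := fun r => θ (x + r • ξ)) (fun r _ => hB _)
  rwa [Real.norm_eq_abs, abs_of_nonneg (sub_nonneg.2 hab)] at this

theorem lineInt_eq_zero {θ : Plane → ℝ} {ξ : Plane} {a b : ℝ} {x : Plane} (hab : a ≤ b)
    (h : ∀ r ∈ Icc a b, θ (x + r • ξ) = 0) : lineInt θ ξ a b x = 0 := by
  rw [lineInt, intervalIntegral.integral_congr (g := fun _ => (0 : ℝ))]
  · simp
  · intro r hr
    rw [uIcc_of_le hab] at hr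
    exact h r hr

theorem lineInt_add {θ : Plane → ℝ} (hθ : Continuous θ) (ξ : Plane) (a b c : ℝ) (x : Plane) :
    lineInt θ ξ a b x + lineInt θ ξ b c x = lineInt θ ξ a c x := by
  have hcont : Continuous fun r : ℝ => θ (x + r • ξ) := by fun_prop
  exact intervalIntegral.integral_add_adjacent_intervals (hcont.intervalIntegrable _ _)
    (hcont.intervalIntegrable _ _)

/-! ### Test functions -/

theorem IsTest.mono {Ω Ω' : Set Plane} {φ : Plane → ℝ} (h : IsTest Ω φ) (hΩ : Ω ⊆ Ω') :
    IsTest Ω' φ := ⟨h.smooth, h.compact, h.support.trans hΩ⟩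

theorem IsTest.zero (Ω : Set Plane) : IsTest Ω fun _ => (0 : ℝ) :=
  ⟨contDiff_const, HasCompactSupport.zero, by
    rw [show (fun _ : Plane => (0 : ℝ)) = 0 from rfl, tsupport_zero]; exact empty_subset _⟩

theorem isTest_of_eq_zero {Ω K : Set Plane} {φ : Plane → ℝ} (hφ : ContDiff ℝ ∞ φ)
    (hK : IsCompact K) (hKΩ : K ⊆ Ω) (h0 : ∀ x ∉ K, φ x = 0) : IsTest Ω φ := by
  refine ⟨hφ, HasCompactSupport.intro hK h0, ?_⟩
  refine (closure_minimal ?_ hK.isClosed).trans hKΩ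
  intro x hx
  by_contra hn
  exact hx (h0 x hn)

theorem IsTest.eq_zero {Ω : Set Plane} {φ : Plane → ℝ} (h : IsTest Ω φ) {x : Plane} (hx : x ∉ Ω) :
    φ x = 0 := image_eq_zero_of_notMem_tsupport fun hx' => hx (h.support hx')

theorem IsTest.fderiv_eq_zero {Ω : Set Plane} {φ : Plane → ℝ} (h : IsTest Ω φ) {x : Plane}
    (hx : x ∉ Ω) : fderiv ℝ φ x = 0 :=
  fderiv_of_notMem_tsupport ℝ fun hx' => hx (h.support hx')

theorem IsTest.add {Ω : Set Plane} {φ ψ : Plane → ℝ} (h : IsTest Ω φ) (h' : IsTest Ω ψ) :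
    IsTest Ω fun x => φ x + ψ x := by
  refine isTest_of_eq_zero (h.smooth.add h'.smooth) (h.compact.union h'.compact)
    (union_subset h.support h'.support) fun x hx => ?_
  rw [mem_union, not_or] at hx
  rw [image_eq_zero_of_notMem_tsupport hx.1, image_eq_zero_of_notMem_tsupport hx.2, add_zero]

theorem IsTest.const_mul {Ω : Set Plane} {φ : Plane → ℝ} (h : IsTest Ω φ) (c : ℝ) :
    IsTest Ω fun x => c * φ x := by
  refine isTest_of_eq_zero (contDiff_const.mul h.smooth) h.compact h.support fun x hx => ?_
  rw [image_eq_zero_of_notMem_tsupport hx, mul_zero]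

theorem IsTest.mul_smooth {Ω : Set Plane} {φ ψ : Plane → ℝ} (h : IsTest Ω φ)
    (hψ : ContDiff ℝ ∞ ψ) : IsTest Ω fun x => φ x * ψ x := by
  refine isTest_of_eq_zero (h.smooth.mul hψ) h.compact h.support fun x hx => ?_
  rw [image_eq_zero_of_notMem_tsupport hx, zero_mul]

theorem IsTest.fderiv_apply {Ω : Set Plane} {φ : Plane → ℝ} (h : IsTest Ω φ) (ξ : Plane) :
    IsTest Ω fun x => fderiv ℝ φ x ξ := by
  refine isTest_of_eq_zero ?_ h.compact h.support fun x hx => ?_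
  · exact (h.smooth.fderiv_right (m := ∞) (by simp)).clm_apply contDiff_const
  · rw [fderiv_of_notMem_tsupport ℝ hx]; rfl

theorem IsTest.exists_bound {Ω : Set Plane} {φ : Plane → ℝ} (h : IsTest Ω φ) :
    ∃ C, 0 < C ∧ ∀ x, |φ x| ≤ C := by
  obtain ⟨C, hC⟩ := h.compact.exists_bound_of_continuous h.smooth.continuous
  exact ⟨max C 1, by positivity, fun x => (hC x).trans (le_max_left _ _)⟩

theorem IsTest.integrable {Ω : Set Plane} {φ : Plane → ℝ} (h : IsTest Ω φ) (μ : Measure Plane)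
    [IsFiniteMeasureOnCompacts μ] : Integrable φ μ :=
  h.smooth.continuous.integrable_of_hasCompactSupport h.compact

theorem IsTest.memLp {Ω : Set Plane} {φ : Plane → ℝ} (h : IsTest Ω φ) (p : ℝ≥0∞)
    (μ : Measure Plane) [IsFiniteMeasureOnCompacts μ] : MemLp φ p μ :=
  h.smooth.continuous.memLp_of_hasCompactSupport h.compact

/-! ### Orthonormal frames -/

/-- The tangential coordinate in the frame `(perp ν, ν)` centred at `x₀`. -/
noncomputable def tanC (x₀ ν y : Plane) : ℝ := inner ℝ (y - x₀) (perp ν)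

/-- The normal coordinate in the frame `(perp ν, ν)` centred at `x₀`. -/
noncomputable def norC (x₀ ν y : Plane) : ℝ := inner ℝ (y - x₀) ν

/-- The point with given coordinates in the frame `(perp ν, ν)` centred at `x₀`. -/
noncomputable def framePt (x₀ ν : Plane) (p : ℝ × ℝ) : Plane := x₀ + (p.1 • perp ν + p.2 • ν)

theorem inner_plane (x y : Plane) : inner ℝ x y = x 0 * y 0 + x 1 * y 1 := by
  simp [PiLp.inner_apply, mul_comm]

@[simp] theorem perp_zero_coord (ν : Plane) : perp ν 0 = -(ν 1) := rfl
@[simp] theorem perp_one_coord (ν : Plane) : perp ν 1 = ν 0 := rfl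

theorem norm_sq_plane (x : Plane) : ‖x‖ ^ 2 = x 0 ^ 2 + x 1 ^ 2 := by
  rw [EuclideanSpace.norm_sq_eq]; simp

theorem norm_perp (ν : Plane) : ‖perp ν‖ = ‖ν‖ := by
  have : ‖perp ν‖ ^ 2 = ‖ν‖ ^ 2 := by
    rw [norm_sq_plane, norm_sq_plane]; simp; ring
  exact (sq_eq_sq₀ (norm_nonneg _) (norm_nonneg _)).1 this

theorem plane_ext {x y : Plane} (h0 : x 0 = y 0) (h1 : x 1 = y 1) : x = y := by
  ext i; fin_cases i <;> assumption

theorem inner_perp_self (ν : Plane) : inner ℝ (perp ν) ν = 0 := by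
  rw [inner_plane]; simp; ring

section Frame

variable {x₀ ν : Plane}

theorem unit_sq (hν : ‖ν‖ = 1) : ν 0 ^ 2 + ν 1 ^ 2 = 1 := by
  rw [← norm_sq_plane, hν, one_pow]

theorem framePt_tanC_norC (hν : ‖ν‖ = 1) (y : Plane) :
    framePt x₀ ν (tanC x₀ ν y, norC x₀ ν y) = y := by
  have h := unit_sq hν
  apply plane_ext <;> simp [framePt, tanC, norC, inner_plane]
  · linear_combination (y 0 - x₀ 0) * h
  · linear_combination (y 1 - x₀ 1) * h

theorem tanC_framePt (hν : ‖ν‖ = 1) (p : ℝ × ℝ) : tanC x₀ ν (framePt x₀ ν p) = p.1 := by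
  have h := unit_sq hν
  simp [framePt, tanC, inner_plane]
  linear_combination p.1 * h

theorem norC_framePt (hν : ‖ν‖ = 1) (p : ℝ × ℝ) : norC x₀ ν (framePt x₀ ν p) = p.2 := by
  have h := unit_sq hν
  simp [framePt, norC, inner_plane]
  linear_combination p.2 * h

theorem continuous_tanC : Continuous (tanC x₀ ν) := by unfold tanC; fun_prop

theorem continuous_norC : Continuous (norC x₀ ν) := by unfold norC; fun_prop

theorem contDiff_tanC : ContDiff ℝ ∞ (tanC x₀ ν) :=
  (contDiff_id.sub contDiff_const).inner ℝ contDiff_const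

theorem continuous_framePt : Continuous (framePt x₀ ν) := by unfold framePt; fun_prop

theorem tanC_add_smul_perp (hν : ‖ν‖ = 1) (y : Plane) (r : ℝ) :
    tanC x₀ ν (y + r • perp ν) = tanC x₀ ν y + r := by
  have h := unit_sq hν
  simp [tanC, inner_plane]
  linear_combination r * h

theorem norC_add_smul_perp (y : Plane) (r : ℝ) :
    norC x₀ ν (y + r • perp ν) = norC x₀ ν y := by
  simp [norC, inner_plane]
  ring

theorem tanC_add_smul_self (y : Plane) (r : ℝ) :
    tanC x₀ ν (y + r • ν) = tanC x₀ ν y := by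
  simp [tanC, inner_plane]
  ring

theorem norC_add_smul_self (hν : ‖ν‖ = 1) (y : Plane) (r : ℝ) :
    norC x₀ ν (y + r • ν) = norC x₀ ν y + r := by
  have h := unit_sq hν
  simp [norC, inner_plane]
  linear_combination r * h

theorem norm_sub_sq_eq (hν : ‖ν‖ = 1) (y z : Plane) :
    ‖y - z‖ ^ 2 = (tanC x₀ ν y - tanC x₀ ν z) ^ 2 + (norC x₀ ν y - norC x₀ ν z) ^ 2 := by
  have h := unit_sq hν
  rw [norm_sq_plane]
  simp [tanC, norC, inner_plane]
  linear_combination (-(y 0 - z 0) ^ 2 - (y 1 - z 1) ^ 2) * h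

theorem abs_tanC_sub_le (hν : ‖ν‖ = 1) (y z : Plane) :
    |tanC x₀ ν y - tanC x₀ ν z| ≤ ‖y - z‖ := by
  refine abs_le_of_sq_le_sq ?_ (norm_nonneg _)
  rw [norm_sub_sq_eq (x₀ := x₀) hν]
  nlinarith [sq_nonneg (norC x₀ ν y - norC x₀ ν z)]

theorem abs_norC_sub_le (hν : ‖ν‖ = 1) (y z : Plane) :
    |norC x₀ ν y - norC x₀ ν z| ≤ ‖y - z‖ := by
  refine abs_le_of_sq_le_sq ?_ (norm_nonneg _)
  rw [norm_sub_sq_eq (x₀ := x₀) hν]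
  nlinarith [sq_nonneg (tanC x₀ ν y - tanC x₀ ν z)]

theorem norm_sub_le_coords (hν : ‖ν‖ = 1) (y z : Plane) :
    ‖y - z‖ ≤ |tanC x₀ ν y - tanC x₀ ν z| + |norC x₀ ν y - norC x₀ ν z| := by
  apply abs_le_of_sq_le_sq' _ (by positivity) |>.2
  rw [norm_sub_sq_eq (x₀ := x₀) hν, add_sq, sq_abs, sq_abs]
  nlinarith [mul_nonneg (abs_nonneg (tanC x₀ ν y - tanC x₀ ν z))
    (abs_nonneg (norC x₀ ν y - norC x₀ ν z))]

@[simp] theorem tanC_self : tanC x₀ ν x₀ = 0 := by simp [tanC]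

@[simp] theorem norC_self : norC x₀ ν x₀ = 0 := by simp [norC]

/-- The coordinates of a unit frame, as a homeomorphism. -/
noncomputable def frameHomeo (x₀ : Plane) {ν : Plane} (hν : ‖ν‖ = 1) : ℝ × ℝ ≃ₜ Plane where
  toFun := framePt x₀ ν
  invFun y := (tanC x₀ ν y, norC x₀ ν y)
  left_inv p := Prod.ext (tanC_framePt hν p) (norC_framePt hν p)
  right_inv y := framePt_tanC_norC hν y
  continuous_toFun := continuous_framePt
  continuous_invFun := continuous_tanC.prodMk continuous_norC

theorem measurableEmbedding_framePt (hν : ‖ν‖ = 1) : MeasurableEmbedding (framePt x₀ ν) :=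
  (frameHomeo x₀ hν).measurableEmbedding

theorem measurePreserving_framePt (hν : ‖ν‖ = 1) :
    MeasurePreserving (framePt x₀ ν) volume volume := by
  have h := unit_sq hν
  let f : Plane →ₗᵢ[ℝ] Plane :=
    { toFun := fun p => p 0 • perp ν + p 1 • ν
      map_add' := fun p q => by simp [add_smul]; abel
      map_smul' := fun c p => by simp [mul_smul]
      norm_map' := fun p => by
        refine (sq_eq_sq₀ (norm_nonneg _) (norm_nonneg _)).1 ?_
        change ‖p 0 • perp ν + p 1 • ν‖ ^ 2 = _
        rw [norm_sq_plane, norm_sq_plane]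
        simp
        linear_combination (p 0 ^ 2 + p 1 ^ 2) * h }
  have h1 := (f.toLinearIsometryEquiv rfl).measurePreserving
  have h2 := PiLp.volume_preserving_toLp (Fin 2)
  have h3 := (volume_preserving_finTwoArrow ℝ).symm
  exact (measurePreserving_add_left volume x₀).comp (h1.comp (h2.comp h3))

theorem integral_framePt (hν : ‖ν‖ = 1) {E : Type*} [NormedAddCommGroup E] [NormedSpace ℝ E]
    (f : Plane → E) : ∫ p, f (framePt x₀ ν p) = ∫ y, f y :=
  (measurePreserving_framePt hν).integral_comp (measurableEmbedding_framePt hν) f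

theorem volume_coords (hν : ‖ν‖ = 1) (A : Set (ℝ × ℝ)) :
    volume {y : Plane | (tanC x₀ ν y, norC x₀ ν y) ∈ A} = volume A := by
  rw [← (measurePreserving_framePt (x₀ := x₀) hν).measure_preimage_emb
    (measurableEmbedding_framePt hν)]
  congr 1
  ext p
  simp [tanC_framePt hν, norC_framePt hν]

/-- An open box in the frame `(perp ν, ν)` centred at `x₀`. -/
def box (x₀ ν : Plane) (α β γ δ : ℝ) : Set Plane :=
  {y | tanC x₀ ν y ∈ Ioo α β ∧ norC x₀ ν y ∈ Ioo γ δ}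

theorem isOpen_box (α β γ δ : ℝ) : IsOpen (box x₀ ν α β γ δ) :=
  (isOpen_Ioo.preimage continuous_tanC).inter (isOpen_Ioo.preimage continuous_norC)

theorem volume_box (hν : ‖ν‖ = 1) (α β γ δ : ℝ) :
    volume (box x₀ ν α β γ δ) = ENNReal.ofReal (β - α) * ENNReal.ofReal (δ - γ) := by
  have := volume_coords (x₀ := x₀) hν (Ioo α β ×ˢ Ioo γ δ)
  rw [Measure.volume_eq_prod, Measure.prod_prod, Real.volume_Ioo, Real.volume_Ioo] at this
  exact this

theorem isCompact_closedBox (hν : ‖ν‖ = 1) (α β γ δ : ℝ) :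
    IsCompact {y | tanC x₀ ν y ∈ Icc α β ∧ norC x₀ ν y ∈ Icc γ δ} := by
  have h := (isCompact_Icc (a := α) (b := β)).prod (isCompact_Icc (a := γ) (b := δ))
  exact (frameHomeo x₀ hν).symm.isCompact_preimage.2 h

end Frame

end HexRhombic

namespace HexRhombic

/-! ### Integration by parts up to the part of the boundary where the trace vanishes -/

/-- By `hmono` nothing of A returns after a point of I outside A, so A ∩ I is an initial part of I,
ending at the infimum of I \ A. The fundamental theorem gives the value of φ there; the first
alternative covers the cases where A contains all or nothing of I. -/
theorem integral_deriv_slice {A I : Set ℝ} (hA : IsOpen A) (hI : I.OrdConnected)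
    (hmono : ∀ r ∈ I, r ∉ A → ∀ r' ∈ I, r < r' → r' ∉ closure A)
    {φ : ℝ → ℝ} (hφ : ContDiff ℝ 1 φ) (hc : HasCompactSupport φ) (hs : tsupport φ ⊆ I) :
    (∫ r in A, deriv φ r) = 0 ∨
      ∃ r ∈ I, r ∈ closure A ∧ r ∉ A ∧ ∫ r in A, deriv φ r = φ r := by
  have h0 : ∀ r ∉ I, deriv φ r = 0 := fun r hr =>
    image_eq_zero_of_notMem_tsupport fun h => hr (hs (tsupport_deriv_subset h))
  have hset : ∀ S : Set ℝ, MeasurableSet S → (∀ r ∈ I, r ∈ A ↔ r ∈ S) →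
      ∫ r in A, deriv φ r = ∫ r in S, deriv φ r := by
    intro S hS h
    rw [← integral_indicator hA.measurableSet, ← integral_indicator hS]
    congr 1
    funext r
    by_cases hr : r ∈ I
    · by_cases hrA : r ∈ A
      · rw [indicator_of_mem hrA, indicator_of_mem ((h r hr).1 hrA)]
      · rw [indicator_of_notMem hrA, indicator_of_notMem fun h' => hrA ((h r hr).2 h')]
    · simp [indicator, h0 r hr]
  by_cases h1 : ∃ r₀ ∈ I, r₀ ∉ A
  swap
  · left
    push Not at h1
    rw [hset univ MeasurableSet.univ fun r hr => by simp [h1 r hr], Measure.restrict_univ]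
    exact integral_eq_zero_of_hasDerivAt_of_integrable
      (fun x => (hφ.differentiable one_ne_zero x).hasDerivAt)
      ((hφ.continuous_deriv le_rfl).integrable_of_hasCompactSupport hc.deriv)
      (hφ.continuous.integrable_of_hasCompactSupport hc)
  by_cases h2 : ∃ r₁ ∈ I, r₁ ∈ A
  swap
  · left
    push Not at h2
    rw [hset ∅ MeasurableSet.empty fun r hr => by simp [h2 r hr]]
    simp
  obtain ⟨r₀, hr₀I, hr₀A⟩ := h1
  obtain ⟨r₁, hr₁I, hr₁A⟩ := h2
  right
  set S : Set ℝ := {r | r ∈ I ∧ r ∉ A} with hS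
  have hlb : ∀ r ∈ S, r₁ ≤ r := by
    intro r hr
    by_contra! hlt
    exact hmono r hr.1 hr.2 r₁ hr₁I hlt (subset_closure hr₁A)
  have hSne : S.Nonempty := ⟨r₀, hr₀I, hr₀A⟩
  have hSbdd : BddBelow S := ⟨r₁, hlb⟩
  have hle : sInf S ≤ r₀ := csInf_le hSbdd ⟨hr₀I, hr₀A⟩
  have hge : r₁ ≤ sInf S := le_csInf hSne hlb
  have hI' : sInf S ∈ I := hI.out hr₁I hr₀I ⟨hge, hle⟩
  have hlow : ∀ r ∈ I, r < sInf S → r ∈ A := by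
    intro r hr hlt
    by_contra hn
    exact absurd (csInf_le hSbdd (show r ∈ S from ⟨hr, hn⟩)) (not_le.2 hlt)
  have hnA : sInf S ∉ A := by
    intro hin
    have hcl := csInf_mem_closure hSne hSbdd
    obtain ⟨r, hrA, hrS⟩ := mem_closure_iff.1 hcl A hA hin
    exact hrS.2 hrA
  have hgt : r₁ < sInf S := lt_of_le_of_ne hge fun h => hnA (h ▸ hr₁A)
  refine ⟨sInf S, hI', ?_, hnA, ?_⟩
  · have : sInf S ∈ closure (Ioo r₁ (sInf S)) := by
      rw [closure_Ioo hgt.ne]; exact right_mem_Icc.2 hgt.le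
    exact closure_mono (fun r hr => hlow r (hI.out hr₁I hI' ⟨hr.1.le, hr.2.le⟩) hr.2) this
  · rw [hset (Iio (sInf S)) measurableSet_Iio, ← integral_Iic_eq_integral_Iio]
    · exact hc.integral_Iic_deriv_eq hφ _
    · intro r hr
      refine ⟨fun h => ?_, fun h => hlow r hr h⟩
      rcases lt_trichotomy r (sInf S) with h' | h' | h'
      · exact h'
      · exact absurd (h' ▸ h) hnA
      · exact absurd (subset_closure h) (hmono _ hI' hnA r hr h')

/-- Projection to the tangential coordinate is 1-Lipschitz and cannot increase ℋ¹. This is how an L²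
norm on the frontier controls an L² norm in the slicing parameter. -/
theorem volume_restrict_image_tanC_le {x₀ ν : Plane} (hν : ‖ν‖ = 1) (E : Set Plane) :
    volume.restrict (tanC x₀ ν '' E) ≤
      ((μH[1] : Measure Plane).restrict E).map (tanC x₀ ν) := by
  have hlip : LipschitzWith 1 (tanC x₀ ν) := LipschitzWith.of_dist_le_mul fun y z => by
    rw [Real.dist_eq, dist_eq_norm, NNReal.coe_one, one_mul]
    exact abs_tanC_sub_le hν y z
  refine Measure.le_iff.2 fun S hS => ?_
  rw [Measure.restrict_apply hS, Measure.map_apply continuous_tanC.measurable hS,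
    Measure.restrict_apply (continuous_tanC.measurable hS), ← hausdorffMeasure_real]
  have h := hlip.hausdorffMeasure_image_le (d := 1) zero_le_one (tanC x₀ ν ⁻¹' S ∩ E)
  simp only [ENNReal.coe_one, ENNReal.one_rpow, one_mul] at h
  refine (measure_mono ?_).trans h
  rintro _ ⟨hs, y, hy, rfl⟩
  exact ⟨y, ⟨hs, hy⟩, rfl⟩

/-- Fubini along lines in direction ξ: each line contributes zero or the value of F at the point
where it leaves Ω. These exit points lie on the frontier and project injectively, so Cauchy–Schwarz
over a shadow of length 2D finishes. -/
theorem enorm_integral_fderiv_le {Ω B : Set Plane} (hΩ : IsOpen Ω) (hB : IsOpen B) (hBc : Convex ℝ B)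
    {ξ : Plane} (hξ : ‖ξ‖ = 1)
    (hmono : ∀ y ∈ B, y ∉ Ω → ∀ r : ℝ, 0 < r → y + r • ξ ∈ B → y + r • ξ ∉ closure Ω)
    {F : Plane → ℝ} (hF : IsTest B F) {D : ℝ} (hD : ∀ x, F x ≠ 0 → tanC 0 ξ x ∈ Icc (-D) D) :
    ‖∫ x in Ω, fderiv ℝ F x ξ‖ₑ ≤
      eLpNorm F 2 ((μH[1] : Measure Plane).restrict (frontier Ω ∩ B)) *
        ENNReal.ofReal (2 * D) ^ (1 / 2 : ℝ) := by
  set ind : Plane → ℝ := Ω.indicator fun x => fderiv ℝ F x ξ with hind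
  set g : ℝ → ℝ := fun s => ∫ h, ind (framePt 0 ξ (s, h)) with hg
  have hint : Integrable ind :=
    ((hF.fderiv_apply ξ).integrable volume).indicator hΩ.measurableSet
  have hint2 : Integrable (fun p : ℝ × ℝ => ind (framePt 0 ξ p)) (volume.prod volume) :=
    (measurePreserving_framePt (x₀ := 0) hξ).integrable_comp_of_integrable hint
  have hcurve : ∀ s h : ℝ, HasDerivAt (fun h : ℝ => F (framePt 0 ξ (s, h)))
      (fderiv ℝ F (framePt 0 ξ (s, h)) ξ) h := by
    intro s h
    have h1 : HasDerivAt (fun h : ℝ => framePt 0 ξ (s, h)) ξ h := by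
      unfold framePt
      simpa using (((hasDerivAt_id h).smul_const ξ).const_add (s • perp ξ)).const_add (0 : Plane)
    exact ((hF.smooth.differentiable (by simp)) _).hasFDerivAt.comp_hasDerivAt h h1
  have hslice : ∀ s, g s = 0 ∨ ∃ y ∈ frontier Ω ∩ B, tanC 0 ξ y = s ∧ g s = F y := by
    intro s
    have hcs : Continuous fun h : ℝ => framePt 0 ξ (s, h) :=
      continuous_framePt.comp (by fun_prop)
    have hce : Topology.IsClosedEmbedding fun h : ℝ => framePt 0 ξ (s, h) :=
      (frameHomeo 0 hξ).isClosedEmbedding.comp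
        (Topology.IsClosedEmbedding.of_continuous_injective_isClosedMap (by fun_prop)
          (fun a b hab => (Prod.ext_iff.1 hab).2) (isClosedMap_prodMk_left s))
    set A : Set ℝ := (fun h : ℝ => framePt 0 ξ (s, h)) ⁻¹' Ω with hAdef
    set I : Set ℝ := (fun h : ℝ => framePt 0 ξ (s, h)) ⁻¹' B with hIdef
    set φ : ℝ → ℝ := fun h => F (framePt 0 ξ (s, h)) with hφdef
    have hφs : ContDiff ℝ 1 φ := by
      have : ContDiff ℝ ∞ φ := hF.smooth.comp (by unfold framePt; fun_prop)
      exact this.of_le (by simp)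
    have hφc : HasCompactSupport φ := hF.compact.comp_isClosedEmbedding hce
    have hφt : tsupport φ ⊆ I := fun h hh => hF.support (tsupport_comp_subset_preimage F hcs hh)
    have hdφ : deriv φ = fun h => fderiv ℝ F (framePt 0 ξ (s, h)) ξ :=
      funext fun h => (hcurve s h).deriv
    have hgA : g s = ∫ h in A, deriv φ h := by
      rw [hg, ← integral_indicator (hΩ.preimage hcs).measurableSet, hdφ]
      rfl
    have hmove : ∀ h h' : ℝ, framePt 0 ξ (s, h') = framePt 0 ξ (s, h) + (h' - h) • ξ := by
      intro h h'
      simp only [framePt]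
      module
    have hclA : ∀ h ∈ closure A, framePt 0 ξ (s, h) ∈ closure Ω := fun h hh =>
      closure_mono (image_preimage_subset _ _) (image_closure_subset_closure_image hcs ⟨h, hh, rfl⟩)
    have hIord : I.OrdConnected := by
      refine ⟨fun a ha b hb c hc => ?_⟩
      rcases eq_or_lt_of_le (hc.1.trans hc.2) with hab | hab
      · have : c = a := le_antisymm (hab ▸ hc.2) hc.1
        exact this ▸ ha
      refine hBc.segment_subset ha hb ?_
      rw [segment_eq_image_lineMap]
      refine ⟨(c - a) / (b - a), ⟨?_, ?_⟩, ?_⟩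
      · exact div_nonneg (sub_nonneg.2 hc.1) (sub_nonneg.2 hab.le)
      · exact div_le_one_of_le₀ (by linarith [hc.2]) (by linarith)
      · have hne : b - a ≠ 0 := by linarith
        change _ = framePt 0 ξ (s, c)
        rw [AffineMap.lineMap_apply]
        change ((c - a) / (b - a)) • (framePt 0 ξ (s, b) -ᵥ framePt 0 ξ (s, a)) +ᵥ
          framePt 0 ξ (s, a) = _
        rw [hmove a b, hmove a c]
        simp only [vsub_eq_sub, vadd_eq_add, add_sub_cancel_left, smul_smul]
        rw [div_mul_cancel₀ _ hne, add_comm]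
    have hm : ∀ r ∈ I, r ∉ A → ∀ r' ∈ I, r < r' → r' ∉ closure A := by
      intro r hrI hrA r' hr'I hlt hcl
      refine hmono _ hrI hrA (r' - r) (sub_pos.2 hlt) ?_ ?_
      · rw [← hmove]; exact hr'I
      · rw [← hmove]; exact hclA r' hcl
    rcases integral_deriv_slice (hΩ.preimage hcs) hIord hm hφs hφc hφt with h | h
    · left; rw [hgA, h]
    · right
      obtain ⟨r, hrI, hrc, hrA, hr⟩ := h
      refine ⟨framePt 0 ξ (s, r), ⟨?_, hrI⟩, tanC_framePt hξ _, by rw [hgA, hr]⟩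
      rw [hΩ.frontier_eq]
      exact ⟨hclA r hrc, hrA⟩
  -- Of two frontier points on one line, the later one would be in the closure of Ω beyond a point
  -- outside Ω, against `hmono`.
  have huniq : ∀ y ∈ frontier Ω ∩ B, ∀ z ∈ frontier Ω ∩ B, tanC 0 ξ y = tanC 0 ξ z → y = z := by
    have key : ∀ y ∈ frontier Ω ∩ B, ∀ z ∈ frontier Ω ∩ B, tanC 0 ξ y = tanC 0 ξ z →
        ¬ norC 0 ξ y < norC 0 ξ z := by
      intro y hy z hz hyz hlt
      rw [hΩ.frontier_eq] at hy hz
      have hz' : z = y + (norC 0 ξ z - norC 0 ξ y) • ξ := by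
        conv_lhs => rw [← framePt_tanC_norC (x₀ := 0) hξ z, ← hyz]
        conv_rhs => rw [← framePt_tanC_norC (x₀ := 0) hξ y]
        rw [norC_framePt hξ]
        simp only [framePt]
        module
      exact hmono y hy.2 hy.1.2 (norC 0 ξ z - norC 0 ξ y) (sub_pos.2 hlt) (hz' ▸ hz.2) (hz' ▸ hz.1.1)
    intro y hy z hz hyz
    have h1 : norC 0 ξ y = norC 0 ξ z :=
      le_antisymm (not_lt.1 (key z hz y hy hyz.symm)) (not_lt.1 (key y hy z hz hyz))
    rw [← framePt_tanC_norC (x₀ := 0) hξ y, ← framePt_tanC_norC (x₀ := 0) hξ z, hyz, h1]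
  have hgF : ∀ y ∈ frontier Ω ∩ B, ‖g (tanC 0 ξ y)‖ₑ ≤ ‖F y‖ₑ := by
    intro y hy
    rcases hslice (tanC 0 ξ y) with h | ⟨z, hz, hzy, h⟩
    · rw [h]; simp
    · rw [h, huniq z hz y hy hzy]
  have hgD : ∀ s ∉ Icc (-D) D, g s = 0 := by
    intro s hs
    rcases hslice s with h | ⟨z, hz, hzy, h⟩
    · exact h
    · rw [h]; by_contra hne; exact hs (hzy ▸ hD z hne)
  have hgint : Integrable g := hint2.integral_prod_left
  have htotal : ∫ x in Ω, fderiv ℝ F x ξ = ∫ s in Icc (-D) D, g s := by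
    rw [← integral_indicator hΩ.measurableSet, ← integral_framePt (x₀ := 0) hξ,
      Measure.volume_eq_prod, integral_prod _ hint2]
    exact (setIntegral_eq_integral_of_forall_compl_eq_zero hgD).symm
  have hL2 : eLpNorm g 2 volume ≤
      eLpNorm F 2 ((μH[1] : Measure Plane).restrict (frontier Ω ∩ B)) := by
    have hsupp : ∀ s ∉ tanC 0 ξ '' (frontier Ω ∩ B), g s = 0 := by
      intro s hs
      rcases hslice s with h | ⟨z, hz, hzy, h⟩
      · exact h
      · exact absurd ⟨z, hz, hzy⟩ hs
    rw [eLpNorm_eq_lintegral_rpow_enorm_toReal (by simp) (by simp),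
      eLpNorm_eq_lintegral_rpow_enorm_toReal (by simp) (by simp)]
    gcongr ?_ ^ _
    have e1 : ∫⁻ s, ‖g s‖ₑ ^ (2 : ℝ≥0∞).toReal =
        ∫⁻ s in tanC 0 ξ '' (frontier Ω ∩ B), ‖g s‖ₑ ^ (2 : ℝ≥0∞).toReal := by
      refine (setLIntegral_eq_of_support_subset ?_).symm
      intro s hs
      by_contra hn
      exact hs (by simp [hsupp s hn])
    rw [e1]
    calc _ ≤ ∫⁻ s, ‖g s‖ₑ ^ (2 : ℝ≥0∞).toReal
          ∂((μH[1] : Measure Plane).restrict (frontier Ω ∩ B)).map (tanC 0 ξ) :=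
          lintegral_mono' (volume_restrict_image_tanC_le hξ _) le_rfl
      _ ≤ ∫⁻ y in frontier Ω ∩ B, ‖g (tanC 0 ξ y)‖ₑ ^ (2 : ℝ≥0∞).toReal ∂μH[1] :=
          lintegral_map_le _ _
      _ ≤ _ := by
          refine lintegral_mono_ae ?_
          refine (ae_restrict_iff' ?_).2 (Eventually.of_forall fun y hy => ?_)
          · exact isClosed_frontier.measurableSet.inter hB.measurableSet
          · gcongr
            exact hgF y hy
  rw [htotal]
  calc _ ≤ eLpNorm g 1 (volume.restrict (Icc (-D) D)) := by
        rw [eLpNorm_one_eq_lintegral_enorm]; exact enorm_integral_le_lintegral_enorm _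
    _ ≤ eLpNorm g 2 (volume.restrict (Icc (-D) D)) *
        (volume.restrict (Icc (-D) D)) univ ^ (1 / (1 : ℝ≥0∞).toReal - 1 / (2 : ℝ≥0∞).toReal) :=
        eLpNorm_le_eLpNorm_mul_rpow_measure_univ (by norm_num) hgint.1.restrict
    _ ≤ _ := by
        gcongr
        · exact (eLpNorm_restrict_le _ _ _ _).trans hL2
        · simp only [Measure.restrict_apply_univ, Real.volume_Icc, ENNReal.toReal_one]
          rw [show D - -D = 2 * D by ring]
          norm_num


/-- The quadratic form of a matrix. -/
def quad (A : Mat) (ξ : Plane) : ℝ := ∑ i, ∑ j, ξ i * ξ j * A i j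

theorem tendsto_integral_mul_of_eLpNorm {α : Type*} [MeasurableSpace α] {μ : Measure α}
    {f : ℕ → α → ℝ} {f₀ g : α → ℝ} (hf : ∀ k, MemLp (f k) 2 μ) (hf₀ : MemLp f₀ 2 μ)
    (hg : MemLp g 2 μ) (h : Tendsto (fun k => eLpNorm (fun x => f k x - f₀ x) 2 μ) atTop (𝓝 0)) :
    Tendsto (fun k => ∫ x, f k x * g x ∂μ) atTop (𝓝 (∫ x, f₀ x * g x ∂μ)) := by
  refine tendsto_integral_of_L1' _ (hf₀.integrable_mul hg).1
    (Eventually.of_forall fun k => (hf k).integrable_mul hg) ?_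
  have hb : ∀ k, eLpNorm ((fun x => f k x * g x) - fun x => f₀ x * g x) 1 μ ≤
      eLpNorm (fun x => f k x - f₀ x) 2 μ * eLpNorm g 2 μ := by
    intro k
    have e : ((fun x => f k x * g x) - fun x => f₀ x * g x) =
        (fun x => f k x - f₀ x) • g := by
      funext x; simp [sub_mul]
    rw [e]
    exact eLpNorm_smul_le_mul_eLpNorm hg.1 ((hf k).1.sub hf₀.1)
  refine tendsto_of_tendsto_of_tendsto_of_le_of_le tendsto_const_nhds ?_ (fun _ => zero_le) hb
  simpa using ENNReal.Tendsto.mul_const h (Or.inr hg.2.ne)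

/-- The matrix of partial derivatives of a vector field. -/
noncomputable def gradMat (w : Plane → Plane) (x : Plane) : Mat :=
  Matrix.of fun i j => fderiv ℝ w x (unitVec j) i

theorem fderiv_inner_const {w : Plane → Plane} (hw : ContDiff ℝ ∞ w) (ξ : Plane) (x : Plane) :
    fderiv ℝ (fun y => inner ℝ (w y) ξ) x ξ =
      quad (gradMat w x) ξ := by
  have hd : HasFDerivAt w (fderiv ℝ w x) x := ((hw.differentiable (by simp)) x).hasFDerivAt
  have h1 := (hd.inner ℝ (hasFDerivAt_const ξ x)).fderiv
  rw [h1]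
  have hξ : ξ = ξ 0 • unitVec 0 + ξ 1 • unitVec 1 := by
    apply plane_ext <;> simp [unitVec]
  have h2 : fderiv ℝ w x ξ = ξ 0 • fderiv ℝ w x (unitVec 0) + ξ 1 • fderiv ℝ w x (unitVec 1) := by
    conv_lhs => rw [hξ]
    simp
  simp [quad, gradMat, Fin.sum_univ_two, h2, inner_plane]
  ring

theorem W12.memLp_inner {Ω : Set Plane} (v : W12 Ω) (ξ : Plane) :
    MemLp (fun x => inner ℝ (v.toFun x) ξ) 2 (volume.restrict Ω) := by
  exact v.memLp.inner_const ξ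

theorem W12.memLp_quad {Ω : Set Plane} (v : W12 Ω) (ξ : Plane) :
    MemLp (fun x => quad (v.grad x) ξ) 2 (volume.restrict Ω) :=
  memLp_finsetSum _ fun i _ => memLp_finsetSum _ fun j _ => (v.grad_memLp i j).const_mul _

/-- Extension by zero across the part of the frontier in B. For smooth approximants the boundary
term is bounded by their L² norm on that part, which tends to 0 because the trace is 0 there.
Pairing the component ξ with the derivative ξ keeps only the quadratic form of the gradient, that
is, of the strain. -/
theorem W12.integral_inner_fderiv_of_trace {Ω B : Set Plane} (hΩ : IsOpen Ω) (hB : IsOpen B)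
    (hBc : Convex ℝ B) {v : W12 Ω} {T : Plane → Plane} (hT : v.HasTrace T)
    (hT0 : ∀ᵐ x ∂((μH[1] : Measure Plane).restrict (frontier Ω ∩ B)), T x = 0) {ξ : Plane}
    (hξ : ‖ξ‖ = 1)
    (hmono : ∀ y ∈ B, y ∉ Ω → ∀ r : ℝ, 0 < r → y + r • ξ ∈ B → y + r • ξ ∉ closure Ω)
    {φ : Plane → ℝ} (hφ : IsTest B φ) :
    ∫ x in Ω, inner ℝ (v.toFun x) ξ * fderiv ℝ φ x ξ =
      -∫ x in Ω, quad (v.grad x) ξ * φ x := by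
  obtain ⟨-, w, hw, hw0, hw1, hwT⟩ := hT
  have hwL : ∀ k, MemLp (fun x => inner ℝ (w k x) ξ) 2 (volume.restrict Ω) := fun k =>
    ((hw k).1.continuous.memLp_of_hasCompactSupport (hw k).2).inner_const ξ
  have hdL : ∀ k i j, MemLp (fun x => fderiv ℝ (w k) x (unitVec j) i) 2 (volume.restrict Ω) := by
    intro k i j
    have hc : Continuous fun x => fderiv ℝ (w k) x (unitVec j) i := by
      have := (hw k).1.continuous_fderiv (by simp)
      fun_prop
    refine hc.memLp_of_hasCompactSupport (HasCompactSupport.intro (hw k).2 fun x hx => ?_)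
    rw [fderiv_of_notMem_tsupport ℝ hx]; rfl
  have hA : Tendsto (fun k => ∫ x in Ω, inner ℝ (w k x) ξ * fderiv ℝ φ x ξ) atTop
      (𝓝 (∫ x in Ω, inner ℝ (v.toFun x) ξ * fderiv ℝ φ x ξ)) := by
    refine tendsto_integral_mul_of_eLpNorm hwL (v.memLp_inner ξ)
      ((hφ.fderiv_apply ξ).memLp 2 _) ?_
    refine tendsto_of_tendsto_of_tendsto_of_le_of_le tendsto_const_nhds hw0 (fun _ => zero_le)
      fun k => eLpNorm_mono fun x => ?_
    rw [← inner_sub_left]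
    simpa [hξ] using norm_inner_le_norm (𝕜 := ℝ) (w k x - v.toFun x) ξ
  have hB1 : ∀ i j, Tendsto (fun k => ∫ x in Ω, fderiv ℝ (w k) x (unitVec j) i * φ x) atTop
      (𝓝 (∫ x in Ω, v.grad x i j * φ x)) := fun i j =>
    tendsto_integral_mul_of_eLpNorm (fun k => hdL k i j) (v.grad_memLp i j) (hφ.memLp 2 _) (hw1 i j)
  have hquad : ∀ M : Plane → Mat, (∀ i j, MemLp (fun x => M x i j) 2 (volume.restrict Ω)) →
      ∫ x in Ω, quad (M x) ξ * φ x = ∑ i, ∑ j, ξ i * ξ j * ∫ x in Ω, M x i j * φ x := by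
    intro M hM
    have hi : ∀ i j, Integrable (fun x => ξ i * ξ j * (M x i j * φ x)) (volume.restrict Ω) :=
      fun i j => ((hM i j).integrable_mul (hφ.memLp 2 _)).const_mul _
    simp only [quad, Finset.sum_mul, mul_assoc] at hi ⊢
    rw [integral_finsetSum _ fun i _ => integrable_finsetSum _ fun j _ => hi i j]
    refine Finset.sum_congr rfl fun i _ => ?_
    rw [integral_finsetSum _ fun j _ => hi i j]
    refine Finset.sum_congr rfl fun j _ => ?_
    rw [integral_const_mul, integral_const_mul]
  have hC : Tendsto (fun k => ∫ x in Ω, quad (gradMat (w k) x) ξ * φ x)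
      atTop (𝓝 (∫ x in Ω, quad (v.grad x) ξ * φ x)) := by
    rw [hquad _ v.grad_memLp]
    simp_rw [fun k => hquad (gradMat (w k)) (hdL k)]
    exact tendsto_finsetSum _ fun i _ => tendsto_finsetSum _ fun j _ => (hB1 i j).const_mul _
  set F : ℕ → Plane → ℝ := fun k x => φ x * inner ℝ (w k x) ξ with hFdef
  have hF : ∀ k, IsTest B (F k) := fun k => hφ.mul_smooth ((hw k).1.inner ℝ contDiff_const)
  have hsum : ∀ k, ∫ x in Ω, fderiv ℝ (F k) x ξ =
      (∫ x in Ω, inner ℝ (w k x) ξ * fderiv ℝ φ x ξ) +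
        ∫ x in Ω, quad (gradMat (w k) x) ξ * φ x := by
    intro k
    have hi1 : Integrable (fun x => inner ℝ (w k x) ξ * fderiv ℝ φ x ξ) (volume.restrict Ω) :=
      (hwL k).integrable_mul ((hφ.fderiv_apply ξ).memLp 2 _)
    rw [← integral_add hi1]
    · congr 1
      funext x
      have h1 := (hφ.smooth.differentiable (by simp) x).hasFDerivAt
      have h2 : DifferentiableAt ℝ (fun x => inner ℝ (w k x) ξ) x :=
        ((hw k).1.inner ℝ contDiff_const).differentiable (n := ∞) (by simp) x
      have h3 : fderiv ℝ (F k) x = _ := (h1.mul h2.hasFDerivAt).fderiv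
      rw [h3]
      simp only [_root_.add_apply, _root_.smul_apply, smul_eq_mul]
      rw [fderiv_inner_const (hw k).1]
      ring
    · refine MemLp.integrable_mul (p := 2) (q := 2) ?_ (hφ.memLp 2 _)
      exact memLp_finsetSum _ fun i _ => memLp_finsetSum _ fun j _ => (hdL k i j).const_mul _
  obtain ⟨Cφ, hCφ, hCφ'⟩ := hφ.exists_bound
  obtain ⟨D, hD⟩ := (hφ.compact.image (continuous_tanC (x₀ := 0) (ν := ξ))).isBounded.subset_closedBall 0
  have hDF : ∀ k x, F k x ≠ 0 → tanC 0 ξ x ∈ Icc (-D) D := by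
    intro k x hx
    have hx' : x ∈ tsupport φ := by
      by_contra hn
      exact hx (by simp [hFdef, image_eq_zero_of_notMem_tsupport hn])
    have := hD ⟨x, hx', rfl⟩
    rw [Real.closedBall_eq_Icc] at this
    simpa using this
  -- On the frontier inside B the product φ (w_k·ξ) is at most a constant times |w_k − T|, since T =
  -- 0 there.
  have hzero : Tendsto (fun k => ∫ x in Ω, fderiv ℝ (F k) x ξ) atTop (𝓝 0) := by
    rw [tendsto_zero_iff_enorm_tendsto_zero]
    have hle : ∀ k, ‖∫ x in Ω, fderiv ℝ (F k) x ξ‖ₑ ≤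
        (ENNReal.ofReal Cφ * eLpNorm (fun x => w k x - T x) 2
          ((μH[1] : Measure Plane).restrict (frontier Ω))) *
        ENNReal.ofReal (2 * D) ^ (1 / 2 : ℝ) := by
      intro k
      refine (enorm_integral_fderiv_le hΩ hB hBc hξ hmono (hF k) (hDF k)).trans ?_
      gcongr
      have h1 : eLpNorm (F k) 2 ((μH[1] : Measure Plane).restrict (frontier Ω ∩ B)) ≤
          ENNReal.ofReal Cφ * eLpNorm (fun x => w k x - T x) 2
            ((μH[1] : Measure Plane).restrict (frontier Ω ∩ B)) := by
        refine eLpNorm_le_mul_eLpNorm_of_ae_le_mul ?_ 2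
        filter_upwards [hT0] with x hx
        rw [hx, sub_zero, hFdef, norm_mul]
        gcongr
        · exact hCφ' x
        · simpa [hξ] using norm_inner_le_norm (𝕜 := ℝ) (w k x) ξ
      refine h1.trans ?_
      gcongr
      exact inter_subset_left
    refine tendsto_of_tendsto_of_tendsto_of_le_of_le tendsto_const_nhds ?_ (fun _ => zero_le) hle
    have h2 := ENNReal.Tendsto.mul_const (b := ENNReal.ofReal (2 * D) ^ (1 / 2 : ℝ))
      (ENNReal.Tendsto.const_mul (a := ENNReal.ofReal Cφ) hwT (Or.inr (by simp)))
      (Or.inr (ENNReal.rpow_ne_top_of_nonneg (by norm_num) ENNReal.ofReal_ne_top))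
    simpa using h2
  have h3 := (hA.add hC).congr fun k => (hsum k).symm
  have h4 := tendsto_nhds_unique h3 hzero
  linarith

end HexRhombic

namespace HexRhombic

/-! ### Mollification -/

/-- A bump function supported in the ball of radius `1 / (n + 1)`. -/
noncomputable def bump (n : ℕ) : ContDiffBump (0 : Plane) where
  rIn := 1 / (n + 1) / 2
  rOut := 1 / (n + 1)
  rIn_pos := by positivity
  rIn_lt_rOut := half_lt_self (by positivity)

/-- Mollification of a scalar function. -/
noncomputable def moll (n : ℕ) (g : Plane → ℝ) : Plane → ℝ :=
  convolution ((bump n).normed volume) g (ContinuousLinearMap.lsmul ℝ ℝ) volume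

theorem moll_apply (n : ℕ) (g : Plane → ℝ) (x : Plane) :
    moll n g x = ∫ t, (bump n).normed volume t * g (x - t) := rfl

theorem moll_apply' (n : ℕ) (g : Plane → ℝ) (x : Plane) :
    moll n g x = ∫ y, g y * (bump n).normed volume (x - y) := by
  rw [moll, convolution_eq_swap]
  simp [mul_comm]

theorem contDiff_moll {g : Plane → ℝ} (hg : LocallyIntegrable g volume) (n : ℕ) :
    ContDiff ℝ ∞ (moll n g) :=
  (bump n).hasCompactSupport_normed.contDiff_convolution_left (n := ⊤) _
    (bump n).contDiff_normed hg

theorem abs_moll_le {g : Plane → ℝ} {B : ℝ} (hB : ∀ x, |g x| ≤ B) (n : ℕ) (x : Plane) :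
    |moll n g x| ≤ B := by
  rw [moll_apply, ← Real.norm_eq_abs]
  have h := norm_integral_le_of_norm_le (f := fun t => (bump n).normed volume t * g (x - t))
    ((bump n).integrable_normed (μ := volume) |>.mul_const B)
    (Eventually.of_forall fun t => by
      rw [norm_mul, Real.norm_of_nonneg ((bump n).nonneg_normed t)]
      exact mul_le_mul_of_nonneg_left (hB _) ((bump n).nonneg_normed t))
  rwa [integral_mul_const, (bump n).integral_normed, one_mul] at h

theorem bump_normed_eq_zero {n : ℕ} {t : Plane} (ht : 1 / ((n : ℝ) + 1) ≤ ‖t‖) :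
    (bump n).normed volume t = 0 := by
  by_contra hne
  have : t ∈ Function.support ((bump n).normed volume) := hne
  rw [(bump n).support_normed_eq, Metric.mem_ball, dist_zero_right] at this
  exact absurd this (not_lt.2 ht)

theorem moll_eq_zero {g : Plane → ℝ} {n : ℕ} {x : Plane}
    (h : ∀ y, ‖x - y‖ < 1 / ((n : ℝ) + 1) → g y = 0) : moll n g x = 0 := by
  rw [moll_apply]
  refine integral_eq_zero_of_ae (Eventually.of_forall fun t => ?_)
  rcases lt_or_ge ‖t‖ (1 / ((n : ℝ) + 1)) with ht | ht
  · simp [h (x - t) (by simpa using ht)]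
  · simp [bump_normed_eq_zero ht]

theorem ae_tendsto_moll {g : Plane → ℝ} (hg : LocallyIntegrable g volume) :
    ∀ᵐ x, Tendsto (fun n => moll n g x) atTop (𝓝 (g x)) :=
  ContDiffBump.ae_convolution_tendsto_right_of_locallyIntegrable (φ := bump) (K := 2)
    tendsto_one_div_add_atTop_nhds_zero_nat
    (Eventually.of_forall fun n => by simp only [bump]; linarith) hg

theorem isTest_moll {g : Plane → ℝ} {K R : Set Plane} (hK : IsCompact K) (hR : IsOpen R)
    (hKR : K ⊆ R) (hg : LocallyIntegrable g volume) (h0 : ∀ x ∉ K, g x = 0) :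
    ∀ᶠ n in atTop, IsTest R (moll n g) := by
  obtain ⟨δ, hδ, hsub⟩ := hK.exists_cthickening_subset_open hR hKR
  have h1 : ∀ᶠ n : ℕ in atTop, 1 / ((n : ℝ) + 1) < δ :=
    tendsto_one_div_add_atTop_nhds_zero_nat.eventually_lt_const hδ
  filter_upwards [h1] with n hn
  refine isTest_of_eq_zero (contDiff_moll hg n) hK.cthickening hsub fun x hx => ?_
  refine moll_eq_zero fun y hy => h0 y fun hyK => hx ?_
  exact Metric.mem_cthickening_of_dist_le x y δ K hyK (by rw [dist_eq_norm]; linarith)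

/-- The sign of f on K is the ideal test function. Its mollifications stay bounded by 1 and, K being
compact in R, are eventually supported in R; dominated convergence passes to the limit. -/
theorem setIntegral_abs_le_of_forall_test {Ω R K : Set Plane}
    (hR : IsOpen R) (hK : IsCompact K) (hKR : K ⊆ R) (hRΩ : R ⊆ Ω) {f : Plane → ℝ}
    (hf : IntegrableOn f Ω) {B : ℝ}
    (hB : ∀ θ : Plane → ℝ, IsTest R θ → (∀ x, |θ x| ≤ 1) → ∫ x in Ω, f x * θ x ≤ B) :
    ∫ x in K, |f x| ≤ B := by
  set f₀ := hf.1.mk f with hf₀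
  have hf₀m : Measurable f₀ := hf.1.stronglyMeasurable_mk.measurable
  have hff₀ : f =ᵐ[volume.restrict Ω] f₀ := hf.1.ae_eq_mk
  set g : Plane → ℝ := K.indicator fun x => if 0 ≤ f₀ x then 1 else -1 with hg
  have hgm : Measurable g := by
    refine Measurable.indicator ?_ hK.measurableSet
    exact Measurable.ite (measurableSet_le measurable_const hf₀m) measurable_const measurable_const
  have hg1 : ∀ x, |g x| ≤ 1 := by
    intro x
    by_cases hx : x ∈ K
    · rw [hg, indicator_of_mem hx]; split_ifs <;> simp
    · rw [hg, indicator_of_notMem hx]; simp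
  have hgl : LocallyIntegrable g volume := by
    refine (locallyIntegrable_const (1 : ℝ)).mono hgm.aestronglyMeasurable ?_
    exact Eventually.of_forall fun x => by simpa using hg1 x
  have hlim : Tendsto (fun n => ∫ x in Ω, f x * moll n g x) atTop (𝓝 (∫ x in Ω, f x * g x)) := by
    refine tendsto_integral_of_dominated_convergence (fun x => ‖f x‖)
      (fun n => hf.1.mul (contDiff_moll hgl n).continuous.aestronglyMeasurable) hf.norm ?_ ?_
    · intro n
      refine Eventually.of_forall fun x => ?_
      rw [norm_mul]
      exact mul_le_of_le_one_right (norm_nonneg _) (abs_moll_le hg1 n x)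
    · filter_upwards [ae_restrict_of_ae (ae_tendsto_moll hgl)] with x hx
      exact hx.const_mul _
  have hle : ∫ x in Ω, f x * g x ≤ B := by
    refine le_of_tendsto hlim ?_
    filter_upwards [isTest_moll hK hR hKR hgl fun x hx => indicator_of_notMem hx _] with n hn
    exact hB _ hn (abs_moll_le hg1 n)
  refine le_trans (le_of_eq ?_) hle
  rw [← integral_indicator hK.measurableSet,
    ← setIntegral_eq_integral_of_forall_compl_eq_zero (s := Ω)]
  · refine integral_congr_ae ?_
    filter_upwards [hff₀] with x hx
    by_cases hxK : x ∈ K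
    · rw [indicator_of_mem hxK, hg, indicator_of_mem hxK, hx]
      split_ifs with h
      · rw [abs_of_nonneg h, mul_one]
      · rw [abs_of_neg (not_le.1 h)]; ring
    · rw [indicator_of_notMem hxK, hg, indicator_of_notMem hxK, mul_zero]
  · intro x hx
    exact indicator_of_notMem (fun h => hx (hRΩ (hKR h))) _

/-! ### Directional variation -/

/-- The variation in `R` of the derivative in direction `τ` of `τ · ∇v τ`. -/
noncomputable def W12.dirVar {Ω : Set Plane} (v : W12 Ω) (τ : Plane) (R : Set Plane) : ℝ≥0∞ :=
  ⨆ φ : {φ : Plane → ℝ // IsTest R φ ∧ ∀ x, |φ x| ≤ 1},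
    ENNReal.ofReal (∫ x in Ω, quad (v.grad x) τ * fderiv ℝ φ.1 x τ)

theorem W12.dirVar_mono {Ω : Set Plane} (v : W12 Ω) (τ : Plane) {R R' : Set Plane} (h : R ⊆ R') :
    v.dirVar τ R ≤ v.dirVar τ R' :=
  iSup_le fun φ => le_iSup_of_le ⟨φ.1, φ.2.1.mono h, φ.2.2⟩ le_rfl

theorem W12.integrable_quad_mul {Ω : Set Plane} (v : W12 Ω) (ξ : Plane) {R : Set Plane}
    {φ : Plane → ℝ} (hφ : IsTest R φ) :
    Integrable (fun x => quad (v.grad x) ξ * φ x) (volume.restrict Ω) :=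
  (v.memLp_quad ξ).integrable_mul (hφ.memLp 2 _)

theorem fderiv_add_apply {φ ψ : Plane → ℝ} {R R' : Set Plane} (hφ : IsTest R φ)
    (hψ : IsTest R' ψ) (x ξ : Plane) :
    fderiv ℝ (fun y => φ y + ψ y) x ξ = fderiv ℝ φ x ξ + fderiv ℝ ψ x ξ := by
  have h : fderiv ℝ (fun y => φ y + ψ y) x = _ := fderiv_add
    (hφ.smooth.differentiable (by simp) x) (hψ.smooth.differentiable (by simp) x)
  rw [h]; rfl

theorem fderiv_const_mul_apply {φ : Plane → ℝ} {R : Set Plane} (hφ : IsTest R φ) (c : ℝ)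
    (x ξ : Plane) : fderiv ℝ (fun y => c * φ y) x ξ = c * fderiv ℝ φ x ξ := by
  rw [fderiv_const_mul (hφ.smooth.differentiable (by simp) x)]; rfl

/-- Test functions of two disjoint sets add up to a test function still bounded by 1. Negative
integrals are replaced by 0 first, since the supremum truncates them. -/
theorem W12.dirVar_add_le {Ω : Set Plane} (v : W12 Ω) (τ : Plane) {R R' : Set Plane}
    (h : Disjoint R R') : v.dirVar τ R + v.dirVar τ R' ≤ v.dirVar τ (R ∪ R') := by
  have hne : ∀ S : Set Plane, Nonempty {φ : Plane → ℝ // IsTest S φ ∧ ∀ x, |φ x| ≤ 1} :=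
    fun S => ⟨⟨fun _ => 0, IsTest.zero S, by simp⟩⟩
  have := hne R
  have := hne R'
  refine ENNReal.iSup_add_iSup_le fun φ ψ => ?_
  rcases le_total (∫ x in Ω, quad (v.grad x) τ * fderiv ℝ φ.1 x τ) 0 with h1 | h1
  · rw [ENNReal.ofReal_of_nonpos h1, zero_add]
    exact le_iSup_of_le ⟨ψ.1, ψ.2.1.mono subset_union_right, ψ.2.2⟩ le_rfl
  rcases le_total (∫ x in Ω, quad (v.grad x) τ * fderiv ℝ ψ.1 x τ) 0 with h2 | h2
  · rw [ENNReal.ofReal_of_nonpos h2, add_zero]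
    exact le_iSup_of_le ⟨φ.1, φ.2.1.mono subset_union_left, φ.2.2⟩ le_rfl
  rw [← ENNReal.ofReal_add h1 h2]
  refine le_iSup_of_le ⟨fun x => φ.1 x + ψ.1 x, (φ.2.1.mono subset_union_left).add
    (ψ.2.1.mono subset_union_right), fun x => ?_⟩ (ENNReal.ofReal_le_ofReal (le_of_eq ?_))
  · change |φ.1 x + ψ.1 x| ≤ 1
    by_cases hx : x ∈ R
    · rw [ψ.2.1.eq_zero (disjoint_left.1 h hx), add_zero]; exact φ.2.2 x
    · rw [φ.2.1.eq_zero hx, zero_add]; exact ψ.2.2 x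
  · rw [← integral_add (v.integrable_quad_mul τ (φ.2.1.fderiv_apply τ))
      (v.integrable_quad_mul τ (ψ.2.1.fderiv_apply τ))]
    congr 1
    funext x
    rw [fderiv_add_apply φ.2.1 ψ.2.1]
    ring

theorem W12.sum_dirVar_le {Ω : Set Plane} (v : W12 Ω) (τ : Plane) {ι : Type*} (s : Finset ι)
    (R : ι → Set Plane) (hd : (s : Set ι).PairwiseDisjoint R) :
    ∑ i ∈ s, v.dirVar τ (R i) ≤ v.dirVar τ (⋃ i ∈ s, R i) := by
  classical
  induction s using Finset.induction_on with
  | empty => simp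
  | insert a s ha ih =>
    rw [Finset.sum_insert ha, Finset.set_biUnion_insert]
    refine (add_le_add le_rfl (ih (hd.subset (by simp)))).trans (v.dirVar_add_le τ ?_)
    rw [disjoint_iUnion₂_right]
    intro i hi
    exact hd (by simp) (by simp [hi]) (by rintro rfl; exact ha hi)

/-- The field φ τ⊗τ⊗τ has pointwise norm |φ| because τ is a unit vector. -/
theorem W12.dirVar_le_hessianVariation {Ω : Set Plane} (v : W12 Ω) {τ : Plane} (hτ : ‖τ‖ = 1) :
    v.dirVar τ Ω ≤ v.hessianVariation := by
  refine iSup_le fun φ => ?_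
  have hsq := unit_sq hτ
  have htest : ∀ i j k, IsTest Ω fun x => τ i * τ j * τ k * φ.1 x := fun i j k =>
    φ.2.1.const_mul _
  refine le_iSup₂_of_le (fun x i j k => τ i * τ j * τ k * φ.1 x) ⟨htest, fun x => ?_⟩
    (ENNReal.ofReal_le_ofReal (le_of_eq ?_))
  · have h1 : φ.1 x ^ 2 ≤ 1 := by
      rw [← sq_abs]; exact pow_le_one₀ (abs_nonneg _) (φ.2.2 x)
    simp only [Fin.sum_univ_two]
    calc _ = (τ 0 ^ 2 + τ 1 ^ 2) ^ 3 * φ.1 x ^ 2 := by ring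
      _ ≤ 1 := by rw [hsq]; simpa using h1
  · congr 1
    funext x
    have hu : τ = τ 0 • unitVec 0 + τ 1 • unitVec 1 := by
      apply plane_ext <;> simp [unitVec]
    have h2 : fderiv ℝ φ.1 x τ =
        τ 0 * fderiv ℝ φ.1 x (unitVec 0) + τ 1 * fderiv ℝ φ.1 x (unitVec 1) := by
      conv_lhs => rw [hu]
      simp
    simp only [fderiv_const_mul_apply φ.2.1, Fin.sum_univ_two, quad, h2]
    ring

theorem W12.integral_quad_fderiv_le {Ω R : Set Plane} (v : W12 Ω) {τ : Plane}
    (hfin : v.dirVar τ R ≠ ⊤) {Φ : Plane → ℝ} (hΦ : IsTest R Φ) {L : ℝ} (hL : 0 < L)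
    (hb : ∀ x, |Φ x| ≤ L) :
    ∫ x in Ω, quad (v.grad x) τ * fderiv ℝ Φ x τ ≤ L * (v.dirVar τ R).toReal := by
  have h1 : ENNReal.ofReal (∫ x in Ω, quad (v.grad x) τ * fderiv ℝ (fun y => L⁻¹ * Φ y) x τ) ≤
      v.dirVar τ R := le_iSup_of_le ⟨fun y => L⁻¹ * Φ y, hΦ.const_mul _, fun x => by
        rw [abs_mul, abs_of_pos (inv_pos.2 hL), inv_mul_le_iff₀ hL, mul_one]
        exact hb x⟩ le_rfl
  rw [ENNReal.ofReal_le_iff_le_toReal hfin] at h1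
  simp only [fderiv_const_mul_apply hΦ, mul_left_comm _ L⁻¹] at h1
  rwa [integral_const_mul, inv_mul_le_iff₀ hL] at h1

/-! ### The test function of a box -/

theorem exists_Icc_of_compact_subset_Ioo {K : Set ℝ} (hK : IsCompact K) {α β : ℝ} (hαβ : α < β)
    (h : K ⊆ Ioo α β) : ∃ a b, α < a ∧ b < β ∧ K ⊆ Icc a b := by
  rcases K.eq_empty_or_nonempty with rfl | hne
  · exact ⟨(α + β) / 2, (α + β) / 2, by linarith, by linarith, empty_subset _⟩
  · refine ⟨sInf K, sSup K, (h (hK.sInf_mem hne)).1, (h (hK.sSup_mem hne)).2, fun x hx => ?_⟩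
    exact ⟨csInf_le hK.bddBelow hx, le_csSup hK.bddAbove hx⟩

/-- A smooth step on `(α, β)`: it increases from `0` to `1`, and is constant near the ends. -/
structure IsStep (H : ℝ → ℝ) (α β : ℝ) : Prop where
  smooth : ContDiff ℝ ∞ H
  nonneg : ∀ s, 0 ≤ H s
  le_one : ∀ s, H s ≤ 1
  ends : ∃ a b, α < a ∧ a < b ∧ b < β ∧ (∀ s ≤ a, H s = 0) ∧ ∀ s, b ≤ s → H s = 1

theorem IsStep.lt {H : ℝ → ℝ} {α β : ℝ} (h : IsStep H α β) : α < β := by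
  obtain ⟨a, b, h1, h2, h3, -⟩ := h.ends
  linarith

/-- The primitive P of θ along the tangent direction does not vanish to the right of the support of
θ, where it equals the total line integral Θ. Subtracting H·Θ with a step H restores compact support
in the box and replaces θ by θ − H′Θ. The second term is slowly varying: Θ is constant along the
tangent inside the box, so only H′ is differentiated. -/
theorem exists_box_test {x₀ ν : Plane} (hν : ‖ν‖ = 1) {α β γ δ : ℝ} (hγδ : γ < δ) {H : ℝ → ℝ}
    (hH : IsStep H α β) {M : ℝ} (hM : ∀ s, |deriv (deriv H) s| ≤ M) {θ : Plane → ℝ}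
    (hθ : IsTest (box x₀ ν α β γ δ) θ) (hθ1 : ∀ x, |θ x| ≤ 1) :
    ∃ Φ : Plane → ℝ, IsTest (box x₀ ν α β γ δ) Φ ∧ (∀ x, |Φ x| ≤ β - α) ∧
      IsTest (box x₀ ν α β γ δ)
        (fun x => deriv H (tanC x₀ ν x) * lineInt θ (perp ν) (-(β - α)) (β - α) x) ∧
      (∀ x, fderiv ℝ Φ x (perp ν) =
        θ x - deriv H (tanC x₀ ν x) * lineInt θ (perp ν) (-(β - α)) (β - α) x) ∧
      (∀ x, |fderiv ℝ (fun x => deriv H (tanC x₀ ν x) *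
        lineInt θ (perp ν) (-(β - α)) (β - α) x) x (perp ν)| ≤ M * (2 * (β - α))) := by
  set R := box x₀ ν α β γ δ with hR
  set τ := perp ν with hτ
  set L := β - α with hL
  have hαβ : α < β := hH.lt
  have hL0 : 0 < L := sub_pos.2 hαβ
  obtain ⟨a', b', ha', hab', hb', hH0, hH1⟩ := hH.ends
  obtain ⟨a, b, ha, hb, hK⟩ := exists_Icc_of_compact_subset_Ioo
    (hθ.compact.image (continuous_tanC (x₀ := x₀) (ν := ν))) hαβ (by
      rintro _ ⟨x, hx, rfl⟩; exact (hθ.support hx).1)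
  obtain ⟨c, d, hc, hd, hK'⟩ := exists_Icc_of_compact_subset_Ioo
    (hθ.compact.image (continuous_norC (x₀ := x₀) (ν := ν))) hγδ (by
      rintro _ ⟨x, hx, rfl⟩; exact (hθ.support hx).2)
  have hθtan : ∀ x, tanC x₀ ν x ∉ Icc a b → θ x = 0 := fun x hx =>
    image_eq_zero_of_notMem_tsupport fun h => hx (hK ⟨x, h, rfl⟩)
  have hθnor : ∀ x, norC x₀ ν x ∉ Icc c d → θ x = 0 := fun x hx =>
    image_eq_zero_of_notMem_tsupport fun h => hx (hK' ⟨x, h, rfl⟩)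
  have htan : ∀ x r, tanC x₀ ν (x + r • τ) = tanC x₀ ν x + r := tanC_add_smul_perp hν
  have hnor : ∀ x r, norC x₀ ν (x + r • τ) = norC x₀ ν x := norC_add_smul_perp
  set P := lineInt θ τ (-L) 0 with hP
  set P' := lineInt θ τ 0 L with hP'
  set Θ := lineInt θ τ (-L) L with hΘ
  have hPP : ∀ x, Θ x = P x + P' x := fun x => (lineInt_add hθ.smooth.continuous τ _ _ _ x).symm
  have hPs : ContDiff ℝ ∞ P := contDiff_lineInt hθ.smooth hθ.compact τ (by linarith)
  have hΘs : ContDiff ℝ ∞ Θ := contDiff_lineInt hθ.smooth hθ.compact τ (by linarith)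
  have hPd : ∀ x, fderiv ℝ P x τ = θ x - θ (x + (-L) • τ) := by
    intro x
    have := fderiv_lineInt hθ.smooth hθ.compact τ (a := -L) (b := 0) (by linarith) x
    simpa using this
  have hΘd : ∀ x, fderiv ℝ Θ x τ = θ (x + L • τ) - θ (x + (-L) • τ) := fun x =>
    fderiv_lineInt hθ.smooth hθ.compact τ (by linarith) x
  have hPb : ∀ x, |P x| ≤ L := by
    intro x
    have := abs_lineInt_le hθ1 τ (a := -L) (b := 0) (by linarith) x
    linarith
  have hPb' : ∀ x, |P' x| ≤ L := by
    intro x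
    have := abs_lineInt_le hθ1 τ (a := 0) (b := L) (by linarith) x
    linarith
  have hΘb : ∀ x, |Θ x| ≤ 2 * L := by
    intro x
    have := abs_lineInt_le hθ1 τ (a := -L) (b := L) (by linarith) x
    linarith
  have hP0 : ∀ x, tanC x₀ ν x < a → P x = 0 := fun x hx =>
    lineInt_eq_zero (by linarith) fun r hr => hθtan _ fun h => by
      rw [htan] at h; linarith [h.1, hr.2]
  have hP'0 : ∀ x, b < tanC x₀ ν x → P' x = 0 := fun x hx =>
    lineInt_eq_zero (by linarith) fun r hr => hθtan _ fun h => by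
      rw [htan] at h; linarith [h.2, hr.1]
  have hn0 : ∀ x, norC x₀ ν x ∉ Icc c d → P x = 0 ∧ Θ x = 0 := fun x hx =>
    ⟨lineInt_eq_zero (by linarith) fun r _ => hθnor _ (by rwa [hnor]),
      lineInt_eq_zero (by linarith) fun r _ => hθnor _ (by rwa [hnor])⟩
  have hHd : ∀ s, s ∉ Icc a' b' → deriv H s = 0 := by
    intro s hs
    rcases lt_or_ge s a' with h | h
    · have : H =ᶠ[𝓝 s] fun _ => (0 : ℝ) := by
        filter_upwards [Iio_mem_nhds h] with t ht using hH0 t (le_of_lt ht)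
      rw [this.deriv_eq]; simp
    · have h' : b' < s := by
        by_contra! hcon
        exact hs ⟨h, hcon⟩
      have : H =ᶠ[𝓝 s] fun _ => (1 : ℝ) := by
        filter_upwards [Ioi_mem_nhds h'] with t ht using hH1 t (le_of_lt ht)
      rw [this.deriv_eq]; simp
  have hHds : ContDiff ℝ ∞ (deriv H) :=
    (contDiff_infty_iff_deriv.1 hH.smooth).2
  set K : Set Plane := {y | tanC x₀ ν y ∈ Icc (min a a') (max b b') ∧ norC x₀ ν y ∈ Icc c d} with hKdef
  have hKc : IsCompact K := isCompact_closedBox hν _ _ _ _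
  have hKR : K ⊆ R := fun y hy =>
    ⟨⟨(lt_min ha ha').trans_le hy.1.1, hy.1.2.trans_lt (max_lt hb hb')⟩,
      ⟨hc.trans_le hy.2.1, hy.2.2.trans_lt hd⟩⟩
  have hHt : ContDiff ℝ ∞ fun x => H (tanC x₀ ν x) := hH.smooth.comp contDiff_tanC
  have hHt' : ContDiff ℝ ∞ fun x => deriv H (tanC x₀ ν x) := hHds.comp contDiff_tanC
  have hcomp : ∀ (h : ℝ → ℝ), ContDiff ℝ ∞ h → ∀ x,
      fderiv ℝ (fun x => h (tanC x₀ ν x)) x τ = deriv h (tanC x₀ ν x) := by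
    intro h hh x
    have hcd : ContDiff ℝ ∞ fun x => h (tanC x₀ ν x) := hh.comp contDiff_tanC
    rw [← (hcd.differentiable (by simp) x).lineDeriv_eq_fderiv, lineDeriv]
    simp only [htan]
    rw [deriv_comp_const_add (f := h), add_zero]
  have hχ : IsTest R fun x => deriv H (tanC x₀ ν x) * Θ x := by
    refine isTest_of_eq_zero (hHt'.mul hΘs) hKc hKR fun x hx => ?_
    by_cases hn : norC x₀ ν x ∈ Icc c d
    · have ht : tanC x₀ ν x ∉ Icc a' b' := fun ht =>
        hx ⟨⟨(min_le_right _ _).trans ht.1, ht.2.trans (le_max_right _ _)⟩, hn⟩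
      rw [hHd _ ht, zero_mul]
    · rw [(hn0 x hn).2, mul_zero]
  have hΦ : IsTest R fun x => P x - H (tanC x₀ ν x) * Θ x := by
    refine isTest_of_eq_zero (hPs.sub (hHt.mul hΘs)) hKc hKR fun x hx => ?_
    by_cases hn : norC x₀ ν x ∈ Icc c d
    · rcases lt_or_ge (tanC x₀ ν x) (min a a') with h | h
      · rw [hP0 x (h.trans_le (min_le_left _ _)),
          hH0 _ (h.le.trans (min_le_right _ _))]
        ring
      · have h' : max b b' < tanC x₀ ν x := by
          by_contra! hcon
          exact hx ⟨⟨h, hcon⟩, hn⟩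
        rw [hH1 _ ((le_max_right _ _).trans h'.le), hPP,
          hP'0 x ((le_max_left _ _).trans_lt h')]
        ring
    · rw [(hn0 x hn).1, (hn0 x hn).2]; ring
  -- A shift by the full width leaves the box: of the endpoint terms in the derivatives of P and Θ
  -- only `θ x` survives.
  have hshift : ∀ x ∈ R, θ (x + L • τ) = 0 ∧ θ (x + (-L) • τ) = 0 := by
    intro x hx
    refine ⟨hθtan _ fun h => ?_, hθtan _ fun h => ?_⟩
    · rw [htan] at h; linarith [h.2, hx.1.1]
    · rw [htan] at h; linarith [h.1, hx.1.2]
  have hmulR : ∀ (h : ℝ → ℝ), ContDiff ℝ ∞ h → ∀ x ∈ R,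
      fderiv ℝ (fun x => h (tanC x₀ ν x) * Θ x) x τ = deriv h (tanC x₀ ν x) * Θ x := by
    intro h hh x hx
    have hcd : ContDiff ℝ ∞ fun x => h (tanC x₀ ν x) := hh.comp contDiff_tanC
    have e : fderiv ℝ (fun x => h (tanC x₀ ν x) * Θ x) x = _ :=
      fderiv_mul (hcd.differentiable (by simp) x) (hΘs.differentiable (by simp) x)
    rw [e]
    simp only [_root_.add_apply, _root_.smul_apply, smul_eq_mul]
    rw [hcomp h hh, hΘd, (hshift x hx).1, (hshift x hx).2]
    ring
  refine ⟨fun x => P x - H (tanC x₀ ν x) * Θ x, hΦ, fun x => ?_, hχ, fun x => ?_, fun x => ?_⟩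
  -- P − HΘ combines the left and the right primitive with weights 1 − H and −H, and each primitive
  -- is at most L in modulus.
  · have e : P x - H (tanC x₀ ν x) * Θ x =
        (1 - H (tanC x₀ ν x)) * P x - H (tanC x₀ ν x) * P' x := by rw [hPP]; ring
    have h0 := hH.nonneg (tanC x₀ ν x)
    have h1 := hH.le_one (tanC x₀ ν x)
    obtain ⟨p1, p2⟩ := abs_le.1 (hPb x)
    obtain ⟨q1, q2⟩ := abs_le.1 (hPb' x)
    change |P x - H (tanC x₀ ν x) * Θ x| ≤ L
    rw [e, abs_le]
    constructor <;> nlinarith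
  · by_cases hx : x ∈ R
    · have e : fderiv ℝ (fun x => P x - H (tanC x₀ ν x) * Θ x) x = _ :=
        fderiv_sub (hPs.differentiable (by simp) x) ((hHt.mul hΘs).differentiable (by simp) x)
      rw [e, _root_.sub_apply, hmulR H hH.smooth x hx, hPd, (hshift x hx).2, sub_zero]
    · have h2 : deriv H (tanC x₀ ν x) * Θ x = 0 := hχ.eq_zero hx
      rw [hΦ.fderiv_eq_zero hx, hθ.eq_zero hx, h2]
      simp
  · have hM0 : 0 ≤ M := (abs_nonneg _).trans (hM 0)
    by_cases hx : x ∈ R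
    · rw [hmulR _ hHds x hx, abs_mul]
      exact mul_le_mul (hM _) (hΘb x) (abs_nonneg _) hM0
    · rw [hχ.fderiv_eq_zero hx]
      simp only [_root_.zero_apply, abs_zero]
      positivity

/-- Integration against a test function in a box: only the directional variation and a term
with a controlled test function remain. -/
theorem W12.exists_box_estimate {Ω : Set Plane} (v : W12 Ω) {x₀ ν : Plane} (hν : ‖ν‖ = 1)
    {α β γ δ : ℝ} (hγδ : γ < δ) {H : ℝ → ℝ} (hH : IsStep H α β) {M : ℝ}
    (hM : ∀ s, |deriv (deriv H) s| ≤ M) (hfin : v.dirVar (perp ν) (box x₀ ν α β γ δ) ≠ ⊤)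
    {θ : Plane → ℝ} (hθ : IsTest (box x₀ ν α β γ δ) θ) (hθ1 : ∀ x, |θ x| ≤ 1) :
    IsTest (box x₀ ν α β γ δ)
        (fun x => deriv H (tanC x₀ ν x) * lineInt θ (perp ν) (-(β - α)) (β - α) x) ∧
    (∀ x, |fderiv ℝ (fun x => deriv H (tanC x₀ ν x) *
        lineInt θ (perp ν) (-(β - α)) (β - α) x) x (perp ν)| ≤ M * (2 * (β - α))) ∧
    ∫ x in Ω, quad (v.grad x) (perp ν) * θ x ≤
      (β - α) * (v.dirVar (perp ν) (box x₀ ν α β γ δ)).toReal +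
      ∫ x in Ω, quad (v.grad x) (perp ν) *
        (deriv H (tanC x₀ ν x) * lineInt θ (perp ν) (-(β - α)) (β - α) x) := by
  obtain ⟨Φ, hΦ, hΦb, hχ, hd, hχ'⟩ := exists_box_test hν hγδ hH hM hθ hθ1
  refine ⟨hχ, hχ', ?_⟩
  have h1 := v.integral_quad_fderiv_le hfin hΦ (sub_pos.2 hH.lt) hΦb
  simp only [hd, mul_sub] at h1
  rw [integral_sub (v.integrable_quad_mul _ hθ) (v.integrable_quad_mul _ hχ)] at h1
  linarith

end HexRhombic

namespace HexRhombic

/-! ### Wells -/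

theorem frobenius_sq (A : Mat) : ‖A‖ ^ 2 = A 0 0 ^ 2 + A 0 1 ^ 2 + A 1 0 ^ 2 + A 1 1 ^ 2 := by
  rw [Matrix.frobenius_norm_def, ← Real.sqrt_eq_rpow, Real.sq_sqrt (by positivity)]
  simp [Fin.sum_univ_two]
  ring

theorem abs_quad_le (A : Mat) (ξ : Plane) : |quad A ξ| ≤ ‖A‖ * ‖ξ‖ ^ 2 := by
  refine abs_le_of_sq_le_sq ?_ (by positivity)
  rw [mul_pow, frobenius_sq, norm_sq_plane]
  simp only [quad, Fin.sum_univ_two]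
  set p := ξ 0
  set q := ξ 1
  -- Lagrange's identity for the Cauchy–Schwarz inequality between A and ξ⊗ξ, one square for each
  -- pair of entries.
  nlinarith [sq_nonneg (A 0 0 * (p * q) - A 0 1 * p ^ 2), sq_nonneg (A 0 0 * (p * q) - A 1 0 * p ^ 2),
    sq_nonneg (A 0 0 * q ^ 2 - A 1 1 * p ^ 2), sq_nonneg (A 0 1 * (p * q) - A 1 0 * (p * q)),
    sq_nonneg (A 0 1 * q ^ 2 - A 1 1 * (p * q)), sq_nonneg (A 1 0 * q ^ 2 - A 1 1 * (p * q))]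

theorem quad_symPart (A : Mat) (ξ : Plane) : quad (symPart A) ξ = quad A ξ := by
  simp [quad, symPart, Fin.sum_univ_two]
  ring

theorem quad_sub (A A' : Mat) (ξ : Plane) : quad (A - A') ξ = quad A ξ - quad A' ξ := by
  simp [quad, Fin.sum_univ_two]
  ring

theorem finite_wells : wells.Finite := by simp [wells]

theorem wells_nonempty : wells.Nonempty := ⟨_, Or.inl rfl⟩

theorem norm_le_of_mem_wells {k : Mat} (hk : k ∈ wells) : ‖k‖ ≤ 2 := by
  have h3 : √3 ^ 2 = 3 := Real.sq_sqrt (by norm_num)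
  refine abs_le_of_sq_le_sq' ?_ (by norm_num) |>.2
  rw [frobenius_sq]
  rcases hk with rfl | rfl | rfl <;> simp <;> nlinarith

/-- The distance of the strain to the wells. -/
noncomputable def W12.misfit {Ω : Set Plane} (v : W12 Ω) (x : Plane) : ℝ :=
  Metric.infDist (symPart (v.grad x)) wells

theorem exists_well (A : Mat) : ∃ k ∈ wells, Metric.infDist A wells = ‖A - k‖ := by
  obtain ⟨k, hk, h⟩ := finite_wells.isCompact.exists_infDist_eq_dist wells_nonempty A
  exact ⟨k, hk, by rw [h, dist_eq_norm]⟩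

theorem W12.misfit_nonneg {Ω : Set Plane} (v : W12 Ω) (x : Plane) : 0 ≤ v.misfit x :=
  Metric.infDist_nonneg

theorem W12.abs_quad_grad_le {Ω : Set Plane} (v : W12 Ω) (x ξ : Plane) :
    |quad (v.grad x) ξ| ≤ (v.misfit x + 2) * ‖ξ‖ ^ 2 := by
  obtain ⟨k, hk, h⟩ := exists_well (symPart (v.grad x))
  rw [← quad_symPart, W12.misfit, h]
  refine (abs_quad_le _ _).trans ?_
  gcongr
  have := norm_le_of_mem_wells hk
  calc ‖symPart (v.grad x)‖ = ‖(symPart (v.grad x) - k) + k‖ := by rw [sub_add_cancel]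
    _ ≤ _ := (norm_add_le _ _).trans (by linarith)

theorem W12.le_abs_quad_grad {Ω : Set Plane} (v : W12 Ω) (x : Plane) {ξ : Plane} (hξ : ‖ξ‖ = 1)
    {c : ℝ} (hc : ∀ k ∈ wells, c ≤ |quad k ξ|) :
    c ≤ |quad (v.grad x) ξ| + v.misfit x := by
  obtain ⟨k, hk, h⟩ := exists_well (symPart (v.grad x))
  have h1 := abs_quad_le (symPart (v.grad x) - k) ξ
  rw [hξ, one_pow, mul_one, quad_sub, quad_symPart] at h1
  rw [W12.misfit, h]
  have h2 := abs_sub_abs_le_abs_sub (quad k ξ) (quad (v.grad x) ξ)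
  rw [abs_sub_comm] at h2
  linarith [hc k hk]

theorem W12.memLp_misfit {Ω : Set Plane} (hΩ : volume Ω ≠ ⊤) (v : W12 Ω) :
    MemLp v.misfit 2 (volume.restrict Ω) := by
  have hfin : IsFiniteMeasure (volume.restrict Ω) := ⟨by simpa using hΩ.lt_top⟩
  have hmeas : AEStronglyMeasurable v.misfit (volume.restrict Ω) := by
    have h1 : Continuous fun p : ℝ × ℝ × ℝ =>
        Metric.infDist (p.1 • !![1, 0; 0, 0] + (p.2.1 • !![0, 1; 1, 0] + p.2.2 • !![0, 0; 0, 1]) : Mat)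
          wells := by fun_prop
    have h2 := (v.grad_memLp 0 0).1.prodMk
      ((((v.grad_memLp 0 1).1.add (v.grad_memLp 1 0).1).const_mul (1 / 2)).prodMk
        (v.grad_memLp 1 1).1)
    refine (h1.comp_aestronglyMeasurable h2).congr (Eventually.of_forall fun x => ?_)
    simp only [W12.misfit]
    congr 1
    ext i j
    fin_cases i <;> fin_cases j <;> simp [symPart] <;> ring
  have hb : MemLp (fun x => (∑ i, ∑ j, |v.grad x i j|) + 2) 2 (volume.restrict Ω) :=
    (memLp_finsetSum _ fun i _ => memLp_finsetSum _ fun j _ => (v.grad_memLp i j).norm).add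
      (memLp_const 2)
  refine hb.mono' hmeas (Eventually.of_forall fun x => ?_)
  rw [Real.norm_of_nonneg (v.misfit_nonneg x)]
  obtain ⟨k, hk⟩ := wells_nonempty
  refine (Metric.infDist_le_dist_of_mem hk).trans ?_
  rw [dist_eq_norm]
  refine (norm_sub_le _ _).trans (add_le_add ?_ (norm_le_of_mem_wells hk))
  refine abs_le_of_sq_le_sq' ?_ (by positivity) |>.2
  rw [frobenius_sq]
  simp only [symPart, Fin.sum_univ_two, Matrix.smul_apply, Matrix.add_apply, Matrix.transpose_apply,
    smul_eq_mul]
  set a := v.grad x 0 0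
  set b := v.grad x 0 1
  set c := v.grad x 1 0
  set d := v.grad x 1 1
  have e : (|a| + |b| + (|c| + |d|)) ^ 2 = a ^ 2 + b ^ 2 + c ^ 2 + d ^ 2 + 2 * (|a| * |b|) +
    2 * (|a| * |c|) + 2 * (|a| * |d|) + 2 * (|b| * |c|) + 2 * (|b| * |d|) + 2 * (|c| * |d|) := by
    rw [← sq_abs a, ← sq_abs b, ← sq_abs c, ← sq_abs d]; ring
  rw [e]
  have h1 : 0 ≤ |a| * |b| := by positivity
  have h2 : 0 ≤ |a| * |c| := by positivity
  have h3 : 0 ≤ |a| * |d| := by positivity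
  have h4 : 0 ≤ |b| * |c| := by positivity
  have h5 : 0 ≤ |b| * |d| := by positivity
  have h6 : 0 ≤ |c| * |d| := by positivity
  nlinarith [sq_nonneg (b - c)]

/-- The elastic energy, as a real number. -/
noncomputable def W12.elastic {Ω : Set Plane} (v : W12 Ω) : ℝ := ∫ x in Ω, v.misfit x ^ 2

theorem W12.energy_eq {Ω : Set Plane} (hΩ : volume Ω ≠ ⊤) (v : W12 Ω) (ε : ℝ) :
    v.energy ε = ENNReal.ofReal v.elastic + ENNReal.ofReal ε * v.hessianVariation := by
  rw [W12.energy, W12.elastic, ofReal_integral_eq_lintegral_ofReal (v.memLp_misfit hΩ).integrable_sq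
    (Eventually.of_forall fun x => sq_nonneg _)]
  rfl

/-! ### Explicit wells and normals -/

theorem rot_explicit (j : Fin 3) : Real.cos (2 * Real.pi / 3 * (j : ℕ)) = ![1, -1/2, -1/2] j ∧
    Real.sin (2 * Real.pi / 3 * (j : ℕ)) = ![0, √3 / 2, -(√3 / 2)] j := by
  have e1 : 2 * Real.pi / 3 = Real.pi - Real.pi / 3 := by ring
  have e2 : 2 * Real.pi / 3 * 2 = Real.pi / 3 + Real.pi := by ring
  fin_cases j
  · simp
  · simp only [Fin.mk_one, Nat.cast_one, mul_one]
    rw [e1, Real.cos_pi_sub, Real.sin_pi_sub, Real.cos_pi_div_three, Real.sin_pi_div_three]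
    simp; norm_num
  · simp only [Fin.reduceFinMk, Nat.cast_ofNat]
    rw [e2, Real.cos_add_pi, Real.sin_add_pi, Real.cos_pi_div_three, Real.sin_pi_div_three]
    simp; norm_num

/-- The normal `Q_j (e₁ + σ e₂)`. -/
noncomputable def amN (σ : ℝ) (j : Fin 3) : Plane := WithLp.toLp 2 (Q j *ᵥ ![1, σ])

theorem amN_zero_coord (σ : ℝ) (j : Fin 3) :
    amN σ j 0 = ![1, -1/2, -1/2] j - σ * ![0, √3 / 2, -(√3 / 2)] j := by
  simp [amN, Q, rotMatrix, (rot_explicit j).1, (rot_explicit j).2]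
  ring

theorem amN_one_coord (σ : ℝ) (j : Fin 3) :
    amN σ j 1 = ![0, √3 / 2, -(√3 / 2)] j + σ * ![1, -1/2, -1/2] j := by
  simp [amN, Q, rotMatrix, (rot_explicit j).1, (rot_explicit j).2]

theorem mem_amNormals {n : Plane} : n ∈ amNormals ↔ ∃ j, n = amN 1 j ∨ n = amN (-1) j := Iff.rfl

theorem norm_sq_amN {σ : ℝ} (hσ : σ ^ 2 = 1) (j : Fin 3) : ‖amN σ j‖ ^ 2 = 2 := by
  have h3 : √3 ^ 2 = 3 := Real.sq_sqrt (by norm_num)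
  rw [norm_sq_plane, amN_zero_coord, amN_one_coord]
  fin_cases j <;> simp <;> nlinarith

/-- The well which is compatible with zero across lines with normal `amN σ j`. -/
noncomputable def wellOf (j : Fin 3) : Mat :=
  ![!![-1, 0; 0, 1], (1 / 2 : ℝ) • !![1, √3; √3, -1], (1 / 2 : ℝ) • !![1, -√3; -√3, -1]] j

theorem mem_wells {k : Mat} : k ∈ wells ↔ ∃ j, k = wellOf j := by
  constructor
  · rintro (rfl | rfl | rfl)
    · exact ⟨2, rfl⟩
    · exact ⟨0, rfl⟩
    · exact ⟨1, rfl⟩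
  · rintro ⟨j, rfl⟩
    fin_cases j
    · exact Or.inr (Or.inl rfl)
    · exact Or.inr (Or.inr rfl)
    · exact Or.inl rfl

/-- Each well is up to sign a symmetrized product of two linear forms, because it is compatible with
zero across two families of lines. Evaluated on the tangent, the factors measure how far ν is from
being parallel to the two normals. -/
theorem quad_wellOf (j : Fin 3) (ν : Plane) : quad (wellOf j) (perp ν) =
    -(inner ℝ ν (perp (amN 1 j)) * inner ℝ ν (perp (amN (-1) j))) := by
  have h3 : √3 ^ 2 = 3 := Real.sq_sqrt (by norm_num)
  simp only [inner_plane, perp_zero_coord, perp_one_coord, amN_zero_coord, amN_one_coord, quad,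
    Fin.sum_univ_two]
  fin_cases j <;> simp [wellOf]
  · ring
  · linear_combination (ν 0 ^ 2 / 4 - ν 1 ^ 2 / 4) * h3
  · linear_combination (ν 0 ^ 2 / 4 - ν 1 ^ 2 / 4) * h3

theorem eq_smul_of_inner_perp_eq_zero {ν n : Plane} (hn : n ≠ 0) (h : inner ℝ ν (perp n) = 0) :
    ∃ t : ℝ, ν = t • n := by
  have hn' : 0 < ‖n‖ ^ 2 := by positivity
  rw [norm_sq_plane] at hn'
  rw [inner_plane] at h
  simp at h
  refine ⟨(ν 0 * n 0 + ν 1 * n 1) / (n 0 ^ 2 + n 1 ^ 2), plane_ext ?_ ?_⟩ <;>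
    simp only [PiLp.smul_apply, smul_eq_mul] <;> field_simp
  · linear_combination (-(n 1)) * h
  · linear_combination (n 0) * h

/-- The only use of the condition on the normal: no factor in `quad_wellOf` vanishes, and there are
finitely many wells. -/
theorem exists_pos_le_abs_quad {ν : Plane} (hν : ∀ n ∈ amNormals, ∀ t : ℝ, ν ≠ t • n) :
    ∃ c, 0 < c ∧ ∀ k ∈ wells, c ≤ |quad k (perp ν)| := by
  have hne : ∀ k ∈ wells, 0 < |quad k (perp ν)| := by
    intro k hk
    obtain ⟨j, rfl⟩ := mem_wells.1 hk
    rw [abs_pos, quad_wellOf, neg_ne_zero]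
    have hn0 : ∀ σ : ℝ, σ ^ 2 = 1 → amN σ j ≠ 0 := by
      intro σ hσ h
      have := norm_sq_amN hσ j
      rw [h] at this; simp at this
    refine mul_ne_zero (fun h => ?_) fun h => ?_
    · obtain ⟨t, ht⟩ := eq_smul_of_inner_perp_eq_zero (hn0 1 (by norm_num)) h
      exact hν _ (mem_amNormals.2 ⟨j, Or.inl rfl⟩) t ht
    · obtain ⟨t, ht⟩ := eq_smul_of_inner_perp_eq_zero (hn0 (-1) (by norm_num)) h
      exact hν _ (mem_amNormals.2 ⟨j, Or.inr rfl⟩) t ht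
  obtain ⟨k₀, hk₀, hmin⟩ := finite_wells.isCompact.exists_isMinOn wells_nonempty
    (f := fun k => |quad k (perp ν)|) (finite_wells.continuousOn _)
  exact ⟨_, hne k₀ hk₀, fun k hk => hmin hk⟩

end HexRhombic

namespace HexRhombic

/-! ### Lower bound in one box -/

theorem W12.integral_inner_fderiv {Ω : Set Plane} (v : W12 Ω) (ξ : Plane) {φ : Plane → ℝ}
    (hφ : IsTest Ω φ) :
    ∫ x in Ω, inner ℝ (v.toFun x) ξ * fderiv ℝ φ x ξ = -∫ x in Ω, quad (v.grad x) ξ * φ x := by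
  have hu : ξ = ξ 0 • unitVec 0 + ξ 1 • unitVec 1 := by
    apply plane_ext <;> simp [unitVec]
  have h2 : ∀ x, fderiv ℝ φ x ξ =
      ξ 0 * fderiv ℝ φ x (unitVec 0) + ξ 1 * fderiv ℝ φ x (unitVec 1) := by
    intro x
    conv_lhs => rw [hu]
    simp
  have hv : ∀ i, MemLp (fun x => v.toFun x i) 2 (volume.restrict Ω) := fun i => by
    have := v.memLp_inner (unitVec i)
    simpa [unitVec, EuclideanSpace.inner_single_right] using this
  have h3 : ∀ i j : Fin 2, Integrable
      (fun x => ξ i * ξ j * (v.toFun x i * fderiv ℝ φ x (unitVec j))) (volume.restrict Ω) :=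
    fun i j => ((hv i).integrable_mul ((hφ.fderiv_apply _).memLp 2 _)).const_mul _
  have h4 : ∀ i j : Fin 2, Integrable
      (fun x => ξ i * ξ j * (v.grad x i j * φ x)) (volume.restrict Ω) :=
    fun i j => ((v.grad_memLp i j).integrable_mul (hφ.memLp 2 _)).const_mul _
  calc _ = ∫ x in Ω, ∑ i, ∑ j, ξ i * ξ j * (v.toFun x i * fderiv ℝ φ x (unitVec j)) := by
        congr 1
        funext x
        rw [h2, inner_plane]
        simp only [Fin.sum_univ_two]
        ring
    _ = ∑ i, ∑ j, ξ i * ξ j * ∫ x in Ω, v.toFun x i * fderiv ℝ φ x (unitVec j) := by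
        rw [integral_finsetSum _ fun i _ => integrable_finsetSum _ fun j _ => h3 i j]
        refine Finset.sum_congr rfl fun i _ => ?_
        rw [integral_finsetSum _ fun j _ => h3 i j]
        exact Finset.sum_congr rfl fun j _ => integral_const_mul _ _
    _ = -∑ i, ∑ j, ξ i * ξ j * ∫ x in Ω, v.grad x i j * φ x := by
        simp only [v.weak_grad φ hφ, mul_neg, Finset.sum_neg_distrib]
    _ = -∫ x in Ω, ∑ i, ∑ j, ξ i * ξ j * (v.grad x i j * φ x) := by
        rw [integral_finsetSum _ fun i _ => integrable_finsetSum _ fun j _ => h4 i j]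
        congr 1
        refine Finset.sum_congr rfl fun i _ => ?_
        rw [integral_finsetSum _ fun j _ => h4 i j]
        exact Finset.sum_congr rfl fun j _ => (integral_const_mul _ _).symm
    _ = _ := by
        congr 2
        funext x
        simp only [quad, Fin.sum_univ_two]
        ring

/-- The extension of `v` by zero satisfies the integration by parts formula for the component
and derivative in direction `ξ`, for test functions in `B`. -/
def W12.ExtendsByZero {Ω : Set Plane} (v : W12 Ω) (B : Set Plane) (ξ : Plane) : Prop :=
  ∀ φ : Plane → ℝ, IsTest B φ → ∫ x in Ω, inner ℝ (v.toFun x) ξ * fderiv ℝ φ x ξ =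
    -∫ x in Ω, quad (v.grad x) ξ * φ x

theorem W12.ExtendsByZero.smul {Ω : Set Plane} {v : W12 Ω} {B : Set Plane} {ξ : Plane}
    (h : v.ExtendsByZero B ξ) (c : ℝ) : v.ExtendsByZero B (c • ξ) := by
  intro φ hφ
  have h1 : ∀ x, inner ℝ (v.toFun x) (c • ξ) * fderiv ℝ φ x (c • ξ) =
      c ^ 2 * (inner ℝ (v.toFun x) ξ * fderiv ℝ φ x ξ) := by
    intro x
    rw [inner_smul_right, map_smul, smul_eq_mul]; ring
  have h2 : ∀ x, quad (v.grad x) (c • ξ) * φ x = c ^ 2 * (quad (v.grad x) ξ * φ x) := by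
    intro x
    simp only [quad, Fin.sum_univ_two, PiLp.smul_apply, smul_eq_mul]; ring
  simp only [h1, h2, integral_const_mul, h φ hφ, mul_neg]

/-- A Poincaré inequality along ξ in dual form. Integrating θ over a segment of length ℓ along ξ
gives Ψ with ∂_ξΨ = θ on Ω; moving this derivative onto v leaves the quadratic form of the strain,
bounded by (misfit + 2)|ξ|², against |Ψ| ≤ Aℓ. Since every ray from R leaves Ω by parameter ℓ, the
far endpoint contributes nothing. -/
theorem W12.abs_integral_inner_le {Ω B D R : Set Plane} (hΩm : MeasurableSet Ω)
    (hΩ : volume Ω ≠ ⊤) {v : W12 Ω} {ξ : Plane} (hext : v.ExtendsByZero B ξ) (hD : D ⊆ B)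
    (hDm : MeasurableSet D) {ℓ : ℝ} (hℓ : 0 < ℓ)
    (hsub : ∀ y ∈ R, ∀ r ∈ Icc 0 ℓ, y + r • ξ ∈ D) (hout : ∀ y ∈ R, y + ℓ • ξ ∉ Ω)
    {θ : Plane → ℝ} (hθ : IsTest R θ) {A : ℝ} (hA : ∀ x, |θ x| ≤ A) :
    |∫ x in Ω, inner ℝ (v.toFun x) ξ * θ x| ≤
      A * ℓ * ‖ξ‖ ^ 2 * ∫ x in D ∩ Ω, (v.misfit x + 2) := by
  have hfin : IsFiniteMeasure (volume.restrict Ω) := ⟨by simpa using hΩ.lt_top⟩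
  have hA0 : 0 ≤ A := (abs_nonneg _).trans (hA 0)
  set Ψ := lineInt θ ξ (-ℓ) 0 with hΨ
  set K : Set Plane := (fun p : Plane × ℝ => p.1 + p.2 • ξ) '' (tsupport θ ×ˢ Icc 0 ℓ) with hK
  have hKc : IsCompact K := (hθ.compact.isCompact.prod isCompact_Icc).image (by fun_prop)
  have hKD : K ⊆ D := by
    rintro _ ⟨⟨y, r⟩, ⟨hy, hr⟩, rfl⟩
    exact hsub y (hθ.support hy) r hr
  have hΨt : IsTest D Ψ := by
    refine isTest_of_eq_zero (contDiff_lineInt hθ.smooth hθ.compact ξ (by linarith)) hKc hKD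
      fun x hx => lineInt_eq_zero (by linarith) fun r hr => ?_
    refine image_eq_zero_of_notMem_tsupport fun h => hx ?_
    refine ⟨(x + r • ξ, -r), ⟨h, ⟨by linarith [hr.2], by linarith [hr.1]⟩⟩, ?_⟩
    simp
  -- If x − ℓξ were in R, then x would lie outside Ω by `hout`; so the endpoint term vanishes for x
  -- in Ω.
  have hd : ∀ x ∈ Ω, fderiv ℝ Ψ x ξ = θ x := by
    intro x hx
    have h1 := fderiv_lineInt hθ.smooth hθ.compact ξ (a := -ℓ) (b := 0) (by linarith) x
    rw [h1, zero_smul, add_zero, hθ.eq_zero (x := x + -ℓ • ξ), sub_zero]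
    intro hR
    exact hout _ hR (by simpa using hx)
  have h1 := hext Ψ (hΨt.mono hD)
  rw [setIntegral_congr_fun hΩm fun x hx => by rw [hd x hx]] at h1
  rw [h1, abs_neg]
  have hΨb : ∀ x, |Ψ x| ≤ A * ℓ := by
    intro x
    have := abs_lineInt_le hA ξ (a := -ℓ) (b := 0) (by linarith) x
    simpa using this
  have hmi : Integrable (fun x => v.misfit x + 2) (volume.restrict Ω) :=
    ((v.memLp_misfit hΩ).integrable one_le_two).add (integrable_const _)
  rw [← Real.norm_eq_abs]
  have h2 : ∫ x in D ∩ Ω, (v.misfit x + 2) =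
      ∫ x in Ω, D.indicator (fun x => v.misfit x + 2) x := by
    rw [setIntegral_indicator hDm, inter_comm]
  rw [h2, ← integral_const_mul]
  refine norm_integral_le_of_norm_le ((hmi.indicator hDm).const_mul _)
    (Eventually.of_forall fun x => ?_)
  by_cases hx : x ∈ D
  · rw [indicator_of_mem hx, norm_mul, Real.norm_eq_abs, Real.norm_eq_abs]
    calc _ ≤ ((v.misfit x + 2) * ‖ξ‖ ^ 2) * (A * ℓ) := by
          gcongr
          · exact mul_nonneg (by linarith [v.misfit_nonneg x]) (sq_nonneg _)
          · exact v.abs_quad_grad_le x ξ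
          · exact hΨb x
      _ = _ := by ring
  · rw [hΨt.eq_zero hx, indicator_of_notMem hx]
    simp

/-- From bounds against test functions to a bound for the area. -/
theorem W12.area_le {Ω R : Set Plane} (hΩ : volume Ω ≠ ⊤) (hR : IsOpen R) (hRΩ : R ⊆ Ω)
    (v : W12 Ω) {τ : Plane} (hτ : ‖τ‖ = 1) {c B : ℝ} (hc0 : 0 < c)
    (hc : ∀ k ∈ wells, c ≤ |quad k τ|)
    (hB : ∀ θ : Plane → ℝ, IsTest R θ → (∀ x, |θ x| ≤ 1) →
      ∫ x in Ω, quad (v.grad x) τ * θ x ≤ B) :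
    c * (volume R).toReal ≤ B + ∫ x in R, v.misfit x := by
  have hfin : IsFiniteMeasure (volume.restrict Ω) := ⟨by simpa using hΩ.lt_top⟩
  have hRfin : volume R ≠ ⊤ := measure_ne_top_of_subset hRΩ hΩ
  have hmi : IntegrableOn v.misfit Ω := (v.memLp_misfit hΩ).integrable one_le_two
  have hq : IntegrableOn (fun x => quad (v.grad x) τ) Ω := (v.memLp_quad τ).integrable one_le_two
  have hK : ∀ K ⊆ R, IsCompact K →
      volume K ≤ ENNReal.ofReal ((B + ∫ x in R, v.misfit x) / c) := by
    intro K hKR hKc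
    have hKΩ := hKR.trans hRΩ
    have h1 := setIntegral_abs_le_of_forall_test hR hKc hKR hRΩ hq hB
    have h2 : ∫ x in K, v.misfit x ≤ ∫ x in R, v.misfit x :=
      setIntegral_mono_set (hmi.mono_set hRΩ) (Eventually.of_forall v.misfit_nonneg)
        (LE.le.eventuallyLE hKR)
    have hqa : IntegrableOn (fun x => |quad (v.grad x) τ|) K := (hq.mono_set hKΩ).norm
    have h3 : ∫ x in K, c ≤ ∫ x in K, (|quad (v.grad x) τ| + v.misfit x) := by
      refine setIntegral_mono_on (integrableOn_const hKc.measure_lt_top.ne)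
        (hqa.add (hmi.mono_set hKΩ)) hKc.measurableSet fun x _ => ?_
      exact v.le_abs_quad_grad x hτ hc
    rw [integral_add hqa (hmi.mono_set hKΩ), setIntegral_const, smul_eq_mul] at h3
    rw [← ENNReal.ofReal_toReal hKc.measure_lt_top.ne]
    refine ENNReal.ofReal_le_ofReal ?_
    rw [le_div_iff₀ hc0]
    simp only [Measure.real] at h3
    linarith
  have h4 : volume R ≤ ENNReal.ofReal ((B + ∫ x in R, v.misfit x) / c) := by
    rw [hR.measure_eq_iSup_isCompact]
    exact iSup₂_le fun K hKR => iSup_le fun hKc => hK K hKR hKc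
  have h5 : 0 ≤ B + ∫ x in R, v.misfit x := by
    have hB0 : 0 ≤ B := by simpa using hB (fun _ => 0) (IsTest.zero R) (by simp)
    exact add_nonneg hB0 (integral_nonneg fun x => v.misfit_nonneg x)
  have h6 := ENNReal.toReal_mono ENNReal.ofReal_ne_top h4
  rw [ENNReal.toReal_ofReal (by positivity), le_div_iff₀ hc0] at h6
  linarith

/-- Young's inequality s ≤ κ + s²/(4κ), with κ left free so that the linear term can be absorbed. -/
theorem W12.setIntegral_misfit_le {Ω D : Set Plane} (hΩ : volume Ω ≠ ⊤) (v : W12 Ω)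
    (hD : D ⊆ Ω) {κ m : ℝ} (hκ : 0 < κ) (hm : (volume D).toReal ≤ m) :
    ∫ x in D, v.misfit x ≤ κ * m + (1 / (4 * κ)) * ∫ x in D, v.misfit x ^ 2 := by
  have hfin : IsFiniteMeasure (volume.restrict Ω) := ⟨by simpa using hΩ.lt_top⟩
  have hfinD : IsFiniteMeasure (volume.restrict D) :=
    ⟨by simpa using (measure_ne_top_of_subset hD hΩ).lt_top⟩
  have h1 : IntegrableOn v.misfit D := IntegrableOn.mono_set (t := Ω)
    ((v.memLp_misfit hΩ).integrable one_le_two) hD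
  have h2 : IntegrableOn (fun x => v.misfit x ^ 2) D := IntegrableOn.mono_set (t := Ω)
    (v.memLp_misfit hΩ).integrable_sq hD
  have h3 : ∫ x in D, v.misfit x ≤ ∫ x in D, (κ + (1 / (4 * κ)) * v.misfit x ^ 2) := by
    refine integral_mono h1 ((integrable_const κ).add (h2.const_mul _)) fun x => ?_
    change v.misfit x ≤ κ + 1 / (4 * κ) * v.misfit x ^ 2
    have : κ + 1 / (4 * κ) * v.misfit x ^ 2 - v.misfit x = (2 * κ - v.misfit x) ^ 2 / (4 * κ) := by
      field_simp; ring
    have h : 0 ≤ (2 * κ - v.misfit x) ^ 2 / (4 * κ) := by positivity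
    linarith
  rw [integral_add (integrable_const κ) (h2.const_mul _), setIntegral_const, integral_const_mul,
    smul_eq_mul] at h3
  simp only [Measure.real] at h3
  nlinarith

/-- The step function on `(0, 1)`. -/
noncomputable def step₀ (s : ℝ) : ℝ := Real.smoothTransition (3 * s - 1)

theorem contDiff_step₀ : ContDiff ℝ ∞ step₀ :=
  Real.smoothTransition.contDiff.comp (by fun_prop)

theorem step₀_eq_zero {s : ℝ} (h : s ≤ 1 / 3) : step₀ s = 0 :=
  Real.smoothTransition.zero_of_nonpos (by linarith)

theorem step₀_eq_one {s : ℝ} (h : 2 / 3 ≤ s) : step₀ s = 1 :=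
  Real.smoothTransition.one_of_one_le (by linarith)

theorem exists_bound_deriv_step₀ : ∃ C, 0 < C ∧ ∀ s, |deriv (deriv step₀) s| ≤ C := by
  have h1 : ContDiff ℝ ∞ (deriv step₀) := (contDiff_infty_iff_deriv.1 contDiff_step₀).2
  have h2 : Continuous (deriv (deriv step₀)) := (contDiff_infty_iff_deriv.1 h1).2.continuous
  have hc : HasCompactSupport (deriv step₀) := by
    refine HasCompactSupport.intro (isCompact_Icc (a := (1 / 3 : ℝ)) (b := 2 / 3)) fun s hs => ?_
    rcases lt_or_ge s (1 / 3) with h | h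
    · have : step₀ =ᶠ[𝓝 s] fun _ => (0 : ℝ) := by
        filter_upwards [Iio_mem_nhds h] with t ht using step₀_eq_zero (le_of_lt ht)
      rw [this.deriv_eq]; simp
    · have h' : 2 / 3 < s := by
        by_contra! hcon
        exact hs ⟨h, hcon⟩
      have : step₀ =ᶠ[𝓝 s] fun _ => (1 : ℝ) := by
        filter_upwards [Ioi_mem_nhds h'] with t ht using step₀_eq_one (le_of_lt ht)
      rw [this.deriv_eq]; simp
  obtain ⟨C, hC⟩ := hc.deriv.exists_bound_of_continuous h2
  exact ⟨max C 1, by positivity, fun s => (hC s).trans (le_max_left _ _)⟩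

theorem isStep_step₀ {α L : ℝ} (hL : 0 < L) :
    IsStep (fun s => step₀ (L⁻¹ * (s - α))) α (α + L) := by
  refine ⟨contDiff_step₀.comp (by fun_prop), fun s => Real.smoothTransition.nonneg _,
    fun s => Real.smoothTransition.le_one _, α + L / 3, α + 2 * L / 3, by linarith, by linarith,
    by linarith, fun s hs => step₀_eq_zero ?_, fun s hs => step₀_eq_one ?_⟩
  · rw [inv_mul_le_iff₀ hL]; linarith
  · rw [le_inv_mul_iff₀ hL]; linarith

theorem deriv_comp_scale (f : ℝ → ℝ) (c α : ℝ) :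
    deriv (fun s => f (c * (s - α))) = fun s => c * deriv f (c * (s - α)) := by
  funext s
  have h1 := deriv_comp_sub_const (f := fun t => f (c * t)) α s
  rw [h1, deriv_comp_mul_left, smul_eq_mul]

/-- The tangential form is at least c₀ − misfit in modulus, so some test function θ sees the area of
R. Trading θ for the slowly varying χ of `exists_box_estimate` costs L times the variation, with L =
M t. In the χ term the derivative, of order 1/L, falls on v·τ, which is of order t because the
boundary is within reach 3t. This remainder has relative size t/L = 1/M and is absorbed for large M.
-/
theorem W12.box_lower {Ω B : Set Plane} (hΩo : IsOpen Ω) (hΩ : volume Ω ≠ ⊤) (v : W12 Ω)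
    {x₀ ν : Plane} (hν : ‖ν‖ = 1) {c₀ : ℝ} (hc₀ : 0 < c₀)
    (hc : ∀ k ∈ wells, c₀ ≤ |quad k (perp ν)|) {C₀ : ℝ} (hC₀ : 0 < C₀)
    (hC : ∀ s, |deriv (deriv step₀) s| ≤ C₀) {M t s₁ a : ℝ} (ht : 0 < t) (hM3 : 3 ≤ M)
    (hMC : 18 * C₀ ≤ M) (hMc : 2304 * C₀ ≤ M * c₀)
    (hext : v.ExtendsByZero B ν) (hext' : v.ExtendsByZero B (perp ν + ν))
    (hRΩ : box x₀ ν s₁ (s₁ + M * t) (a - 2 * t) (a - t) ⊆ Ω)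
    (hDB : box x₀ ν s₁ (s₁ + 2 * M * t) (a - 2 * t) (a + 2 * t + t) ⊆ B)
    (hout : ∀ y ∈ box x₀ ν s₁ (s₁ + 2 * M * t) (a - 2 * t) (a + 2 * t + t),
      a + t < norC x₀ ν y → y ∉ Ω)
    (hfin : v.dirVar (perp ν) (box x₀ ν s₁ (s₁ + M * t) (a - 2 * t) (a - t)) ≠ ⊤) :
    c₀ / 2 * t ≤ (v.dirVar (perp ν) (box x₀ ν s₁ (s₁ + M * t) (a - 2 * t) (a - t))).toReal +
      (64 / (c₀ * t)) * ∫ x in box x₀ ν s₁ (s₁ + 2 * M * t) (a - 2 * t) (a + 2 * t + t) ∩ Ω,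
        v.misfit x ^ 2 := by
  have hfinΩ : IsFiniteMeasure (volume.restrict Ω) := ⟨by simpa using hΩ.lt_top⟩
  set R := box x₀ ν s₁ (s₁ + M * t) (a - 2 * t) (a - t) with hR
  set D := box x₀ ν s₁ (s₁ + 2 * M * t) (a - 2 * t) (a + 2 * t + t) with hD
  have hM : 0 < M := by linarith
  set L := M * t with hL
  have hL0 : 0 < L := by positivity
  have htL : 3 * t ≤ L := by nlinarith
  have hRD : R ⊆ D := fun y hy =>
    ⟨⟨hy.1.1, by linarith [hy.1.2]⟩, ⟨hy.2.1, by linarith [hy.2.2]⟩⟩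
  have hτ : ‖perp ν‖ = 1 := by rw [norm_perp, hν]
  have hτν : ‖perp ν + ν‖ ^ 2 = 2 := by
    have := unit_sq hν
    rw [norm_sq_plane]; simp; nlinarith
  have hstep := isStep_step₀ (α := s₁) hL0
  set H : ℝ → ℝ := fun s => step₀ (L⁻¹ * (s - s₁)) with hHdef
  have hHM : ∀ s, |deriv (deriv H) s| ≤ C₀ / L ^ 2 := by
    intro s
    have h1 : deriv H = fun s => L⁻¹ * deriv step₀ (L⁻¹ * (s - s₁)) := deriv_comp_scale _ _ _
    have h2 : deriv (deriv H) s = L⁻¹ * (L⁻¹ * deriv (deriv step₀) (L⁻¹ * (s - s₁))) := by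
      rw [h1, deriv_const_mul_field, deriv_comp_scale]
    rw [h2, abs_mul, abs_mul, abs_of_pos (inv_pos.2 hL0)]
    have := hC (L⁻¹ * (s - s₁))
    rw [← mul_assoc, show L⁻¹ * L⁻¹ = (L ^ 2)⁻¹ by field_simp, div_eq_inv_mul]
    gcongr
  set W := (v.dirVar (perp ν) R).toReal with hW
  set I := ∫ x in D ∩ Ω, (v.misfit x + 2) with hI
  have key : ∀ θ : Plane → ℝ, IsTest R θ → (∀ x, |θ x| ≤ 1) →
      ∫ x in Ω, quad (v.grad x) (perp ν) * θ x ≤ L * W + 18 * C₀ / M * I := by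
    intro θ hθ hθ1
    obtain ⟨hχ, hχ', hle⟩ := v.exists_box_estimate hν (by linarith) hstep hHM hfin hθ hθ1
    rw [add_sub_cancel_left] at hχ hχ' hle
    refine hle.trans (add_le_add le_rfl ?_)
    set χ : Plane → ℝ := fun x => deriv H (tanC x₀ ν x) * lineInt θ (perp ν) (-L) L x with hχdef
    have h1 := v.integral_inner_fderiv (perp ν) (hχ.mono hRΩ)
    set θ₁ : Plane → ℝ := fun x => fderiv ℝ χ x (perp ν) with hθ₁
    have hθ₁t : IsTest R θ₁ := hχ.fderiv_apply _
    have hA : ∀ x, |θ₁ x| ≤ 2 * C₀ / L := fun x => (hχ' x).trans (le_of_eq (by field_simp))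
    have hpt : ∀ y ∈ R, ∀ r ∈ Icc 0 (3 * t), y + r • ν ∈ D := by
      intro y hy r hr
      refine ⟨?_, ?_⟩
      · rw [tanC_add_smul_self]; exact ⟨hy.1.1, by linarith [hy.1.2]⟩
      · rw [norC_add_smul_self hν]
        exact ⟨by linarith [hy.2.1, hr.1], by linarith [hy.2.2, hr.2]⟩
    have hpt' : ∀ y ∈ R, ∀ r ∈ Icc 0 (3 * t), y + r • (perp ν + ν) ∈ D := by
      intro y hy r hr
      rw [smul_add, ← add_assoc]
      refine ⟨?_, ?_⟩
      · rw [tanC_add_smul_self, tanC_add_smul_perp hν]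
        exact ⟨by linarith [hy.1.1, hr.1], by linarith [hy.1.2, hr.2]⟩
      · rw [norC_add_smul_self hν, norC_add_smul_perp]
        exact ⟨by linarith [hy.2.1, hr.1], by linarith [hy.2.2, hr.2]⟩
    have hend : (3 * t) ∈ Icc 0 (3 * t) := ⟨by linarith, le_rfl⟩
    have hDm : MeasurableSet D := (isOpen_box _ _ _ _).measurableSet
    have e1 := W12.abs_integral_inner_le hΩo.measurableSet hΩ hext hDB hDm (by linarith) hpt
      (fun y hy => hout _ (hpt y hy _ hend) (by
        rw [norC_add_smul_self hν]; linarith [hy.2.1])) hθ₁t hA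
    have e2 := W12.abs_integral_inner_le hΩo.measurableSet hΩ hext' hDB hDm (by linarith) hpt'
      (fun y hy => hout _ (hpt' y hy _ hend) (by
        rw [smul_add, ← add_assoc, norC_add_smul_self hν, norC_add_smul_perp]
        linarith [hy.2.1])) hθ₁t hA
    rw [hτν] at e2
    rw [hν] at e1
    -- A tangential ray need not reach the boundary, but rays along ν and along τ + ν do, and τ is
    -- their difference.
    have h2 : ∫ x in Ω, inner ℝ (v.toFun x) (perp ν) * θ₁ x =
        (∫ x in Ω, inner ℝ (v.toFun x) (perp ν + ν) * θ₁ x) -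
          ∫ x in Ω, inner ℝ (v.toFun x) ν * θ₁ x := by
      have i1 : ∀ ξ, Integrable (fun x => inner ℝ (v.toFun x) ξ * θ₁ x) (volume.restrict Ω) :=
        fun ξ => (v.memLp_inner ξ).integrable_mul (hθ₁t.memLp 2 _)
      rw [← integral_sub (i1 _) (i1 _)]
      congr 1
      funext x
      rw [inner_add_right]; ring
    have h3 : ∫ x in Ω, quad (v.grad x) (perp ν) * χ x =
        -∫ x in Ω, inner ℝ (v.toFun x) (perp ν) * θ₁ x := by rw [h1, neg_neg]
    rw [h3, h2]
    have e3 := (abs_le.1 e1).2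
    have e4 := (abs_le.1 e2).1
    have e5 : 2 * C₀ / L * (3 * t) * 1 ^ 2 * I + 2 * C₀ / L * (3 * t) * 2 * I = 18 * C₀ / M * I := by
      rw [hL]; field_simp; ring
    rw [← hI] at e3 e4
    linarith
  have harea := v.area_le hΩ (isOpen_box _ _ _ _) hRΩ hτ hc₀ hc key
  have hDvol : (volume D).toReal = 2 * L * (5 * t) := by
    rw [hD, volume_box hν, ENNReal.toReal_mul, ENNReal.toReal_ofReal (by nlinarith),
      ENNReal.toReal_ofReal (by linarith)]
    ring
  have hRvol : (volume R).toReal = L * t := by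
    rw [hR, volume_box hν, ENNReal.toReal_mul, ENNReal.toReal_ofReal (by linarith),
      ENNReal.toReal_ofReal (by linarith)]
    ring
  have hDΩ : (volume (D ∩ Ω)).toReal ≤ 10 * (L * t) := by
    refine (ENNReal.toReal_mono ?_ (measure_mono inter_subset_left)).trans (le_of_eq ?_)
    · rw [hD, volume_box hν]; exact ENNReal.mul_ne_top ENNReal.ofReal_ne_top ENNReal.ofReal_ne_top
    · rw [hDvol]; ring
  have hmi : IntegrableOn v.misfit Ω := (v.memLp_misfit hΩ).integrable one_le_two
  have hIle : I ≤ (∫ x in D ∩ Ω, v.misfit x) + 20 * (L * t) := by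
    have hf : IsFiniteMeasure (volume.restrict (D ∩ Ω)) :=
      ⟨by simpa using (measure_ne_top_of_subset inter_subset_right hΩ).lt_top⟩
    rw [hI, integral_add (hmi.mono_set inter_subset_right) (integrable_const _), setIntegral_const,
      smul_eq_mul]
    simp only [Measure.real]
    linarith
  have hRle : ∫ x in R, v.misfit x ≤ ∫ x in D ∩ Ω, v.misfit x :=
    setIntegral_mono_set (hmi.mono_set inter_subset_right) (Eventually.of_forall v.misfit_nonneg)
      (LE.le.eventuallyLE (subset_inter hRD hRΩ))
  -- The misfit integral S enters twice, each time costing 10κLt, in total 20/128 = 45/288 of c₀Lt.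
  have hY := v.setIntegral_misfit_le hΩ (inter_subset_right (s := D)) (κ := c₀ / 128) (by positivity)
    hDΩ
  set S := ∫ x in D ∩ Ω, v.misfit x with hS
  set S2 := ∫ x in D ∩ Ω, v.misfit x ^ 2 with hS2
  have hS0 : 0 ≤ S := integral_nonneg v.misfit_nonneg
  have hS20 : 0 ≤ S2 := integral_nonneg fun x => sq_nonneg _
  rw [hRvol] at harea
  have hq1 : 18 * C₀ / M ≤ 1 := by rw [div_le_one hM]; exact hMC
  -- Here 2304 = 18 · 20 · 288/45, so the constant part of I costs another 45/288 of c₀Lt; both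
  -- losses together stay below one half.
  have hq2 : 18 * C₀ / M * 20 ≤ c₀ * (45 / 288) := by
    rw [div_mul_eq_mul_div, div_le_iff₀ hM]; nlinarith
  have hq0 : 0 ≤ 18 * C₀ / M := by positivity
  have hLt : 0 < L * t := by positivity
  have h5 : 18 * C₀ / M * I ≤ S + c₀ * (45 / 288) * (L * t) := by
    calc _ ≤ 18 * C₀ / M * (S + 20 * (L * t)) := by gcongr
      _ = 18 * C₀ / M * S + (18 * C₀ / M * 20) * (L * t) := by ring
      _ ≤ 1 * S + c₀ * (45 / 288) * (L * t) := by gcongr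
      _ = _ := by ring
  have h6 : 1 / (4 * (c₀ / 128)) * S2 = 32 / c₀ * S2 := by field_simp; ring
  rw [h6] at hY
  have h7 : c₀ / 2 * (L * t) ≤ L * W + 64 / c₀ * S2 := by
    have : 64 / c₀ * S2 = 2 * (32 / c₀ * S2) := by ring
    rw [this]
    nlinarith
  have h8 : c₀ / 2 * t ≤ W + 64 / (c₀ * L) * S2 := by
    have e : L * W + 64 / c₀ * S2 = L * (W + 64 / (c₀ * L) * S2) := by field_simp
    rw [e] at h7
    have e2 : c₀ / 2 * (L * t) = L * (c₀ / 2 * t) := by ring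
    rw [e2] at h7
    exact le_of_mul_le_mul_left h7 hL0
  refine h8.trans ?_
  gcongr
  linarith

end HexRhombic

namespace HexRhombic

/-! ### Local graphs -/

/-- Near `x₀`, the set `Ω` is the region below the graph of `g` in the frame given by `ν`. -/
def IsGraphNear (Ω : Set Plane) (x₀ ν : Plane) (r : ℝ) (g : ℝ → ℝ) : Prop :=
  ∀ y ∈ Metric.ball x₀ r, y ∈ Ω ↔ norC x₀ ν y < g (tanC x₀ ν y)

theorem IsGraphNear.notMem_closure {Ω : Set Plane} {x₀ ν : Plane} {r : ℝ} {g : ℝ → ℝ}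
    (h : IsGraphNear Ω x₀ ν r g) (hg : Continuous g) {y : Plane} (hy : y ∈ Metric.ball x₀ r)
    (hlt : g (tanC x₀ ν y) < norC x₀ ν y) : y ∉ closure Ω := by
  intro hcl
  have ho : IsOpen (Metric.ball x₀ r ∩ {y | g (tanC x₀ ν y) < norC x₀ ν y}) :=
    Metric.isOpen_ball.inter (isOpen_lt (hg.comp continuous_tanC) continuous_norC)
  obtain ⟨z, ⟨hz, hz'⟩, hzΩ⟩ := mem_closure_iff.1 hcl _ ho ⟨hy, hlt⟩
  exact absurd ((h z hz).1 hzΩ) (not_lt.2 (le_of_lt hz'))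

theorem IsGraphNear.mem_frontier_iff {Ω : Set Plane} (hΩ : IsOpen Ω) {x₀ ν : Plane} (hν : ‖ν‖ = 1)
    {r : ℝ} {g : ℝ → ℝ} (h : IsGraphNear Ω x₀ ν r g) (hg : Continuous g) {y : Plane}
    (hy : y ∈ Metric.ball x₀ r) : y ∈ frontier Ω ↔ norC x₀ ν y = g (tanC x₀ ν y) := by
  rw [hΩ.frontier_eq]
  constructor
  · rintro ⟨hcl, hn⟩
    refine le_antisymm ?_ ?_
    · by_contra! hlt
      exact h.notMem_closure hg hy hlt hcl
    · by_contra! hlt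
      exact hn ((h y hy).2 hlt)
  · intro he
    refine ⟨?_, fun hin => absurd ((h y hy).1 hin) (not_lt.2 he.ge)⟩
    have hc : Tendsto (fun n : ℕ => y + (-(1 / ((n : ℝ) + 1))) • ν) atTop (𝓝 y) := by
      have := (tendsto_one_div_add_atTop_nhds_zero_nat (𝕜 := ℝ)).neg.smul_const ν
      simpa using this.const_add y
    refine mem_closure_of_tendsto hc ?_
    filter_upwards [hc.eventually (Metric.isOpen_ball.mem_nhds hy)] with n hn
    rw [h _ hn, tanC_add_smul_self, norC_add_smul_self hν, he]
    have : 0 < 1 / ((n : ℝ) + 1) := by positivity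
    linarith

/-- Around any of its points Γ contains an arc of a graph, hence infinitely many points, and only
finitely many can be irregular. -/
theorem exists_regular_mem {Ω Γ : Set Plane} (hΩ : IsPiecewiseC3Domain Ω)
    (hΓ : IsRelOpenBoundary Ω Γ) (hne : Γ.Nonempty) : ∃ x ∈ Γ, IsRegularPoint Ω x := by
  obtain ⟨U, hU, rfl⟩ := hΓ
  obtain ⟨x, hxU, hx⟩ := hne
  obtain ⟨ν, hν, L, g, hg, r, hr, hgr⟩ := hΩ.graph x hx
  have hgr' : IsGraphNear Ω x ν r g := hgr
  have hgc := hg.continuous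
  have h0 : 0 = g 0 := by
    have := (hgr'.mem_frontier_iff hΩ.isOpen hν hgc (Metric.mem_ball_self hr)).1 hx
    simpa using this
  set p : ℝ → Plane := fun s => framePt x ν (s, g s) with hp
  have hpc : Continuous p := continuous_framePt.comp (continuous_id.prodMk hgc)
  have hp0 : p 0 = x := by simp [hp, framePt, ← h0]
  have hnhds : ∀ᶠ s in 𝓝 (0 : ℝ), p s ∈ U ∩ Metric.ball x r := by
    refine hpc.continuousAt.eventually_mem ?_
    rw [hp0]
    exact (hU.inter Metric.isOpen_ball).mem_nhds ⟨hxU, Metric.mem_ball_self hr⟩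
  have hpf : ∀ s, p s ∈ Metric.ball x r → p s ∈ frontier Ω := by
    intro s hs
    rw [hgr'.mem_frontier_iff hΩ.isOpen hν hgc hs, hp]
    simp only [tanC_framePt hν, norC_framePt hν]
  by_contra! hcon
  obtain ⟨δ, hδ, hball⟩ := Metric.eventually_nhds_iff_ball.1 hnhds
  have hinj : Set.InjOn p (Metric.ball 0 δ) := by
    intro s _ s' _ hss
    have := congrArg (tanC x ν) hss
    simpa [hp, tanC_framePt hν] using this
  have hinf : (Metric.ball (0 : ℝ) δ).Infinite := by
    rw [Real.ball_eq_Ioo]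
    exact Ioo_infinite (by linarith)
  refine (hinf.image hinj) (hΩ.finite_irregular.subset ?_)
  rintro _ ⟨s, hs, rfl⟩
  have h1 := hball s hs
  exact ⟨hpf s h1.2, hcon _ ⟨h1.1, hpf s h1.2⟩⟩

theorem W12.extendsByZero_of_graph {Ω : Set Plane} (hΩ : IsOpen Ω) {x₀ ν : Plane} (hν : ‖ν‖ = 1)
    {r ρ : ℝ} {g : ℝ → ℝ} (h : IsGraphNear Ω x₀ ν r g) (hg : Continuous g) (hρ : 2 * ρ ≤ r)
    {v : W12 Ω} {T : Plane → Plane} (hT : v.HasTrace T)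
    (hT0 : ∀ᵐ x ∂((μH[1] : Measure Plane).restrict (frontier Ω ∩ box x₀ ν (-ρ) ρ (-ρ) ρ)), T x = 0)
    {ξ : Plane} (hξ : ‖ξ‖ = 1)
    (hup : ∀ y ∈ box x₀ ν (-ρ) ρ (-ρ) ρ, ∀ r : ℝ, 0 < r → y + r • ξ ∈ box x₀ ν (-ρ) ρ (-ρ) ρ →
      g (tanC x₀ ν y) ≤ norC x₀ ν y → g (tanC x₀ ν (y + r • ξ)) < norC x₀ ν (y + r • ξ)) :
    v.ExtendsByZero (box x₀ ν (-ρ) ρ (-ρ) ρ) ξ := by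
  have hsub : box x₀ ν (-ρ) ρ (-ρ) ρ ⊆ Metric.ball x₀ r := by
    intro y hy
    rw [Metric.mem_ball, dist_eq_norm]
    refine (norm_sub_le_coords (x₀ := x₀) hν y x₀).trans_lt ?_
    rw [tanC_self, norC_self, sub_zero, sub_zero]
    linarith [abs_lt.2 hy.1, abs_lt.2 hy.2]
  have hconv : Convex ℝ (box x₀ ν (-ρ) ρ (-ρ) ρ) := by
    intro y hy z hz a b ha hb hab
    have h1 : tanC x₀ ν (a • y + b • z) = a * tanC x₀ ν y + b * tanC x₀ ν z := by
      obtain rfl : b = 1 - a := by linarith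
      simp only [tanC, inner_plane, PiLp.sub_apply, PiLp.add_apply, PiLp.smul_apply, smul_eq_mul]
      ring
    have h2 : norC x₀ ν (a • y + b • z) = a * norC x₀ ν y + b * norC x₀ ν z := by
      obtain rfl : b = 1 - a := by linarith
      simp only [norC, inner_plane, PiLp.sub_apply, PiLp.add_apply, PiLp.smul_apply, smul_eq_mul]
      ring
    refine ⟨?_, ?_⟩
    · rw [h1]; exact convex_Ioo (-ρ) ρ hy.1 hz.1 ha hb hab
    · rw [h2]; exact convex_Ioo (-ρ) ρ hy.2 hz.2 ha hb hab
  intro φ hφ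
  refine W12.integral_inner_fderiv_of_trace hΩ (isOpen_box _ _ _ _) hconv hT hT0 hξ ?_ hφ
  intro y hy hyΩ s hs hys
  refine h.notMem_closure hg (hsub hys) (hup y hy s hs hys ?_)
  by_contra! hlt
  exact hyΩ ((h y (hsub hy)).2 hlt)

/-- The number of scales is optimized: K is the largest integer with 4^K ≤ 1/ε, so that K + 1 is at
least of order |log ε| and the elastic prefactor 4^K costs no more than 1/ε. For ε ≥ 1 the single
scale K = 0 suffices. -/
theorem lower_of_dyadic {Ω Γ : Set Plane} (hΩ : volume Ω ≠ ⊤) {c₁ C₁ : ℝ} (hc₁ : 0 < c₁)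
    (hC₁ : 1 ≤ C₁) (h : ∀ v : W12 Ω, v.VanishesOn Γ → v.hessianVariation ≠ ⊤ → ∀ K : ℕ,
      (K + 1) * c₁ ≤ v.hessianVariation.toReal + C₁ * 4 ^ K * v.elastic) :
    ∃ c, 0 < c ∧ ∀ ε, 0 < ε →
      ENNReal.ofReal (c * min 1 (ε * (|Real.log ε| + 1))) ≤ minEnergy Ω Γ ε := by
  refine ⟨c₁ / (4 * C₁), by positivity, fun ε hε => le_iInf₂ fun v hv => ?_⟩
  have hE0 : 0 ≤ v.elastic := integral_nonneg fun x => sq_nonneg _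
  rw [v.energy_eq hΩ]
  by_cases hfin : v.hessianVariation = ⊤
  · rw [hfin, ENNReal.mul_top (by simpa using hε)]; simp
  set V := v.hessianVariation.toReal with hV
  have hV0 : 0 ≤ V := ENNReal.toReal_nonneg
  rw [← ENNReal.ofReal_toReal hfin, ← ENNReal.ofReal_mul hε.le, ← ENNReal.ofReal_add hE0 (by positivity)]
  refine ENNReal.ofReal_le_ofReal ?_
  rw [← hV, div_mul_eq_mul_div, div_le_iff₀ (by positivity)]
  rcases le_or_gt 1 ε with h1 | h1
  · have h2 := h v hv hfin 0
    simp only [Nat.cast_zero, zero_add, one_mul, pow_zero, mul_one] at h2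
    have h3 : min 1 (ε * (|Real.log ε| + 1)) ≤ 1 := min_le_left _ _
    calc _ ≤ c₁ * 1 := by gcongr
      _ ≤ V + C₁ * v.elastic := by linarith
      _ ≤ ε * V * C₁ + C₁ * v.elastic := by
          gcongr
          calc V = 1 * V * 1 := by ring
            _ ≤ _ := by gcongr
      _ ≤ _ := by nlinarith [mul_nonneg hE0 (by linarith : 0 ≤ C₁), mul_nonneg (mul_nonneg hε.le hV0) (by linarith : 0 ≤ C₁)]
  -- The choice 4^K ≤ 1/ε < 4^(K+1).
  · obtain ⟨K, hK1, hK2⟩ := exists_nat_pow_near (x := ε⁻¹) (y := 4) (one_le_inv₀ hε |>.2 h1.le) (by norm_num)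
    have h2 := h v hv hfin K
    have hlog : |Real.log ε| ≤ (K + 1) * 2 := by
      rw [abs_of_neg (Real.log_neg hε h1), ← Real.log_inv]
      have h4 : Real.log ε⁻¹ ≤ Real.log (4 ^ (K + 1)) := Real.log_le_log (by positivity) hK2.le
      rw [Real.log_pow] at h4
      have h5 : Real.log 4 ≤ 2 := by
        rw [show (4 : ℝ) = 2 ^ 2 by norm_num, Real.log_pow]
        have := Real.log_two_lt_d9
        push_cast; linarith
      push_cast at h4
      have : ((K : ℝ) + 1) * Real.log 4 ≤ (K + 1) * 2 := by gcongr
      linarith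
    have hK4 : ε * 4 ^ K ≤ 1 := by
      calc ε * 4 ^ K ≤ ε * ε⁻¹ := by gcongr
        _ = 1 := mul_inv_cancel₀ hε.ne'
    calc _ ≤ c₁ * (ε * (|Real.log ε| + 1)) := by gcongr; exact min_le_right _ _
      _ ≤ c₁ * (ε * ((K + 1) * 4)) := by
          gcongr
          have : (0 : ℝ) ≤ K := Nat.cast_nonneg K
          linarith
      _ = 4 * ε * ((K + 1) * c₁) := by ring
      _ ≤ 4 * ε * (V + C₁ * 4 ^ K * v.elastic) := by gcongr
      _ = 4 * (ε * V) + 4 * C₁ * v.elastic * (ε * 4 ^ K) := by ring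
      _ ≤ 4 * (ε * V) * C₁ + 4 * C₁ * v.elastic * 1 := by
          exact add_le_add (le_mul_of_one_le_right (by positivity) hC₁)
            (mul_le_mul_of_nonneg_left hK4 (by positivity))
      _ = _ := by ring

theorem abs_sub_le_of_deriv_small {g : ℝ → ℝ} (hg : ContDiff ℝ 3 g) (h0 : deriv g 0 = 0) {η : ℝ}
    (hη : 0 < η) : ∃ s₀ > 0, ∀ s ∈ Ioo (-s₀) s₀, ∀ s' ∈ Ioo (-s₀) s₀,
      |g s - g s'| ≤ η * |s - s'| := by
  have hc : Continuous (deriv g) := hg.continuous_deriv (by norm_num)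
  have h1 : ∀ᶠ s in 𝓝 (0 : ℝ), |deriv g s| < η := by
    have h2 : ContinuousAt (fun s => |deriv g s|) 0 := hc.abs.continuousAt
    exact h2.eventually_lt_const (by simpa [h0] using hη)
  obtain ⟨s₀, hs₀, hb⟩ := Metric.eventually_nhds_iff_ball.1 h1
  rw [Real.ball_eq_Ioo] at hb
  simp only [zero_sub, zero_add] at hb
  refine ⟨s₀, hs₀, fun s hs s' hs' => ?_⟩
  exact (convex_Ioo (-s₀) s₀).norm_image_sub_le_of_norm_deriv_le
    (fun x _ => hg.differentiable (by norm_num) x) (fun x hx => (hb x hx).le) hs' hs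

theorem measure_ne_top_of_isBounded {Ω : Set Plane} (h : Bornology.IsBounded Ω) :
    volume Ω ≠ ⊤ := h.measure_lt_top.ne

theorem W12.sum_sum_dirVar_le {Ω : Set Plane} (v : W12 Ω) (τ : Plane) (I : Finset ℕ)
    (J : ℕ → Finset ℕ) (R : ℕ → ℕ → Set Plane) {W : ℝ≥0∞}
    (hR : ∀ k ∈ I, ∀ j ∈ J k, R k j ⊆ Ω)
    (hd : ∀ k ∈ I, ∀ j ∈ J k, ∀ k' ∈ I, ∀ j' ∈ J k', ¬(k = k' ∧ j = j') →
      Disjoint (R k j) (R k' j')) (hW : W ≠ ⊤) (hle : v.dirVar τ Ω ≤ W) :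
    ∑ k ∈ I, ∑ j ∈ J k, (v.dirVar τ (R k j)).toReal ≤ W.toReal := by
  have hfin : ∀ k ∈ I, ∀ j ∈ J k, v.dirVar τ (R k j) ≠ ⊤ := fun k hk j hj =>
    ne_top_of_le_ne_top hW ((v.dirVar_mono _ (hR k hk j hj)).trans hle)
  have h1 := v.sum_dirVar_le τ (I.sigma J) (fun p => R p.1 p.2) (by
    rintro ⟨k, j⟩ hp ⟨k', j'⟩ hp' hne
    have hp := Finset.mem_sigma.1 (Finset.mem_coe.1 hp)
    have hp' := Finset.mem_sigma.1 (Finset.mem_coe.1 hp')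
    refine hd k hp.1 j hp.2 k' hp'.1 j' hp'.2 ?_
    rintro ⟨h1, h2⟩
    subst h1 h2
    exact hne rfl)
  have h2 : v.dirVar τ (⋃ p ∈ I.sigma J, R p.1 p.2) ≤ v.dirVar τ Ω :=
    v.dirVar_mono _ (iUnion₂_subset fun p hp => by
      have hp := Finset.mem_sigma.1 hp
      exact hR p.1 hp.1 p.2 hp.2)
  have h3 := ENNReal.toReal_mono hW ((h1.trans h2).trans hle)
  rw [ENNReal.toReal_sum fun p hp => hfin p.1 (Finset.mem_sigma.1 hp).1 p.2 (Finset.mem_sigma.1 hp).2,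
    Finset.sum_sigma] at h3
  exact h3

-- Near one regular point of Γ with non-exceptional normal, `box_lower` is applied at every scale
-- t₀/4^k to 4^k boxes following the graph. Within one scale the enlarged boxes are disjoint, so
-- their elastic energies sum to at most the total; across scales the small boxes are disjoint, so
-- the variations over all scales sum to at most |D²v|.
set_option maxHeartbeats 400000 in
theorem minEnergy_ge_log {Ω Γ : Set Plane} (hΩ : IsPiecewiseC3Domain Ω)
    (hΓ : IsRelOpenBoundary Ω Γ) (hne : Γ.Nonempty)
    (hnor : ∀ x ∈ Γ, ∀ ν : Plane, IsRegularWithNormal Ω x ν →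
      ∀ n ∈ amNormals, ∀ t : ℝ, ν ≠ t • n) :
    ∃ c, 0 < c ∧ ∀ ε, 0 < ε →
      ENNReal.ofReal (c * min 1 (ε * (|Real.log ε| + 1))) ≤ minEnergy Ω Γ ε := by
  have hvol := measure_ne_top_of_isBounded hΩ.isBounded
  obtain ⟨x₀, hx₀, ν, hreg⟩ := exists_regular_mem hΩ hΓ hne
  obtain ⟨c₀, hc₀, hc⟩ := exists_pos_le_abs_quad (hnor x₀ hx₀ ν hreg)
  obtain ⟨hν, g, hg, hg0, hg', r, hr, hgr⟩ := hreg
  have hgr' : IsGraphNear Ω x₀ ν r g := hgr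
  have hgc := hg.continuous
  obtain ⟨U, hU, rfl⟩ := hΓ
  obtain ⟨rU, hrU, hballU⟩ := Metric.isOpen_iff.1 hU x₀ hx₀.1
  obtain ⟨C₀, hC₀, hC⟩ := exists_bound_deriv_step₀
  -- The three summands serve the three lower bounds on M demanded by `box_lower`.
  set M := 3 + 18 * C₀ + 2304 * C₀ / c₀ with hM
  have hMc' : 0 < 2304 * C₀ / c₀ := by positivity
  have hM3 : 3 ≤ M := by linarith
  have hM0 : 0 < M := by linarith
  have hMC : 18 * C₀ ≤ M := by linarith
  have hMc : 2304 * C₀ ≤ M * c₀ := by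
    rw [← div_le_iff₀ hc₀]; linarith
  -- With slope at most 1/(8M) the graph moves by at most t/8 over a box of length M t and by t/4
  -- over the enlarged box of length 2M t.
  obtain ⟨s₀, hs₀, hlip⟩ := abs_sub_le_of_deriv_small hg hg' (η := 1 / (8 * M)) (by positivity)
  set ρ := min s₀ (min (r / 2) (rU / 2)) with hρdef
  have hρ : 0 < ρ := by positivity
  have hρs : ρ ≤ s₀ := min_le_left _ _
  have hρr : 2 * ρ ≤ r := by
    have : ρ ≤ r / 2 := (min_le_right _ _).trans (min_le_left _ _)
    linarith
  have hρU : 2 * ρ ≤ rU := by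
    have : ρ ≤ rU / 2 := (min_le_right _ _).trans (min_le_right _ _)
    linarith
  set B := box x₀ ν (-ρ) ρ (-ρ) ρ with hB
  have hBball : ∀ r' : ℝ, 2 * ρ ≤ r' → B ⊆ Metric.ball x₀ r' := by
    intro r' hr' y hy
    rw [Metric.mem_ball, dist_eq_norm]
    refine (norm_sub_le_coords (x₀ := x₀) hν y x₀).trans_lt ?_
    rw [tanC_self, norC_self, sub_zero, sub_zero]
    linarith [abs_lt.2 hy.1, abs_lt.2 hy.2]
  have hlipB : ∀ s ∈ Ioo (-ρ) ρ, ∀ s' ∈ Ioo (-ρ) ρ, |g s - g s'| ≤ 1 / (8 * M) * |s - s'| :=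
    fun s hs s' hs' => hlip s ⟨by linarith [hs.1], by linarith [hs.2]⟩ s'
      ⟨by linarith [hs'.1], by linarith [hs'.2]⟩
  have hη : 1 / (8 * M) ≤ 1 / 24 := one_div_le_one_div_of_le (by norm_num) (by linarith)
  -- Then 4^k enlarged boxes of length 2M t₀/4^k fill exactly the length 2M t₀ = ρ/2, at every
  -- scale.
  set t₀ := ρ / (4 * M) with ht₀
  have ht₀0 : 0 < t₀ := by positivity
  have hMt₀ : M * t₀ = ρ / 4 := by rw [ht₀]; field_simp
  refine lower_of_dyadic hvol (c₁ := c₀ / 2 * t₀) (C₁ := 1 + 128 / (c₀ * t₀)) (by positivity)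
    (by linarith [show 0 < 128 / (c₀ * t₀) by positivity]) fun v hv hfin K => ?_
  obtain ⟨T, hT, hT0⟩ := hv
  have hT0' : ∀ᵐ x ∂((μH[1] : Measure Plane).restrict (frontier Ω ∩ B)), T x = 0 := by
    refine ae_mono (Measure.restrict_mono_set _ ?_) hT0
    exact fun y hy => ⟨hballU (hBball _ hρU hy.2), hy.1⟩
  have hext : v.ExtendsByZero B ν := by
    refine W12.extendsByZero_of_graph hΩ.isOpen hν hgr' hgc hρr hT hT0' hν ?_
    intro y _ s hs _ hle
    rw [tanC_add_smul_self, norC_add_smul_self hν]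
    linarith
  have hext' : v.ExtendsByZero B (perp ν + ν) := by
    have hn : ‖perp ν + ν‖ = √2 := by
      rw [← Real.sqrt_sq (norm_nonneg _)]
      congr 1
      have := unit_sq hν
      rw [norm_sq_plane]; simp; nlinarith
    have h2 : 0 < √2 := by positivity
    -- The trace formula wants a unit direction. The graph has slope below 1, so the diagonal ray
    -- leaves Ω for good; the factor √2 is restored by homogeneity.
    have hx : v.ExtendsByZero B ((√2)⁻¹ • (perp ν + ν)) := by
      refine W12.extendsByZero_of_graph hΩ.isOpen hν hgr' hgc hρr hT hT0' ?_ ?_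
      · rw [norm_smul, hn, norm_inv, Real.norm_of_nonneg h2.le, inv_mul_cancel₀ h2.ne']
      · intro y hy s hs hys hle
        have e : y + s • (√2)⁻¹ • (perp ν + ν) =
            y + (s * (√2)⁻¹) • perp ν + (s * (√2)⁻¹) • ν := by module
        rw [e] at hys ⊢
        set s' := s * (√2)⁻¹ with hs'
        have hs'0 : 0 < s' := by positivity
        have h3 := hys.1
        rw [tanC_add_smul_self, tanC_add_smul_perp hν] at h3 ⊢
        rw [norC_add_smul_self hν, norC_add_smul_perp]
        have h4 := hlipB _ h3 _ hy.1
        rw [add_sub_cancel_left, abs_of_pos hs'0] at h4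
        have h5 : 1 / (8 * M) * s' ≤ 1 / 24 * s' := by gcongr
        linarith [(abs_le.1 h4).2]
    have := hx.smul (√2)
    rwa [smul_smul, mul_inv_cancel₀ h2.ne', one_smul] at this
  set V := v.hessianVariation.toReal with hV
  have hdv : v.dirVar (perp ν) Ω ≤ v.hessianVariation :=
    v.dirVar_le_hessianVariation (by rw [norm_perp, hν])
  let tt : ℕ → ℝ := fun k => t₀ / 4 ^ k
  have htt0 : ∀ k, 0 < tt k := fun k => by positivity
  have httle : ∀ k, tt k ≤ t₀ := fun k => div_le_self ht₀0.le (one_le_pow₀ (by norm_num))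
  -- The spacing is the length of the enlarged boxes, twice that of the small ones.
  let ss : ℕ → ℕ → ℝ := fun k j => 2 * M * tt k * j
  let RR : ℕ → ℕ → Set Plane := fun k j =>
    box x₀ ν (ss k j) (ss k j + M * tt k) (g (ss k j) - 2 * tt k) (g (ss k j) - tt k)
  let DD : ℕ → ℕ → Set Plane := fun k j =>
    box x₀ ν (ss k j) (ss k j + 2 * M * tt k) (g (ss k j) - 2 * tt k) (g (ss k j) + 2 * tt k + tt k)
  have hss : ∀ k j, j < 4 ^ k → 0 ≤ ss k j ∧ ss k j + 2 * M * tt k ≤ ρ / 2 := by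
    intro k j hj
    have hj' : (j : ℝ) + 1 ≤ 4 ^ k := by exact_mod_cast hj
    refine ⟨by positivity, ?_⟩
    have : ss k j + 2 * M * tt k = 2 * (M * t₀) * ((j + 1) / 4 ^ k) := by
      simp only [ss, tt]; field_simp
    rw [this, hMt₀]
    have h6 : ((j : ℝ) + 1) / 4 ^ k ≤ 1 := div_le_one_of_le₀ hj' (by positivity)
    nlinarith
  have hssB : ∀ k j, j < 4 ^ k → ss k j ∈ Ioo (-ρ) ρ := fun k j hj => by
    obtain ⟨h1, h2⟩ := hss k j hj
    have := mul_pos hM0 (htt0 k)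
    exact ⟨by linarith, by nlinarith⟩
  have ht₀ρ : 12 * t₀ ≤ ρ := by nlinarith
  have hgs : ∀ k j, j < 4 ^ k → |g (ss k j)| ≤ ρ / 24 := by
    intro k j hj
    have h1 := hlipB _ (hssB k j hj) 0 ⟨by linarith, hρ⟩
    rw [hg0, sub_zero, sub_zero] at h1
    have h2 : |ss k j| ≤ ρ := (abs_lt.2 (hssB k j hj)).le
    calc _ ≤ 1 / (8 * M) * |ss k j| := h1
      _ ≤ 1 / 24 * ρ := by gcongr
      _ = _ := by ring
  have hDDB : ∀ k j, j < 4 ^ k → DD k j ⊆ B := by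
    intro k j hj y hy
    obtain ⟨h1, h2⟩ := hss k j hj
    obtain ⟨h3, h4⟩ := abs_le.1 (hgs k j hj)
    have := httle k
    refine ⟨⟨by linarith [hy.1.1], by linarith [hy.1.2]⟩, ⟨?_, ?_⟩⟩
    · linarith [hy.2.1]
    · linarith [hy.2.2]
  have hclose : ∀ k j, j < 4 ^ k → ∀ y ∈ B, ss k j < tanC x₀ ν y → ∀ w, 
      tanC x₀ ν y < ss k j + w → |g (tanC x₀ ν y) - g (ss k j)| ≤ 1 / (8 * M) * w := by
    intro k j hj y hy h1 w h2
    refine (hlipB _ hy.1 _ (hssB k j hj)).trans ?_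
    rw [abs_of_pos (by linarith)]
    gcongr
    linarith
  have hRD : ∀ k j, RR k j ⊆ DD k j := fun k j y hy => by
    have := mul_pos hM0 (htt0 k)
    have := htt0 k
    exact ⟨⟨hy.1.1, by linarith [hy.1.2]⟩, ⟨hy.2.1, by linarith [hy.2.2]⟩⟩
  -- Depth below the graph lies between 7/8 and 17/8 of the scale. As 17/8 · 1/4 < 7/8, boxes of
  -- different generations are disjoint.
  have hdepth : ∀ k j, j < 4 ^ k → ∀ y ∈ RR k j,
      7 / 8 * tt k < g (tanC x₀ ν y) - norC x₀ ν y ∧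
        g (tanC x₀ ν y) - norC x₀ ν y < 17 / 8 * tt k := by
    intro k j hj y hy
    have h1 := hclose k j hj y (hDDB k j hj (hRD k j hy)) hy.1.1 _ hy.1.2
    have e : 1 / (8 * M) * (M * tt k) = tt k / 8 := by field_simp
    rw [e] at h1
    obtain ⟨h2, h3⟩ := abs_le.1 h1
    constructor
    · linarith [hy.2.2]
    · linarith [hy.2.1]
  have hRΩ : ∀ k j, j < 4 ^ k → RR k j ⊆ Ω := by
    intro k j hj y hy
    rw [hgr' y (hBball _ hρr (hDDB k j hj (hRD k j hy)))]
    have := (hdepth k j hj y hy).1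
    have := htt0 k
    linarith
  have hout : ∀ k j, j < 4 ^ k → ∀ y ∈ DD k j, g (ss k j) + tt k < norC x₀ ν y → y ∉ Ω := by
    intro k j hj y hy hlt
    rw [hgr' y (hBball _ hρr (hDDB k j hj hy)), not_lt]
    have h1 := hclose k j hj y (hDDB k j hj hy) hy.1.1 _ hy.1.2
    have e : 1 / (8 * M) * (2 * M * tt k) = tt k / 4 := by field_simp; ring
    rw [e] at h1
    have := htt0 k
    linarith [(abs_le.1 h1).2]
  have hfinR : ∀ k j, j < 4 ^ k → v.dirVar (perp ν) (RR k j) ≠ ⊤ := fun k j hj =>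
    ne_top_of_le_ne_top hfin ((v.dirVar_mono _ (hRΩ k j hj)).trans hdv)
  have hjdisj : ∀ k j j' : ℕ, j < j' → ∀ y, tanC x₀ ν y < ss k j + 2 * M * tt k →
      ss k j' < tanC x₀ ν y → False := by
    intro k j j' hjj y h1 h2
    have h3 : (j : ℝ) + 1 ≤ j' := by exact_mod_cast hjj
    have h4 : ss k j + 2 * M * tt k ≤ ss k j' := by
      calc ss k j + 2 * M * tt k = 2 * M * tt k * (j + 1) := by simp only [ss]; ring
        _ ≤ 2 * M * tt k * j' := by
            have := htt0 k
            gcongr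
    linarith
  have hDdisj : ∀ k, ∀ j j' : ℕ, j ≠ j' → Disjoint (DD k j) (DD k j') := by
    intro k j j' hne
    rw [disjoint_left]
    intro y hy hy'
    rcases lt_or_gt_of_ne hne with h | h
    · exact hjdisj k j j' h y hy.1.2 hy'.1.1
    · exact hjdisj k j' j h y hy'.1.2 hy.1.1
  have hkdisj : ∀ k k' j j', k < k' → j < 4 ^ k → j' < 4 ^ k' → Disjoint (RR k j) (RR k' j') := by
    intro k k' j j' hkk hj hj'
    rw [disjoint_left]
    intro y hy hy'
    have h1 := (hdepth k j hj y hy).1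
    have h2 := (hdepth k' j' hj' y hy').2
    have h3 : tt k' ≤ tt k / 4 := by
      have : tt k / 4 = t₀ / 4 ^ (k + 1) := by simp only [tt]; rw [pow_succ]; field_simp
      rw [this]
      exact div_le_div_of_nonneg_left ht₀0.le (by positivity)
        (pow_le_pow_right₀ (by norm_num) hkk)
    have := htt0 k
    linarith
  have hbox : ∀ k j, j < 4 ^ k → c₀ / 2 * tt k ≤ (v.dirVar (perp ν) (RR k j)).toReal +
      (64 / (c₀ * tt k)) * ∫ x in DD k j ∩ Ω, v.misfit x ^ 2 := fun k j hj =>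
    v.box_lower hΩ.isOpen hvol hν hc₀ hc hC₀ hC (htt0 k) hM3 hMC hMc hext hext' (hRΩ k j hj)
      (hDDB k j hj) (hout k j hj) (hfinR k j hj)
  have hE : IntegrableOn (fun x => v.misfit x ^ 2) Ω := (v.memLp_misfit hvol).integrable_sq
  have hDsum : ∀ k, ∑ j ∈ Finset.range (4 ^ k), ∫ x in DD k j ∩ Ω, v.misfit x ^ 2 ≤ v.elastic := by
    intro k
    rw [← integral_biUnion_finset]
    · exact setIntegral_mono_set hE (Eventually.of_forall fun x => sq_nonneg _)
        (LE.le.eventuallyLE (iUnion₂_subset fun j _ => inter_subset_right))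
    · exact fun j _ => (isOpen_box _ _ _ _).measurableSet.inter hΩ.isOpen.measurableSet
    · exact fun j _ j' _ hne => (hDdisj k j j' hne).mono inter_subset_left inter_subset_left
    · exact fun j _ => hE.mono_set inter_subset_right
  have hscale : ∀ k, c₀ / 2 * t₀ ≤ ∑ j ∈ Finset.range (4 ^ k), (v.dirVar (perp ν) (RR k j)).toReal +
      64 / (c₀ * t₀) * 4 ^ k * v.elastic := by
    intro k
    have h1 : ∑ j ∈ Finset.range (4 ^ k), c₀ / 2 * tt k = c₀ / 2 * t₀ := by
      rw [Finset.sum_const, Finset.card_range, nsmul_eq_mul]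
      simp only [tt]; push_cast; field_simp
    rw [← h1]
    refine (Finset.sum_le_sum fun j hj => hbox k j (Finset.mem_range.1 hj)).trans ?_
    rw [Finset.sum_add_distrib, ← Finset.mul_sum]
    have h2 : 64 / (c₀ * tt k) = 64 / (c₀ * t₀) * 4 ^ k := by
      simp only [tt]; field_simp
    rw [h2]
    gcongr
    exact hDsum k
  have hsumV : ∑ k ∈ Finset.range (K + 1), ∑ j ∈ Finset.range (4 ^ k),
      (v.dirVar (perp ν) (RR k j)).toReal ≤ V := by
    have hj4 : ∀ k j, j ∈ Finset.range (4 ^ k) → j < 4 ^ k := fun k j hj => Finset.mem_range.1 hj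
    refine v.sum_sum_dirVar_le (perp ν) (Finset.range (K + 1)) (fun k => Finset.range (4 ^ k)) RR
      (Ω := Ω) (fun k _ j hj => hRΩ k j (hj4 k j hj)) ?_ hfin hdv
    intro k _ j hj k' _ j' hj' hne
    have hj := hj4 k j hj
    have hj' := hj4 k' j' hj'
    rcases lt_trichotomy k k' with h | h | h
    · exact hkdisj k k' j j' h hj hj'
    · subst h
      exact (hDdisj k j j' fun h => hne ⟨rfl, h⟩).mono (hRD _ _) (hRD _ _)
    · exact (hkdisj k' k j' j h hj' hj).symm
  have hgeom : ∑ k ∈ Finset.range (K + 1), (4 : ℝ) ^ k ≤ 2 * 4 ^ K := by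
    rw [geom_sum_eq (by norm_num), div_le_iff₀ (by norm_num), pow_succ]
    have : (1 : ℝ) ≤ 4 ^ K := one_le_pow₀ (by norm_num)
    linarith
  have hE0 : 0 ≤ v.elastic := integral_nonneg fun x => sq_nonneg _
  calc (K + 1) * (c₀ / 2 * t₀) = ∑ k ∈ Finset.range (K + 1), c₀ / 2 * t₀ := by
        rw [Finset.sum_const, Finset.card_range, nsmul_eq_mul]; push_cast; ring
    _ ≤ _ := Finset.sum_le_sum fun k _ => hscale k
    _ ≤ V + 64 / (c₀ * t₀) * (2 * 4 ^ K) * v.elastic := by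
        rw [Finset.sum_add_distrib, ← Finset.sum_mul, ← Finset.mul_sum]
        gcongr
    _ = V + 128 / (c₀ * t₀) * 4 ^ K * v.elastic := by ring
    _ ≤ _ := by
        gcongr
        linarith

end HexRhombic

namespace HexRhombic

/-! ### Lower bound for convex domains with zero boundary values -/

/-- H is the primitive of a normalized bump. The bump equals 1 on [−r, r], so its mass c is at least
2r, and H′ equals its maximum 1/c on the whole plateau. A long plateau makes weighting by H′ almost
the same as plain averaging over the chord. -/
theorem exists_plateau_step {r R : ℝ} (hr : 0 < r) (hrR : r < R) :
    ∃ (H : ℝ → ℝ) (c M : ℝ), (∀ R', R < R' → IsStep H (-R') R') ∧ 2 * r ≤ c ∧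
      (∀ s, |s| ≤ r → deriv H s = 1 / c) ∧ (∀ s, 0 ≤ deriv H s ∧ deriv H s ≤ 1 / c) ∧
      ∀ s, |deriv (deriv H) s| ≤ M := by
  let f : ContDiffBump (0 : ℝ) := ⟨r, R, hr, hrR⟩
  set q : ℝ → ℝ := f.normed volume with hq
  have hqs : ContDiff ℝ ∞ q := f.contDiff_normed
  have hqc : HasCompactSupport q := f.hasCompactSupport_normed
  have hq0 : ∀ s, 0 ≤ q s := f.nonneg_normed
  have hsupp : Function.support q = Ioo (-R) R := by
    rw [hq, f.support_normed_eq, Real.ball_eq_Ioo]; simp [f]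
  set H : ℝ → ℝ := fun s => ∫ t in (-R)..s, q t with hH
  have hderiv : deriv H = q := by
    funext s
    exact (hqs.continuous.integral_hasStrictDerivAt (-R) s).hasDerivAt.deriv
  have hdiff : Differentiable ℝ H := fun s =>
    (hqs.continuous.integral_hasStrictDerivAt (-R) s).hasDerivAt.differentiableAt
  have hHs : ContDiff ℝ ∞ H := by
    rw [contDiff_infty_iff_deriv, hderiv]; exact ⟨hdiff, hqs⟩
  have hmono : Monotone H := monotone_of_deriv_nonneg hdiff (by rw [hderiv]; exact hq0)
  have h0 : ∀ s ≤ -R, H s = 0 := by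
    intro s hs
    rw [hH]
    simp only
    rw [intervalIntegral.integral_congr (g := fun _ => (0 : ℝ))]
    · simp
    · intro t ht
      rw [uIcc_of_ge hs] at ht
      by_contra hne
      have : t ∈ Function.support q := hne
      rw [hsupp] at this
      linarith [this.1, ht.2]
  have h1 : ∀ s, R ≤ s → H s = 1 := by
    intro s hs
    rw [hH]
    simp only
    rw [intervalIntegral.integral_eq_integral_of_support_subset]
    · exact f.integral_normed
    · rw [hsupp]; exact fun t ht => ⟨ht.1, by linarith [ht.2]⟩
  obtain ⟨M, hM⟩ := hqc.deriv.exists_bound_of_continuous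
    ((contDiff_infty_iff_deriv.1 hqs).2.continuous)
  refine ⟨H, ∫ t, f t, M, fun R' hR' => ⟨hHs, fun s => ?_, fun s => ?_, -R, R, by linarith,
    by linarith, hR', h0, h1⟩, ?_, ?_, ?_, ?_⟩
  · rw [← h0 (min s (-R)) (min_le_right _ _)]; exact hmono (min_le_left _ _)
  · rw [← h1 (max s R) (le_max_right _ _)]; exact hmono (le_max_left _ _)
  · have := f.measure_closedBall_le_integral volume
    rw [Real.closedBall_eq_Icc, Measure.real, Real.volume_Icc] at this
    rw [ENNReal.toReal_ofReal (by simp [f]; linarith)] at this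
    refine le_trans (le_of_eq ?_) this
    simp [f]; ring
  · intro s hs
    rw [hderiv, hq, ContDiffBump.normed, f.one_of_mem_closedBall]
    rw [Metric.mem_closedBall, dist_zero_right]; exact hs
  · intro s
    rw [hderiv]
    exact ⟨hq0 s, div_le_div_of_nonneg_right f.le_one f.integral_pos.le⟩
  · rw [hderiv]; exact hM

theorem exists_midpoint_chord {Ω : Set Plane} (hΩ : IsOpen Ω) (hc : Convex ℝ Ω)
    (hb : Bornology.IsBounded Ω) (hne : Ω.Nonempty) {τ : Plane} (hτ : ‖τ‖ = 1) :
    ∃ (x₀ : Plane) (ℓ : ℝ), 0 < ℓ ∧ ∀ s : ℝ, x₀ + s • τ ∈ Ω ↔ |s| < ℓ := by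
  obtain ⟨y, hy⟩ := hne
  set S : Set ℝ := {s | y + s • τ ∈ Ω} with hS
  have hSo : IsOpen S := hΩ.preimage (by fun_prop)
  have hSc : Convex ℝ S := by
    intro a ha b hb p q hp hq hpq
    have := hc ha hb hp hq hpq
    have e : p • (y + a • τ) + q • (y + b • τ) = y + (p • a + q • b) • τ := by
      obtain rfl : q = 1 - p := by linarith
      module
    rwa [e] at this
  obtain ⟨C, hC⟩ := hb.exists_norm_le
  have hSb : S ⊆ Icc (-(C + ‖y‖)) (C + ‖y‖) := by
    intro s hs
    rw [mem_Icc, ← abs_le]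
    have h1 := hC _ hs
    have h2 : ‖s • τ‖ = |s| := by rw [norm_smul, hτ, mul_one, Real.norm_eq_abs]
    rw [← h2]
    calc ‖s • τ‖ = ‖(y + s • τ) - y‖ := by rw [add_sub_cancel_left]
      _ ≤ _ := (norm_sub_le _ _).trans (by linarith)
  have h0 : (0 : ℝ) ∈ S := by simpa [hS] using hy
  have hbb : BddBelow S := bddBelow_Icc.mono hSb
  have hba : BddAbove S := bddAbove_Icc.mono hSb
  have hIoo : S = Ioo (sInf S) (sSup S) := by
    apply Subset.antisymm
    · intro s hs
      obtain ⟨ε, hε, hball⟩ := Metric.isOpen_iff.1 hSo s hs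
      have h1 : s - ε / 2 ∈ S := hball (by
        rw [Metric.mem_ball, Real.dist_eq, abs_lt]; constructor <;> linarith)
      have h2 : s + ε / 2 ∈ S := hball (by
        rw [Metric.mem_ball, Real.dist_eq, abs_lt]; constructor <;> linarith)
      exact ⟨by linarith [csInf_le hbb h1], by linarith [le_csSup hba h2]⟩
    · exact IsConnected.Ioo_csInf_csSup_subset ⟨⟨0, h0⟩, hSc.isPreconnected⟩ hbb hba
  have hlt : sInf S < sSup S := by
    rw [hIoo] at h0; linarith [h0.1, h0.2]
  refine ⟨y + ((sInf S + sSup S) / 2) • τ, (sSup S - sInf S) / 2, by linarith, fun s => ?_⟩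
  have e : y + ((sInf S + sSup S) / 2) • τ + s • τ = y + ((sInf S + sSup S) / 2 + s) • τ := by
    module
  rw [e]
  change (sInf S + sSup S) / 2 + s ∈ S ↔ _
  rw [hIoo, abs_lt, mem_Ioo, ← hIoo]
  constructor <;> rintro ⟨h1, h2⟩ <;> constructor <;> linarith

theorem convex_box {x₀ ν : Plane} (α β γ δ : ℝ) : Convex ℝ (box x₀ ν α β γ δ) := by
  intro y hy z hz a b ha hb hab
  have h1 : tanC x₀ ν (a • y + b • z) = a * tanC x₀ ν y + b * tanC x₀ ν z := by
    obtain rfl : b = 1 - a := by linarith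
    simp only [tanC, inner_plane, PiLp.sub_apply, PiLp.add_apply, PiLp.smul_apply, smul_eq_mul]
    ring
  have h2 : norC x₀ ν (a • y + b • z) = a * norC x₀ ν y + b * norC x₀ ν z := by
    obtain rfl : b = 1 - a := by linarith
    simp only [norC, inner_plane, PiLp.sub_apply, PiLp.add_apply, PiLp.smul_apply, smul_eq_mul]
    ring
  constructor
  · rw [h1]; exact convex_Ioo _ _ hy.1 hz.1 ha hb hab
  · rw [h2]; exact convex_Ioo _ _ hy.2 hz.2 ha hb hab

/-- Beyond a point outside an open convex set, a ray coming from the set stays away from it. -/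
theorem Convex.add_smul_notMem_closure {Ω : Set Plane} (hΩ : IsOpen Ω) (hc : Convex ℝ Ω)
    {p ξ : Plane} {s r : ℝ} (hp : p ∈ Ω) (hs : 0 < s) (hr : 0 < r) (hy : p + s • ξ ∉ Ω) :
    p + s • ξ + r • ξ ∉ closure Ω := by
  intro hcl
  apply hy
  have h := hc.openSegment_interior_closure_subset_interior (hΩ.interior_eq.symm ▸ hp) hcl
  rw [hΩ.interior_eq] at h
  refine h ⟨r / (s + r), s / (s + r), by positivity, by positivity, by field_simp; ring, ?_⟩
  have h1 : (s / (s + r)) * (s + r) = s := by field_simp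
  have h2 : r / (s + r) + s / (s + r) = 1 := by field_simp; ring
  calc (r / (s + r)) • p + (s / (s + r)) • (p + s • ξ + r • ξ)
      = (r / (s + r) + s / (s + r)) • p + ((s / (s + r)) * (s + r)) • ξ := by module
    _ = p + s • ξ := by rw [h1, h2, one_smul]

/-- The line crosses the frontier twice, so the one-sided formula does not apply directly. The test
function is split into parts right and left of the middle: starting from the middle strip, which
lies in Ω, a ray to either side leaves the convex set once and for all. -/
theorem W12.extendsByZero_of_convex {Ω : Set Plane} (hΩ : IsOpen Ω) (hc : Convex ℝ Ω) (v : W12 Ω)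
    (hv : v.VanishesOn (frontier Ω)) {x₀ ν : Plane} (hν : ‖ν‖ = 1) {a κ N : ℝ} (ha : 0 < a)
    (haN : a < N) (hsub : ∀ y, |tanC x₀ ν y| ≤ a → |norC x₀ ν y| < κ → y ∈ Ω) :
    v.ExtendsByZero (box x₀ ν (-N) N (-κ) κ) (perp ν) := by
  obtain ⟨T, hT, hT0⟩ := hv
  have hT0' : ∀ B : Set Plane,
      ∀ᵐ x ∂((μH[1] : Measure Plane).restrict (frontier Ω ∩ B)), T x = 0 := fun B =>
    ae_mono (Measure.restrict_mono_set _ inter_subset_left) hT0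
  have hτ : ‖perp ν‖ = 1 := by rw [norm_perp, hν]
  have hp : ∀ y ∈ box x₀ ν (-N) N (-κ) κ, y + (-tanC x₀ ν y) • perp ν ∈ Ω ∧
      y + (-tanC x₀ ν y + a) • perp ν ∈ Ω ∧ y + (-tanC x₀ ν y - a) • perp ν ∈ Ω := by
    intro y hy
    refine ⟨hsub _ ?_ ?_, hsub _ ?_ ?_, hsub _ ?_ ?_⟩
    all_goals first
      | rw [norC_add_smul_perp]; exact abs_lt.2 hy.2
      | rw [tanC_add_smul_perp hν]; ring_nf; simp [abs_of_pos ha, ha.le]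
  have hright : v.ExtendsByZero (box x₀ ν (-a) N (-κ) κ) (perp ν) := by
    intro φ hφ
    refine W12.integral_inner_fderiv_of_trace hΩ (isOpen_box _ _ _ _) (convex_box _ _ _ _) hT
      (hT0' _) hτ (fun y hy hyΩ r hr _ => ?_) hφ
    have h1 := (hp y ⟨⟨by linarith [hy.1.1], hy.1.2⟩, hy.2⟩).2.2
    have e : y = y + (-tanC x₀ ν y - a) • perp ν + (tanC x₀ ν y + a) • perp ν := by module
    rw [e] at hyΩ ⊢
    exact Convex.add_smul_notMem_closure hΩ hc h1 (by linarith [hy.1.1]) hr hyΩ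
  have hleft' : v.ExtendsByZero (box x₀ ν (-N) a (-κ) κ) (-perp ν) := by
    intro φ hφ
    refine W12.integral_inner_fderiv_of_trace hΩ (isOpen_box _ _ _ _) (convex_box _ _ _ _) hT
      (hT0' _) (by rw [norm_neg, hτ]) (fun y hy hyΩ r hr _ => ?_) hφ
    have h1 := (hp y ⟨⟨hy.1.1, by linarith [hy.1.2]⟩, hy.2⟩).2.1
    have e : y = y + (-tanC x₀ ν y + a) • perp ν + (a - tanC x₀ ν y) • (-perp ν) := by module
    rw [e] at hyΩ ⊢
    exact Convex.add_smul_notMem_closure hΩ hc h1 (by linarith [hy.1.2]) hr hyΩ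
  have hleft : v.ExtendsByZero (box x₀ ν (-N) a (-κ) κ) (perp ν) := by
    have := hleft'.smul (-1)
    rwa [neg_smul, one_smul, neg_neg] at this
  intro φ hφ
  -- A cutoff in the tangential variable, 0 left of −a/3 and 1 right of a/3: each part of φ keeps
  -- inside its own box.
  set p : Plane → ℝ := fun x => step₀ ((2 * a)⁻¹ * (tanC x₀ ν x - (-a))) with hpdef
  have hps : ContDiff ℝ ∞ p := contDiff_step₀.comp
    (contDiff_const.mul (contDiff_tanC.sub contDiff_const))
  have h1 : IsTest (box x₀ ν (-a) N (-κ) κ) fun x => φ x * p x := by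
    refine isTest_of_eq_zero (K := tsupport φ ∩ {x | -(a / 3) ≤ tanC x₀ ν x})
      (hφ.smooth.mul hps) (IsCompact.inter_right hφ.compact (isClosed_Ici.preimage continuous_tanC))
      (fun x hx => ⟨⟨?_, (hφ.support hx.1).1.2⟩, (hφ.support hx.1).2⟩) fun x hx => ?_
    · have : -(a / 3) ≤ tanC x₀ ν x := hx.2
      linarith
    · by_cases hxs : x ∈ tsupport φ
      · have : tanC x₀ ν x < -(a / 3) := by
          by_contra! h
          exact hx ⟨hxs, h⟩
        rw [hpdef]
        simp only
        rw [step₀_eq_zero, mul_zero]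
        rw [inv_mul_le_iff₀ (by linarith)]; linarith
      · rw [image_eq_zero_of_notMem_tsupport hxs, zero_mul]
  have h2 : IsTest (box x₀ ν (-N) a (-κ) κ) fun x => φ x * (1 - p x) := by
    refine isTest_of_eq_zero (K := tsupport φ ∩ {x | tanC x₀ ν x ≤ a / 3})
      (hφ.smooth.mul (contDiff_const.sub hps))
      (IsCompact.inter_right hφ.compact (isClosed_Iic.preimage continuous_tanC))
      (fun x hx => ⟨⟨(hφ.support hx.1).1.1, ?_⟩, (hφ.support hx.1).2⟩) fun x hx => ?_
    · have : tanC x₀ ν x ≤ a / 3 := hx.2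
      linarith
    · by_cases hxs : x ∈ tsupport φ
      · have : a / 3 < tanC x₀ ν x := by
          by_contra! h
          exact hx ⟨hxs, h⟩
        rw [hpdef]
        simp only
        rw [step₀_eq_one, sub_self, mul_zero]
        rw [le_inv_mul_iff₀ (by linarith)]; linarith
      · rw [image_eq_zero_of_notMem_tsupport hxs, zero_mul]
  have e : φ = fun x => φ x * p x + φ x * (1 - p x) := by funext x; ring
  have e1 := hright _ h1
  have e2 := hleft _ h2
  have ed : ∀ x, fderiv ℝ φ x (perp ν) = fderiv ℝ (fun x => φ x * p x) x (perp ν) +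
      fderiv ℝ (fun x => φ x * (1 - p x)) x (perp ν) := by
    intro x
    conv_lhs => rw [e]
    exact fderiv_add_apply h1 h2 x _
  have ei : ∀ x, inner ℝ (v.toFun x) (perp ν) * fderiv ℝ φ x (perp ν) =
      inner ℝ (v.toFun x) (perp ν) * fderiv ℝ (fun x => φ x * p x) x (perp ν) +
      inner ℝ (v.toFun x) (perp ν) * fderiv ℝ (fun x => φ x * (1 - p x)) x (perp ν) := by
    intro x; rw [ed]; ring
  have eq' : ∀ x, quad (v.grad x) (perp ν) * φ x = quad (v.grad x) (perp ν) * (φ x * p x) +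
      quad (v.grad x) (perp ν) * (φ x * (1 - p x)) := by intro x; ring
  simp only [ei, eq']
  rw [integral_add, integral_add, e1, e2]
  · ring
  · exact v.integrable_quad_mul _ h1
  · exact v.integrable_quad_mul _ h2
  · exact (v.memLp_inner _).integrable_mul ((h1.fderiv_apply _).memLp 2 _)
  · exact (v.memLp_inner _).integrable_mul ((h2.fderiv_apply _).memLp 2 _)

end HexRhombic

/-! ### Strips around a chord and the linear lower bound -/

namespace HexRhombic

/-- Convexity fixes the line itself: inside the chord it is in Ω, beyond the ends it misses the
closure. Compactness of the two exceptional sets, neither of which meets the line, transfers this to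
a thin strip. -/
theorem exists_strip {Ω : Set Plane} (hΩ : IsOpen Ω) (hc : Convex ℝ Ω)
    (hb : Bornology.IsBounded Ω) {x₀ ν : Plane} (hν : ‖ν‖ = 1) {ℓ : ℝ} (hℓ : 0 < ℓ)
    (hch : ∀ s : ℝ, x₀ + s • perp ν ∈ Ω ↔ |s| < ℓ) {δ : ℝ} (hδ : 0 < δ) :
    ∃ κ > 0, (∀ y, |tanC x₀ ν y| ≤ ℓ - δ → |norC x₀ ν y| < κ → y ∈ Ω) ∧
      ∀ y ∈ Ω, |norC x₀ ν y| < κ → |tanC x₀ ν y| < ℓ + δ := by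
  obtain ⟨C, hC⟩ := hb.exists_norm_le
  have hline : ∀ y : Plane, norC x₀ ν y = 0 → y = x₀ + tanC x₀ ν y • perp ν := by
    intro y hy
    have := framePt_tanC_norC (x₀ := x₀) hν y
    rw [framePt, hy, zero_smul, add_zero] at this
    exact this.symm
  have hfar : ∀ K : Set Plane, IsCompact K → (∀ y ∈ K, norC x₀ ν y ≠ 0) →
      ∃ κ > 0, ∀ y ∈ K, κ ≤ |norC x₀ ν y| := by
    intro K hK h0
    rcases K.eq_empty_or_nonempty with rfl | hne
    · exact ⟨1, one_pos, by simp⟩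
    · obtain ⟨z, hz, hmin⟩ := hK.exists_isMinOn hne
        (continuous_norC (x₀ := x₀) (ν := ν)).abs.continuousOn
      exact ⟨_, abs_pos.2 (h0 z hz), fun y hy => hmin hy⟩
  have hclb : IsCompact (closure Ω) := hb.isCompact_closure
  obtain ⟨κ₁, hκ₁, h1⟩ := hfar
    ({y | tanC x₀ ν y ∈ Icc (-(ℓ - δ)) (ℓ - δ) ∧ norC x₀ ν y ∈ Icc (-1) 1} ∩ Ωᶜ)
    ((isCompact_closedBox hν _ _ _ _).inter_right hΩ.isClosed_compl) (by
      intro y hy h0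
      apply hy.2
      rw [hline y h0, hch]
      have := abs_le.2 hy.1.1
      linarith)
  obtain ⟨κ₂, hκ₂, h2⟩ := hfar (closure Ω ∩ {y | ℓ + δ ≤ |tanC x₀ ν y|})
    (hclb.inter_right (isClosed_Ici.preimage continuous_tanC.abs)) (by
      rintro y ⟨hy, hyδ⟩ h0
      have hyδ : ℓ + δ ≤ |tanC x₀ ν y| := hyδ
      have hx₀ : x₀ ∈ Ω := by simpa using (hch 0).2 (by simpa using hℓ)
      set t := tanC x₀ ν y with ht
      have ht0 : 0 < |t| := by linarith
      set σ := t / |t| with hσ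
      have hσt : σ * |t| = t := by rw [hσ]; field_simp
      have hσ1 : |σ| = 1 := by rw [hσ, abs_div, abs_abs, div_self ht0.ne']
      have hout : x₀ + ℓ • (σ • perp ν) ∉ Ω := by
        rw [smul_smul, hch, abs_mul, hσ1, mul_one, abs_of_pos hℓ]; exact lt_irrefl _
      refine Convex.add_smul_notMem_closure hΩ hc hx₀ hℓ (r := |t| - ℓ) (by linarith) hout ?_
      have e : x₀ + ℓ • (σ • perp ν) + (|t| - ℓ) • (σ • perp ν) = x₀ + (σ * |t|) • perp ν := by
        module
      rw [e, hσt, ← hline y h0]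
      exact hy)
  refine ⟨min 1 (min κ₁ κ₂), by positivity, fun y hy hyκ => ?_, fun y hy hyκ => ?_⟩
  · by_contra hn
    have h := h1 y ⟨⟨abs_le.1 hy, abs_le.1 (hyκ.le.trans (min_le_left _ _))⟩, hn⟩
    have := (min_le_right (1 : ℝ) (min κ₁ κ₂)).trans (min_le_left _ _)
    linarith
  · by_contra! hn
    have h := h2 y ⟨subset_closure hy, hn⟩
    have := (min_le_right (1 : ℝ) (min κ₁ κ₂)).trans (min_le_right _ _)
    linarith

theorem lower_of_linear {Ω Γ : Set Plane} (hΩ : volume Ω ≠ ⊤) {c₁ C₁ : ℝ} (hc₁ : 0 < c₁)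
    (hC₁ : 1 ≤ C₁) (h : ∀ v : W12 Ω, v.VanishesOn Γ → v.hessianVariation ≠ ⊤ →
      c₁ ≤ C₁ * v.hessianVariation.toReal + C₁ * v.elastic) :
    ∃ c, 0 < c ∧ ∀ ε, 0 < ε → ENNReal.ofReal (c * min ε 1) ≤ minEnergy Ω Γ ε := by
  refine ⟨c₁ / C₁, by positivity, fun ε hε => le_iInf₂ fun v hv => ?_⟩
  have hE0 : 0 ≤ v.elastic := integral_nonneg fun x => sq_nonneg _
  rw [v.energy_eq hΩ]
  by_cases hfin : v.hessianVariation = ⊤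
  · rw [hfin, ENNReal.mul_top (by simpa using hε)]; simp
  set V := v.hessianVariation.toReal with hV
  have hV0 : 0 ≤ V := ENNReal.toReal_nonneg
  rw [← ENNReal.ofReal_toReal hfin, ← ENNReal.ofReal_mul hε.le, ← ENNReal.ofReal_add hE0 (by positivity)]
  refine ENNReal.ofReal_le_ofReal ?_
  have h2 := h v hv hfin
  rw [← hV, div_mul_eq_mul_div, div_le_iff₀ (by positivity)]
  have hm : 0 < min ε 1 := by positivity
  calc c₁ * min ε 1 ≤ (C₁ * V + C₁ * v.elastic) * min ε 1 := by gcongr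
    _ = C₁ * (min ε 1 * V + v.elastic * min ε 1) := by ring
    _ ≤ C₁ * (ε * V + v.elastic * 1) := by
        gcongr
        · exact min_le_left _ _
        · exact min_le_right _ _
    _ = _ := by ring

/-- If τ·(∇v)τ varied little along the chord direction, it would be close to its mean along each
chord, which is 0 since v vanishes at both ends; but its modulus is at least c₀ − misfit. The
argument runs on test functions: the weight H′ of the box estimate is compared with the constant
weight 1/c, for which the mean vanishes exactly. -/
theorem minEnergy_ge_linear {Ω : Set Plane} (hΩ : IsOpen Ω) (hc : Convex ℝ Ω)
    (hb : Bornology.IsBounded Ω) (hne : Ω.Nonempty) {ν : Plane} (hν : ‖ν‖ = 1) {c₀ : ℝ}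
    (hc₀ : 0 < c₀) (hc₀1 : c₀ ≤ 1) (hck : ∀ k ∈ wells, c₀ ≤ |quad k (perp ν)|) :
    ∃ c, 0 < c ∧ ∀ ε, 0 < ε → ENNReal.ofReal (c * min ε 1) ≤ minEnergy Ω (frontier Ω) ε := by
  have hvol := measure_ne_top_of_isBounded hb
  have hfinΩ : IsFiniteMeasure (volume.restrict Ω) := ⟨by simpa using hvol.lt_top⟩
  have hτ : ‖perp ν‖ = 1 := by rw [norm_perp, hν]
  obtain ⟨x₀, ℓ, hℓ, hch⟩ := exists_midpoint_chord hΩ hc hb hne hτ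
  -- So small that the uncontrolled zones at the two ends, of total area at most 20δκ, cost less
  -- than a third of c₀ℓκ.
  set δ := ℓ * c₀ / 1000 with hδ
  have hδ0 : 0 < δ := by positivity
  have hδℓ : 1000 * δ ≤ ℓ := by rw [hδ]; nlinarith
  obtain ⟨κ, hκ, hin, hout⟩ := exists_strip hΩ hc hb hν hℓ hch hδ0
  obtain ⟨H, c, M, hH, hcr, hH1, hH01, hHM⟩ := exists_plateau_step (r := ℓ - 3 * δ)
    (R := ℓ - 2 * δ) (by linarith) (by linarith)
  have hH := hH (ℓ - δ) (by linarith)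
  have hcℓ : ℓ ≤ c := by linarith
  have hc0 : 0 < c := by linarith
  set R := box x₀ ν (-(ℓ - δ)) (ℓ - δ) (-κ) κ with hR
  have hRΩ : R ⊆ Ω := fun y hy => hin y (abs_lt.2 hy.1).le (abs_lt.2 hy.2)
  -- The two end zones, each of size 5δ by 2κ, where H′ may differ from the plateau value 1/c.
  set D := (box x₀ ν (-(ℓ + δ)) (-(ℓ - 4 * δ)) (-κ) κ ∪
    box x₀ ν (ℓ - 4 * δ) (ℓ + δ) (-κ) κ) ∩ Ω with hD
  have hDm : MeasurableSet D :=
    ((isOpen_box _ _ _ _).measurableSet.union (isOpen_box _ _ _ _).measurableSet).inter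
      hΩ.measurableSet
  have hDΩ : D ⊆ Ω := inter_subset_right
  have hDvol : (volume D).toReal ≤ 20 * δ * κ := by
    have h1 : volume D ≤ ENNReal.ofReal (20 * δ * κ) := by
      refine (measure_mono inter_subset_left).trans ((measure_union_le _ _).trans (le_of_eq ?_))
      rw [volume_box hν, volume_box hν, ← ENNReal.ofReal_mul (by linarith),
        ← ENNReal.ofReal_mul (by linarith), ← ENNReal.ofReal_add (by nlinarith) (by nlinarith)]
      congr 1; ring
    exact ENNReal.toReal_le_of_le_ofReal (by positivity) h1
  have hRvol : (volume R).toReal = 4 * (ℓ - δ) * κ := by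
    rw [hR, volume_box hν, ENNReal.toReal_mul, ENNReal.toReal_ofReal (by linarith),
      ENNReal.toReal_ofReal (by linarith)]
    ring
  set m := (volume Ω).toReal with hm
  have hm0 : 0 ≤ m := ENNReal.toReal_nonneg
  -- The Young parameter: the misfit enters nine times, and 9 · `lam` · m is at most 9/20 of c₀ℓκ.
  set lam := c₀ * ℓ * κ / (20 * (m + 1)) with hlam
  have hlam0 : 0 < lam := by positivity
  refine lower_of_linear hvol (c₁ := c₀ * ℓ * κ) (C₁ := 1 + 2 * ℓ + 9 / (4 * lam)) (by positivity)
    (by linarith [show 0 < 9 / (4 * lam) by positivity]) fun v hv hfin => ?_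
  have hE0 : 0 ≤ v.elastic := integral_nonneg fun x => sq_nonneg _
  set V := v.hessianVariation.toReal with hV
  have hV0 : 0 ≤ V := ENNReal.toReal_nonneg
  have hmi : IntegrableOn v.misfit Ω := (v.memLp_misfit hvol).integrable one_le_two
  have hdv : v.dirVar (perp ν) R ≤ v.hessianVariation :=
    (v.dirVar_mono _ hRΩ).trans (v.dirVar_le_hessianVariation hτ)
  have hfinR := ne_top_of_le_ne_top hfin hdv
  have hdV : (v.dirVar (perp ν) R).toReal ≤ V := ENNReal.toReal_mono hfin hdv
  have hext : v.ExtendsByZero (box x₀ ν (-(6 * ℓ)) (6 * ℓ) (-κ) κ) (perp ν) :=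
    v.extendsByZero_of_convex hΩ hc hv hν (a := ℓ - δ) (by linarith) (by linarith) hin
  set I := ∫ x in Ω, v.misfit x with hI
  have key : ∀ θ : Plane → ℝ, IsTest R θ → (∀ x, |θ x| ≤ 1) →
      ∫ x in Ω, quad (v.grad x) (perp ν) * θ x ≤ 2 * ℓ * V + 8 * (I + 40 * δ * κ) := by
    intro θ hθ hθ1
    obtain ⟨hχ, -, hle⟩ := v.exists_box_estimate hν (by linarith) hH hHM hfinR hθ hθ1
    set L := ℓ - δ - -(ℓ - δ) with hL
    have hLe : L = 2 * (ℓ - δ) := by rw [hL]; ring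
    -- For every point of Ω in the strip the window of half-length 4ℓ covers the whole support of θ
    -- on its line, so Θ does not change along the line within Ω.
    set Θ := lineInt θ (perp ν) (-(4 * ℓ)) (4 * ℓ) with hΘ
    have htan : ∀ x r, tanC x₀ ν (x + r • perp ν) = tanC x₀ ν x + r := tanC_add_smul_perp hν
    have hnor : ∀ x r, norC x₀ ν (x + r • perp ν) = norC x₀ ν x := norC_add_smul_perp
    have hθ0 : ∀ x, ℓ - δ ≤ |tanC x₀ ν x| → θ x = 0 := fun x hx =>
      hθ.eq_zero fun h => absurd (abs_lt.2 h.1) (not_lt.2 hx)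
    have hθn : ∀ x, norC x₀ ν x ∉ Ioo (-κ) κ → θ x = 0 := fun x hx =>
      hθ.eq_zero fun h => hx h.2
    have hΘb : ∀ x, |Θ x| ≤ 8 * ℓ := fun x => by
      have := abs_lineInt_le hθ1 (perp ν) (a := -(4 * ℓ)) (b := 4 * ℓ) (by linarith) x
      linarith
    obtain ⟨γ, γ', hγ, hγ', hK⟩ := exists_Icc_of_compact_subset_Ioo
      (hθ.compact.image (continuous_norC (x₀ := x₀) (ν := ν))) (show -κ < κ by linarith) (by
        rintro _ ⟨x, hx, rfl⟩; exact (hθ.support hx).2)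
    have hΘt : IsTest (box x₀ ν (-(6 * ℓ)) (6 * ℓ) (-κ) κ) Θ := by
      refine isTest_of_eq_zero (contDiff_lineInt hθ.smooth hθ.compact _ (by linarith))
        (isCompact_closedBox (x₀ := x₀) hν (-(5 * ℓ)) (5 * ℓ) γ γ') (fun y hy => ⟨⟨?_, ?_⟩, ⟨?_, ?_⟩⟩)
        fun x hx => lineInt_eq_zero (by linarith) fun r hr => ?_
      · linarith [hy.1.1]
      · linarith [hy.1.2]
      · linarith [hy.2.1]
      · linarith [hy.2.2]
      · by_contra hne
        have hs : x + r • perp ν ∈ tsupport θ := subset_closure hne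
        have h1 := (hθ.support hs).1
        have h2 := hK ⟨_, hs, rfl⟩
        rw [hnor] at h2
        rw [htan] at h1
        exact hx ⟨⟨by linarith [h1.1, hr.2], by linarith [h1.2, hr.1]⟩, h2⟩
    -- Since ∂_τΘ = 0 on Ω, integration by parts with zero boundary values shows that the mean
    -- vanishes.
    have hΘ0 : ∫ x in Ω, quad (v.grad x) (perp ν) * Θ x = 0 := by
      have h1 := hext Θ hΘt
      rw [setIntegral_eq_zero_of_forall_eq_zero (f := fun x => inner ℝ (v.toFun x) (perp ν) * fderiv ℝ Θ x (perp ν))] at h1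
      · linarith
      · intro x hx
        rw [hΘ, fderiv_lineInt hθ.smooth hθ.compact _ (by linarith)]
        by_cases hxn : norC x₀ ν x ∈ Ioo (-κ) κ
        · have h2 := abs_lt.1 (hout x hx (abs_lt.2 hxn))
          rw [hθ0 _ (by rw [htan]; exact le_abs.2 (Or.inl (by linarith))),
            hθ0 _ (by rw [htan]; exact le_abs.2 (Or.inr (by linarith)))]
          ring
        · rw [hθn _ (by rwa [hnor]), hθn _ (by rwa [hnor])]; ring
    set χ : Plane → ℝ := fun x => deriv H (tanC x₀ ν x) * lineInt θ (perp ν) (-L) L x with hχdef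
    have hχe : ∀ x, χ x = deriv H (tanC x₀ ν x) * Θ x := by
      intro x
      by_cases hxR : x ∈ R
      · rw [hχdef, hΘ]
        simp only
        congr 1
        have hb := abs_lt.2 hxR.1
        have hb := abs_lt.1 hb
        rw [← lineInt_add hθ.smooth.continuous (perp ν) (-(4 * ℓ)) (-L) (4 * ℓ) x,
          ← lineInt_add hθ.smooth.continuous (perp ν) (-L) L (4 * ℓ) x,
          lineInt_eq_zero (a := -(4 * ℓ)) (by linarith), lineInt_eq_zero (a := L) (by linarith)]
        · ring
        · intro r hr
          exact hθ0 _ (by rw [htan]; exact le_abs.2 (Or.inl (by linarith [hr.1])))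
        · intro r hr
          exact hθ0 _ (by rw [htan]; exact le_abs.2 (Or.inr (by linarith [hr.2])))
      · rw [hχ.eq_zero hxR]
        by_cases hxn : norC x₀ ν x ∈ Ioo (-κ) κ
        · have hxt : ℓ - δ ≤ |tanC x₀ ν x| := by
            by_contra! h
            exact hxR ⟨abs_lt.1 h, hxn⟩
          have h0 : deriv H (tanC x₀ ν x) = 0 := by
            obtain ⟨a, b, ha, hab, hb, hHa, hHb⟩ := hH.ends
            rcases le_abs.1 hxt with h | h
            · have : H =ᶠ[𝓝 (tanC x₀ ν x)] fun _ => (1 : ℝ) := by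
                filter_upwards [Ioi_mem_nhds (show b < tanC x₀ ν x by linarith)] with t ht
                  using hHb t (le_of_lt ht)
              rw [this.deriv_eq]; simp
            · have : H =ᶠ[𝓝 (tanC x₀ ν x)] fun _ => (0 : ℝ) := by
                filter_upwards [Iio_mem_nhds (show tanC x₀ ν x < a by linarith)] with t ht
                  using hHa t (le_of_lt ht)
              rw [this.deriv_eq]; simp
          rw [h0, zero_mul]
        · rw [hΘ, lineInt_eq_zero (by linarith), mul_zero]
          exact fun r _ => hθn _ (by rwa [hnor])
    have hΘi : Integrable (fun x => quad (v.grad x) (perp ν) * Θ x) (volume.restrict Ω) :=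
      v.integrable_quad_mul _ hΘt
    have hχi : Integrable (fun x => quad (v.grad x) (perp ν) * χ x) (volume.restrict Ω) :=
      v.integrable_quad_mul _ hχ
    -- Off D the weights agree or Θ vanishes; on D the factor is at most (1/c) · 8ℓ ≤ 8.
    have hpt : ∀ x ∈ Ω, quad (v.grad x) (perp ν) * χ x - 1 / c * (quad (v.grad x) (perp ν) * Θ x) ≤
        D.indicator (fun x => 8 * (v.misfit x + 2)) x := by
      intro x hx
      have e : quad (v.grad x) (perp ν) * χ x - 1 / c * (quad (v.grad x) (perp ν) * Θ x) =
          quad (v.grad x) (perp ν) * ((deriv H (tanC x₀ ν x) - 1 / c) * Θ x) := by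
        rw [hχe]; ring
      rw [e]
      by_cases hxD : x ∈ D
      · rw [indicator_of_mem hxD]
        have h1 := v.abs_quad_grad_le x (perp ν)
        rw [hτ, one_pow, mul_one] at h1
        have h2 : |(deriv H (tanC x₀ ν x) - 1 / c) * Θ x| ≤ 8 := by
          rw [abs_mul]
          have h3 : |deriv H (tanC x₀ ν x) - 1 / c| ≤ 1 / c := by
            obtain ⟨h4, h5⟩ := hH01 (tanC x₀ ν x)
            rw [abs_le]; constructor <;> linarith
          calc _ ≤ 1 / c * (8 * ℓ) := mul_le_mul h3 (hΘb x) (abs_nonneg _) (by positivity)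
            _ ≤ 8 := by rw [div_mul_eq_mul_div, div_le_iff₀ hc0]; linarith
        calc _ ≤ |quad (v.grad x) (perp ν) * ((deriv H (tanC x₀ ν x) - 1 / c) * Θ x)| :=
              le_abs_self _
          _ ≤ (v.misfit x + 2) * 8 := by
              rw [abs_mul]
              exact mul_le_mul h1 h2 (abs_nonneg _) ((abs_nonneg _).trans h1)
          _ = _ := by ring
      · rw [indicator_of_notMem hxD]
        refine le_of_eq ?_
        by_cases hxn : norC x₀ ν x ∈ Ioo (-κ) κ
        · rw [hH1, sub_self, zero_mul, mul_zero]
          by_contra! hgt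
          have h2 := abs_lt.1 (hout x hx (abs_lt.2 hxn))
          apply hxD
          refine ⟨?_, hx⟩
          rcases lt_abs.1 hgt with h | h
          · exact Or.inr ⟨⟨by linarith, by linarith⟩, hxn⟩
          · exact Or.inl ⟨⟨by linarith, by linarith⟩, hxn⟩
        · rw [hΘ, lineInt_eq_zero (by linarith), mul_zero, mul_zero]
          exact fun r _ => hθn _ (by rwa [hnor])
    have hfD : IsFiniteMeasure (volume.restrict D) :=
      ⟨by simpa using (measure_ne_top_of_subset hDΩ hvol).lt_top⟩
    have hgi : IntegrableOn (fun x => 8 * (v.misfit x + 2)) D :=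
      ((hmi.mono_set hDΩ).add (integrable_const _)).const_mul 8
    have h6 : ∫ x in Ω, (quad (v.grad x) (perp ν) * χ x -
        1 / c * (quad (v.grad x) (perp ν) * Θ x)) ≤
        ∫ x in Ω, D.indicator (fun x => 8 * (v.misfit x + 2)) x :=
      setIntegral_mono_on (hχi.sub (hΘi.const_mul _))
        ((integrable_indicator_iff hDm).2 hgi).integrableOn hΩ.measurableSet hpt
    rw [integral_sub hχi (hΘi.const_mul _), integral_const_mul, hΘ0, mul_zero, sub_zero,
      setIntegral_indicator hDm, inter_eq_self_of_subset_right hDΩ, integral_const_mul,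
      integral_add (hmi.mono_set hDΩ) (integrable_const _), setIntegral_const, smul_eq_mul] at h6
    simp only [Measure.real] at h6
    have h7 : ∫ x in D, v.misfit x ≤ I :=
      setIntegral_mono_set hmi (Eventually.of_forall v.misfit_nonneg) (LE.le.eventuallyLE hDΩ)
    have h8 : L * (v.dirVar (perp ν) R).toReal ≤ 2 * ℓ * V := by
      rw [hLe]; exact mul_le_mul (by linarith) hdV ENNReal.toReal_nonneg (by linarith)
    linarith
  have harea := v.area_le hvol (isOpen_box _ _ _ _) hRΩ hτ hc₀ hck key
  have h1 : ∫ x in R, v.misfit x ≤ I :=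
    setIntegral_mono_set hmi (Eventually.of_forall v.misfit_nonneg) (LE.le.eventuallyLE hRΩ)
  have h2 := v.setIntegral_misfit_le hvol (subset_refl Ω) hlam0 (le_refl (volume Ω).toReal)
  change I ≤ lam * m + 1 / (4 * lam) * v.elastic at h2
  have h3 : 9 * (lam * m) ≤ c₀ * ℓ * κ * (9 / 20) := by
    have : lam * (m + 1) = c₀ * ℓ * κ / 20 := by rw [hlam]; field_simp
    nlinarith
  rw [← hR, hRvol] at harea
  have h4 : 320 * δ * κ = c₀ * ℓ * κ * (320 / 1000) := by rw [hδ]; ring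
  have h5 : c₀ * (4 * (ℓ - δ) * κ) = 4 * (c₀ * ℓ * κ) - 4 * c₀ * δ * κ := by ring
  have h6 : 4 * c₀ * δ * κ ≤ c₀ * ℓ * κ := by
    have : 4 * δ ≤ ℓ := by linarith
    have h7 : 0 < c₀ * κ := by positivity
    nlinarith
  have h7 : 9 * (1 / (4 * lam) * v.elastic) = 9 / (4 * lam) * v.elastic := by ring
  have h8 : 0 < c₀ * ℓ * κ := by positivity
  have h9 : 0 ≤ 9 / (4 * lam) * V := by positivity
  have h10 : 0 ≤ 2 * ℓ * v.elastic := by positivity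
  nlinarith

end HexRhombic

namespace HexRhombic

/-! ### Competitors on the whole plane -/

/-- A continuous field on the plane with a bounded weak gradient whose derivative has total
variation at most `V`. -/
structure IsPatch (u : Plane → Plane) (G : Plane → Mat) (V : ℝ) : Prop where
  continuous : Continuous u
  measurable : ∀ i j, Measurable fun x => G x i j
  bounded : ∃ C, ∀ x i j, |G x i j| ≤ C
  weak : ∀ φ : Plane → ℝ, IsTest univ φ → ∀ i j : Fin 2,
    ∫ x, u x i * fderiv ℝ φ x (unitVec j) = -∫ x, G x i j * φ x
  var : ∀ Φ : Plane → Fin 2 → Fin 2 → Fin 2 → ℝ, IsTestField univ Φ →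
    ∫ x, ∑ i, ∑ j, ∑ k, G x i j * fderiv ℝ (fun y => Φ y i j k) x (unitVec k) ≤ V

namespace IsPatch

variable {u u' : Plane → Plane} {G G' : Plane → Mat} {V V' : ℝ}

theorem integrable_mul (h : IsPatch u G V) {ψ : Plane → ℝ} (hψ : IsTest univ ψ) (i j : Fin 2) :
    Integrable (fun x => G x i j * ψ x) := by
  obtain ⟨C, hC⟩ := h.bounded
  exact (hψ.integrable volume).bdd_mul (h.measurable i j).aestronglyMeasurable
    (Eventually.of_forall fun x => hC x i j)

theorem continuous_apply (h : IsPatch u G V) (i : Fin 2) : Continuous fun x => u x i := by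
  have := h.continuous
  fun_prop

theorem integrable_apply_mul (h : IsPatch u G V) {ψ : Plane → ℝ} (hψ : IsTest univ ψ)
    (i : Fin 2) : Integrable (fun x => u x i * ψ x) :=
  ((h.continuous_apply i).mul hψ.smooth.continuous).integrable_of_hasCompactSupport
    (hψ.compact.mul_left)

theorem integrable_var (h : IsPatch u G V) {Φ : Plane → Fin 2 → Fin 2 → Fin 2 → ℝ}
    (hΦ : IsTestField univ Φ) : Integrable fun x =>
      ∑ i, ∑ j, ∑ k, G x i j * fderiv ℝ (fun y => Φ y i j k) x (unitVec k) :=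
  integrable_finsetSum _ fun i _ => integrable_finsetSum _ fun j _ => integrable_finsetSum _
    fun k _ => h.integrable_mul ((hΦ.isTest i j k).fderiv_apply _) i j

theorem zero : IsPatch (fun _ => 0) (fun _ => 0) 0 where
  continuous := continuous_const
  measurable _ _ := measurable_const
  bounded := ⟨0, by simp⟩
  weak := by simp
  var := by simp

theorem mono (h : IsPatch u G V) (hV : V ≤ V') : IsPatch u G V' :=
  ⟨h.continuous, h.measurable, h.bounded, h.weak, fun Φ hΦ => (h.var Φ hΦ).trans hV⟩

theorem add (h : IsPatch u G V) (h' : IsPatch u' G' V') :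
    IsPatch (fun x => u x + u' x) (fun x => G x + G' x) (V + V') where
  continuous := h.continuous.add h'.continuous
  measurable i j := (h.measurable i j).add (h'.measurable i j)
  bounded := by
    obtain ⟨C, hC⟩ := h.bounded
    obtain ⟨C', hC'⟩ := h'.bounded
    exact ⟨C + C', fun x i j => (abs_add_le _ _).trans (add_le_add (hC x i j) (hC' x i j))⟩
  weak φ hφ i j := by
    simp only [PiLp.add_apply, Matrix.add_apply, add_mul]
    rw [integral_add (h.integrable_apply_mul (hφ.fderiv_apply _) i)
      (h'.integrable_apply_mul (hφ.fderiv_apply _) i),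
      integral_add (h.integrable_mul hφ i j) (h'.integrable_mul hφ i j), h.weak φ hφ,
      h'.weak φ hφ, neg_add]
  var Φ hΦ := by
    simp only [Matrix.add_apply, add_mul, Finset.sum_add_distrib]
    rw [integral_add (h.integrable_var hΦ) (h'.integrable_var hΦ)]
    exact add_le_add (h.var Φ hΦ) (h'.var Φ hΦ)

theorem sum {ι : Type*} (s : Finset ι) {u : ι → Plane → Plane} {G : ι → Plane → Mat} {V : ι → ℝ}
    (h : ∀ a ∈ s, IsPatch (u a) (G a) (V a)) :
    IsPatch (fun x => ∑ a ∈ s, u a x) (fun x => ∑ a ∈ s, G a x) (∑ a ∈ s, V a) := by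
  classical
  induction s using Finset.induction_on with
  | empty => simpa using IsPatch.zero
  | insert a s ha ih =>
    simp only [Finset.sum_insert ha]
    exact (h a (Finset.mem_insert_self _ _)).add (ih fun b hb => h b (Finset.mem_insert_of_mem hb))

theorem _root_.HexRhombic.IsTest.comp_affine {φ : Plane → ℝ} (hφ : IsTest univ φ) (a : Plane) {r : ℝ} (hr : r ≠ 0) :
    IsTest univ fun y => φ (a + r • y) :=
  ⟨hφ.smooth.comp (by fun_prop), hφ.compact.comp_homeomorph
    ((Homeomorph.smulOfNeZero r hr).trans (Homeomorph.addLeft a)), subset_univ _⟩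

theorem _root_.HexRhombic.fderiv_comp_affine {φ : Plane → ℝ} (hφ : IsTest univ φ) (a : Plane) (r : ℝ) (y ξ : Plane) :
    fderiv ℝ (fun y => φ (a + r • y)) y ξ = r * fderiv ℝ φ (a + r • y) ξ := by
  have h1 : HasFDerivAt (fun y : Plane => a + r • y) (r • ContinuousLinearMap.id ℝ Plane) y :=
    ((hasFDerivAt_id y).const_smul r).const_add a
  have h2 := (hφ.smooth.differentiable (by simp) (a + r • y)).hasFDerivAt.comp y h1
  rw [show (fun y => φ (a + r • y)) = φ ∘ fun y => a + r • y from rfl, h2.fderiv]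
  simp

theorem _root_.HexRhombic.integral_comp_affine (f : Plane → ℝ) (a : Plane) {r : ℝ} (hr : r ≠ 0) :
    ∫ x, f x = r ^ 2 * ∫ y, f (a + r • y) := by
  have h1 := Measure.integral_comp_smul volume (fun y => f (a + y)) r
  rw [h1, integral_add_left_eq_self f a, finrank_euclideanSpace, Fintype.card_fin, smul_eq_mul,
    abs_of_nonneg (by positivity)]
  field_simp

/-- Rescaling a patch. -/
theorem rescale (h : IsPatch u G V) (a : Plane) {r : ℝ} (hr : r ≠ 0) :
    IsPatch (fun x => r • u (r⁻¹ • (x - a))) (fun x => G (r⁻¹ • (x - a))) (|r| * V) := by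
  have hinv : ∀ y : Plane, r⁻¹ • (a + r • y - a) = y := fun y => by
    rw [add_sub_cancel_left, smul_smul, inv_mul_cancel₀ hr, one_smul]
  have hc : Continuous fun x : Plane => r⁻¹ • (x - a) := by fun_prop
  refine ⟨(h.continuous.comp hc).const_smul r, fun i j => (h.measurable i j).comp hc.measurable,
    ?_, fun φ hφ i j => ?_, fun Φ hΦ => ?_⟩
  · obtain ⟨C, hC⟩ := h.bounded
    exact ⟨C, fun x i j => hC _ i j⟩
  · rw [integral_comp_affine _ a hr, integral_comp_affine (fun x => _ * φ x) a hr]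
    have h1 := h.weak _ (hφ.comp_affine a hr) i j
    simp only [fderiv_comp_affine hφ] at h1
    simp only [hinv, PiLp.smul_apply, smul_eq_mul]
    rw [← mul_neg, ← h1]
    congr 1
    refine integral_congr_ae (Eventually.of_forall fun y => ?_)
    change r * u y i * _ = u y i * (r * _)
    ring
  · rw [integral_comp_affine _ a hr]
    simp only [hinv]
    -- The scaling factor r may be negative; a sign s with s r = |r| is absorbed into the test
    -- field.
    have hf : ∀ s : ℝ, s ^ 2 = 1 → IsTestField univ fun y i j k => s * Φ (a + r • y) i j k := by
      intro s hs
      refine ⟨fun i j k => ((hΦ.isTest i j k).comp_affine a hr).const_mul s, fun x => ?_⟩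
      simp only [mul_pow, hs, one_mul]
      exact hΦ.le_one _
    have key : ∀ s : ℝ, s ^ 2 = 1 → s * r * ∫ y, ∑ i, ∑ j, ∑ k, G y i j *
        fderiv ℝ (fun y => Φ y i j k) (a + r • y) (unitVec k) ≤ V := by
      intro s hs
      refine le_trans (le_of_eq ?_) (h.var _ (hf s hs))
      rw [← integral_const_mul]
      refine integral_congr_ae (Eventually.of_forall fun y => ?_)
      simp only [Finset.mul_sum]
      refine Finset.sum_congr rfl fun i _ => Finset.sum_congr rfl fun j _ =>
        Finset.sum_congr rfl fun k _ => ?_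
      have e : fderiv ℝ (fun y => s * Φ (a + r • y) i j k) y (unitVec k) =
          s * (r * fderiv ℝ (fun y => Φ y i j k) (a + r • y) (unitVec k)) := by
        rw [← fderiv_comp_affine (hΦ.isTest i j k)]
        have hd := ((hΦ.isTest i j k).comp_affine a hr).smooth.differentiable (by simp) y
        rw [fderiv_const_mul hd]
        rfl
      rw [e]; ring
    have hs : ∃ s : ℝ, s ^ 2 = 1 ∧ s * r = |r| := by
      rcases le_total 0 r with h0 | h0
      · exact ⟨1, by norm_num, by rw [one_mul, abs_of_nonneg h0]⟩
      · exact ⟨-1, by norm_num, by rw [abs_of_nonpos h0]; ring⟩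
    obtain ⟨s, hs, hsr⟩ := hs
    have := key s hs
    rw [hsr] at this
    rw [← sq_abs, sq, mul_assoc]
    exact mul_le_mul_of_nonneg_left this (abs_nonneg r)

end IsPatch

theorem tendsto_eLpNorm_two_of_bounded {α : Type*} {m : MeasurableSpace α} {μ : Measure α}
    [IsFiniteMeasure μ] {E : Type*} [NormedAddCommGroup E] {f : ℕ → α → E} {C : ℝ}
    (hm : ∀ n, AEStronglyMeasurable (f n) μ) (hC : ∀ n, ∀ᵐ x ∂μ, ‖f n x‖ ≤ C)
    (hf : ∀ᵐ x ∂μ, Tendsto (fun n => f n x) atTop (𝓝 0)) :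
    Tendsto (fun n => eLpNorm (f n) 2 μ) atTop (𝓝 0) := by
  have h1 : Tendsto (fun n => ∫⁻ x, ‖f n x‖ₑ ^ (2 : ℝ) ∂μ) atTop (𝓝 (∫⁻ _, 0 ∂μ)) := by
    refine tendsto_lintegral_of_dominated_convergence' (fun _ => ENNReal.ofReal C ^ (2 : ℝ))
      (fun n => (hm n).enorm.pow_const _) (fun n => ?_) ?_ ?_
    · filter_upwards [hC n] with x hx
      gcongr
      rw [← ofReal_norm]
      exact ENNReal.ofReal_le_ofReal hx
    · rw [lintegral_const]
      exact ENNReal.mul_ne_top (by simp) (measure_ne_top _ _)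
    · filter_upwards [hf] with x hx
      have h2 : Tendsto (fun n => ‖f n x‖ₑ) atTop (𝓝 0) := by
        have := hx.enorm
        rwa [enorm_zero] at this
      have h3 := (ENNReal.continuous_rpow_const (y := 2)).tendsto 0 |>.comp h2
      simpa [Function.comp_def] using h3
  rw [lintegral_zero] at h1
  have h4 := (ENNReal.continuous_rpow_const (y := 1 / 2)).tendsto 0 |>.comp h1
  simp only [eLpNorm_eq_lintegral_rpow_enorm_toReal two_ne_zero ENNReal.ofNat_ne_top]
  simpa [Function.comp_def] using h4

/-- The derivative is put on the mollifier, whose reflected translate is a test function for the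
weak gradient. Mollification therefore inherits the bound of G and converges almost everywhere with
its gradient. -/
theorem IsPatch.fderiv_moll {u : Plane → Plane} {G : Plane → Mat} {V : ℝ} (h : IsPatch u G V)
    (n : ℕ) (i j : Fin 2) (x : Plane) :
    fderiv ℝ (moll n fun y => u y i) x (unitVec j) = moll n (fun y => G y i j) x := by
  have hb1 : ContDiff ℝ 1 ((bump n).normed (volume : Measure Plane)) := (bump n).contDiff_normed
  have hg := (h.continuous_apply i).locallyIntegrable (μ := (volume : Measure Plane))
  have hd := HasCompactSupport.hasFDerivAt_convolution_left (ContinuousLinearMap.lsmul ℝ ℝ)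
    (bump n).hasCompactSupport_normed hb1 hg x
  have hint := ((bump n).hasCompactSupport_normed (μ := (volume : Measure Plane))).fderiv
    (𝕜 := ℝ) |>.convolutionExists_left
    ((ContinuousLinearMap.lsmul ℝ ℝ : ℝ →L[ℝ] ℝ →L[ℝ] ℝ).precompL Plane)
    (hb1.continuous_fderiv one_ne_zero) hg x
  have hφ : IsTest univ fun y => (bump n).normed (volume : Measure Plane) (x - y) :=
    ⟨(bump n).contDiff_normed.comp (by fun_prop), (bump n).hasCompactSupport_normed.comp_homeomorph
      (Homeomorph.subLeft x), subset_univ _⟩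
  have hw := h.weak _ hφ i j
  have hfd : ∀ y, fderiv ℝ (fun y => (bump n).normed (volume : Measure Plane) (x - y)) y
      (unitVec j) = -fderiv ℝ ((bump n).normed volume) (x - y) (unitVec j) := by
    intro y
    have h1 : HasFDerivAt (fun y : Plane => x - y) (-ContinuousLinearMap.id ℝ Plane) y :=
      (hasFDerivAt_id y).const_sub x
    have h2 := (hb1.differentiable one_ne_zero (x - y)).hasFDerivAt.comp y h1
    rw [show (fun y => (bump n).normed volume (x - y)) = (bump n).normed volume ∘ fun y => x - y
      from rfl, h2.fderiv]
    simp
  rw [moll_apply', ← neg_eq_iff_eq_neg.2 hw, moll, hd.fderiv, convolution,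
    ContinuousLinearMap.integral_apply hint]
  simp only [hfd, mul_neg, integral_neg, neg_neg]
  rw [← integral_sub_left_eq_self _ volume x]
  refine integral_congr_ae (Eventually.of_forall fun y => ?_)
  simp [ContinuousLinearMap.precompL, mul_comm]

/-- Two scalar functions as a vector field. -/
def vec (f : Fin 2 → Plane → ℝ) (x : Plane) : Plane := WithLp.toLp 2 fun i => f i x

theorem contDiff_vec {f : Fin 2 → Plane → ℝ} (hf : ∀ i, ContDiff ℝ ∞ (f i)) :
    ContDiff ℝ ∞ (vec f) := by
  rw [contDiff_euclidean]; exact hf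

theorem fderiv_vec {f : Fin 2 → Plane → ℝ} (hf : ∀ i, ContDiff ℝ ∞ (f i)) (x ξ : Plane)
    (i : Fin 2) : fderiv ℝ (vec f) x ξ i = fderiv ℝ (f i) x ξ := by
  have h1 := (((contDiff_vec hf).differentiable (by simp)) x).hasFDerivAt
  have h2 := (PiLp.hasFDerivAt_apply (𝕜 := ℝ) 2 (vec f x) i).comp x h1
  have h3 : ((fun p : Plane => p i) ∘ vec f) = f i := rfl
  rw [h3] at h2
  rw [h2.fderiv]; rfl

section Competitor

variable {Ω : Set Plane} {u : Plane → Plane} {G : Plane → Mat} {V : ℝ}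

/-- The restriction of a patch to a bounded open set. -/
noncomputable def IsPatch.toW12 (h : IsPatch u G V) (hu : HasCompactSupport u)
    (hΩ : volume Ω ≠ ⊤) : W12 Ω where
  toFun := u
  grad := G
  memLp := h.continuous.memLp_of_hasCompactSupport hu
  grad_memLp i j := by
    have hfin : IsFiniteMeasure (volume.restrict Ω) := ⟨by simpa using hΩ.lt_top⟩
    obtain ⟨C, hC⟩ := h.bounded
    exact MemLp.of_bound (h.measurable i j).aestronglyMeasurable C
      (Eventually.of_forall fun x => hC x i j)
  weak_grad φ hφ i j := by
    rw [setIntegral_eq_integral_of_forall_compl_eq_zero,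
      setIntegral_eq_integral_of_forall_compl_eq_zero]
    · exact h.weak φ (hφ.mono (subset_univ _)) i j
    · intro x hx; rw [hφ.eq_zero hx, mul_zero]
    · intro x hx; rw [hφ.fderiv_eq_zero hx]; simp

theorem IsPatch.hessianVariation_le (h : IsPatch u G V) (hu : HasCompactSupport u)
    (hΩ : volume Ω ≠ ⊤) : (h.toW12 hu hΩ).hessianVariation ≤ ENNReal.ofReal V := by
  refine iSup₂_le fun Φ hΦ => ENNReal.ofReal_le_ofReal ?_
  rw [setIntegral_eq_integral_of_forall_compl_eq_zero]
  · exact h.var Φ ⟨fun i j k => (hΦ.isTest i j k).mono (subset_univ _), hΦ.le_one⟩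
  · intro x hx
    refine Finset.sum_eq_zero fun i _ => Finset.sum_eq_zero fun j _ => Finset.sum_eq_zero
      fun k _ => ?_
    rw [(hΦ.isTest i j k).fderiv_eq_zero hx]; simp

/-- The mollifications of a field supported in a compact part of Ω eventually have support in Ω.
They converge boundedly and almost everywhere, hence in L² on the bounded measure space, and are
identically 0 on the frontier. -/
theorem IsPatch.vanishesOn (h : IsPatch u G V) {K Γ : Set Plane} (hK : IsCompact K) (hΩo : IsOpen Ω)
    (hKΩ : K ⊆ Ω) (h0 : ∀ x ∉ K, u x = 0) (hu : HasCompactSupport u) (hΩ : volume Ω ≠ ⊤) :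
    (h.toW12 hu hΩ).VanishesOn Γ := by
  have hfin : IsFiniteMeasure (volume.restrict Ω) := ⟨by simpa using hΩ.lt_top⟩
  have hloc : ∀ i, LocallyIntegrable (fun y => u y i) volume := fun i =>
    (h.continuous_apply i).locallyIntegrable
  obtain ⟨C, hC⟩ := h.bounded
  have hlocG : ∀ i j, LocallyIntegrable (fun y => G y i j) volume := fun i j =>
    (memLp_top_of_bound (h.measurable i j).aestronglyMeasurable C
      (Eventually.of_forall fun x => hC x i j)).locallyIntegrable le_top
  obtain ⟨B, hB⟩ := hu.exists_bound_of_continuous h.continuous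
  have hBi : ∀ i y, |u y i| ≤ B := fun i y => by
    rw [← Real.norm_eq_abs]; exact (PiLp.norm_apply_le (u y) i).trans (hB y)
  have htest : ∀ᶠ n in atTop, ∀ i, IsTest Ω (moll n fun y => u y i) :=
    eventually_all.2 fun i => isTest_moll hK hΩo hKΩ (hloc i) fun x hx => by rw [h0 x hx]; rfl
  obtain ⟨n₀, hn₀⟩ := eventually_atTop.1 htest
  -- The trace requires every member of the sequence to be admissible, so the first n₀
  -- mollifications are dropped.
  have hn : ∀ n i, IsTest Ω (moll (n + n₀) fun y => u y i) := fun n i => hn₀ _ (by lia) i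
  have hcd : ∀ n i, ContDiff ℝ ∞ (moll (n + n₀) fun y => u y i) := fun n i => (hn n i).smooth
  set w : ℕ → Plane → Plane := fun n => vec fun i => moll (n + n₀) fun y => u y i with hw
  have hw0 : ∀ n, ∀ x ∉ Ω, w n x = 0 := by
    intro n x hx
    apply PiLp.ext
    intro i
    exact (hn n i).eq_zero hx
  have hshift : ∀ {f : ℕ → ℝ} {a : ℝ}, Tendsto f atTop (𝓝 a) →
      Tendsto (fun n => f (n + n₀)) atTop (𝓝 a) := fun hf => (tendsto_add_atTop_iff_nat n₀).2 hf
  refine ⟨fun _ => 0, ⟨MemLp.zero, w, fun n => ⟨contDiff_vec (hcd n), ?_⟩, ?_, ?_, ?_⟩,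
    Eventually.of_forall fun _ => rfl⟩
  · refine HasCompactSupport.intro ((hn n 0).compact.union (hn n 1).compact) fun x hx => ?_
    rw [mem_union, not_or] at hx
    apply PiLp.ext
    intro i
    fin_cases i
    · exact image_eq_zero_of_notMem_tsupport (f := moll (n + n₀) fun y => u y 0) hx.1
    · exact image_eq_zero_of_notMem_tsupport (f := moll (n + n₀) fun y => u y 1) hx.2
  · refine tendsto_eLpNorm_two_of_bounded (C := 4 * B) (fun n => ?_) (fun n => ?_) ?_
    · exact ((contDiff_vec (hcd n)).continuous.sub h.continuous).aestronglyMeasurable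
    · refine Eventually.of_forall fun x => ?_
      have h1 : ‖w n x‖ ≤ 2 * B := by
        refine abs_le_of_sq_le_sq' ?_ (by linarith [(norm_nonneg _).trans (hB x)]) |>.2
        rw [norm_sq_plane]
        have h2 : ∀ i, |w n x i| ≤ B := fun i => abs_moll_le (hBi i) _ x
        have h3 := sq_le_sq' (abs_le.1 (h2 0)).1 (abs_le.1 (h2 0)).2
        have h4 := sq_le_sq' (abs_le.1 (h2 1)).1 (abs_le.1 (h2 1)).2
        nlinarith [sq_nonneg B]
      change ‖w n x - u x‖ ≤ _
      linarith [norm_sub_le (w n x) (u x), hB x, (norm_nonneg _).trans (hB x)]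
    · refine ae_restrict_of_ae ?_
      filter_upwards [eventually_all.2 fun i => ae_tendsto_moll (hloc i)] with x hx
      have h1 : Tendsto (fun n => w n x) atTop (𝓝 (WithLp.toLp 2 fun i => u x i)) :=
        (PiLp.continuous_toLp 2 _).tendsto _ |>.comp (tendsto_pi_nhds.2 fun i => hshift (hx i))
      have h2 := h1.sub_const (u x)
      rwa [show (WithLp.toLp 2 fun i => u x i) = u x from rfl, sub_self] at h2
  · intro i j
    refine tendsto_eLpNorm_two_of_bounded (C := 2 * C) (fun n => ?_) (fun n => ?_) ?_
    · have : Continuous fun x => fderiv ℝ (w n) x (unitVec j) i := by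
        have := (contDiff_vec (hcd n)).continuous_fderiv (by simp)
        fun_prop
      exact (this.measurable.sub (h.measurable i j)).aestronglyMeasurable
    · refine Eventually.of_forall fun x => ?_
      change ‖fderiv ℝ (w n) x (unitVec j) i - G x i j‖ ≤ _
      rw [fderiv_vec (hcd n), h.fderiv_moll]
      refine (norm_sub_le _ _).trans ?_
      have h1 : |moll (n + n₀) (fun y => G y i j) x| ≤ C := abs_moll_le (fun y => hC y i j) _ x
      have h2 := hC x i j
      rw [Real.norm_eq_abs, Real.norm_eq_abs]
      linarith
    · refine ae_restrict_of_ae ?_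
      filter_upwards [ae_tendsto_moll (hlocG i j)] with x hx
      have h1 := (hshift hx).sub_const (G x i j)
      rw [sub_self] at h1
      refine h1.congr fun n => ?_
      change _ = fderiv ℝ (w n) x (unitVec j) i - G x i j
      rw [fderiv_vec (hcd n), h.fderiv_moll]
  · have h1 : ∀ n, eLpNorm (fun x => w n x - 0) 2
        ((μH[1] : Measure Plane).restrict (frontier Ω)) = 0 := by
      intro n
      rw [eLpNorm_congr_ae (g := fun _ => (0 : Plane)), eLpNorm_zero']
      refine ae_restrict_of_forall_mem isClosed_frontier.measurableSet fun x hx => ?_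
      change w n x - 0 = 0
      rw [hw0 n x, sub_zero]
      rw [hΩo.frontier_eq] at hx
      exact hx.2
    simp only [h1]
    exact tendsto_const_nhds

/-- The energy of a compactly supported patch which is exact off `A`. -/
theorem IsPatch.minEnergy_le (h : IsPatch u G V) {K Γ A : Set Plane} (hK : IsCompact K)
    (hΩo : IsOpen Ω) (hΩ : volume Ω ≠ ⊤) (hKΩ : K ⊆ Ω) (h0 : ∀ x ∉ K, u x = 0)
    (hA : ∀ᵐ x, x ∈ Ω → symPart (G x) ∈ wells ∨ (x ∈ A ∧ symPart (G x) = 0)) {ε : ℝ} (hε : 0 < ε) :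
    minEnergy Ω Γ ε ≤ 4 * volume (A ∩ Ω) + ENNReal.ofReal (ε * V) := by
  have hu : HasCompactSupport u := HasCompactSupport.intro hK h0
  refine (iInf₂_le (h.toW12 hu hΩ) (h.vanishesOn hK hΩo hKΩ h0 hu hΩ)).trans ?_
  rw [W12.energy, ENNReal.ofReal_mul hε.le]
  refine add_le_add ?_ (by gcongr; exact h.hessianVariation_le hu hΩ)
  have h1 : ∫⁻ x in Ω, ENNReal.ofReal (Metric.infDist (symPart (G x)) wells ^ 2) ≤
      ∫⁻ x in Ω, A.indicator (fun _ => 4) x := by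
    refine lintegral_mono_ae ?_
    rw [ae_restrict_iff' hΩo.measurableSet]
    filter_upwards [hA] with x hx hxΩ
    rcases hx hxΩ with h2 | ⟨h2, h3⟩
    · rw [Metric.infDist_zero_of_mem h2]; simp
    · rw [indicator_of_mem h2, h3]
      obtain ⟨k, hk⟩ := wells_nonempty
      -- Zero strain is at distance at most 2 from the wells, which is the origin of the factor 4
      -- before the bad area.
      have h4 : Metric.infDist (0 : Mat) wells ≤ 2 := by
        refine (Metric.infDist_le_dist_of_mem hk).trans ?_
        rw [dist_zero_left]
        exact norm_le_of_mem_wells hk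
      have h5 : Metric.infDist (0 : Mat) wells ^ 2 ≤ 4 := by
        have := Metric.infDist_nonneg (x := (0 : Mat)) (s := wells)
        nlinarith
      exact (ENNReal.ofReal_le_ofReal h5).trans (by simp)
  refine h1.trans ((lintegral_indicator_const_le _ _).trans ?_)
  rw [Measure.restrict_apply' hΩo.measurableSet]

theorem minEnergy_le_volume (hΩo : IsOpen Ω) (hΩ : volume Ω ≠ ⊤) (Γ : Set Plane) {ε : ℝ}
    (hε : 0 < ε) : minEnergy Ω Γ ε ≤ 4 * volume Ω := by
  have := IsPatch.zero.minEnergy_le (Γ := Γ) (A := univ) isCompact_empty hΩo hΩ (empty_subset _)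
    (fun _ _ => rfl) (Eventually.of_forall fun x _ => Or.inr ⟨mem_univ _, by simp [symPart]⟩) hε
  simpa using this

end Competitor

end HexRhombic

namespace HexRhombic

/-! ### Piecewise constant gradients -/

theorem abs_setIntegral_deriv_le {I : Set ℝ} (hI : Convex ℝ I) {D : ℝ} (hD : ∀ s ∈ I, |s| ≤ D)
    {f : ℝ → ℝ} (hf : ContDiff ℝ 1 f) (hf1 : ∀ s, |f s| ≤ 1) : |∫ s in I, deriv f s| ≤ 2 := by
  rcases I.eq_empty_or_nonempty with rfl | hne
  · simp
  have hbb : BddBelow I := ⟨-D, fun s hs => (abs_le.1 (hD s hs)).1⟩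
  have hba : BddAbove I := ⟨D, fun s hs => (abs_le.1 (hD s hs)).2⟩
  have h1 : Ioo (sInf I) (sSup I) ⊆ I :=
    IsConnected.Ioo_csInf_csSup_subset ⟨hne, hI.isPreconnected⟩ hbb hba
  have h2 : I ⊆ Icc (sInf I) (sSup I) := fun s hs => ⟨csInf_le hbb hs, le_csSup hba hs⟩
  have hle : sInf I ≤ sSup I := csInf_le_csSup hne hbb hba
  have hae : I =ᵐ[volume] Ioc (sInf I) (sSup I) := by
    refine (LE.le.eventuallyLE h2).antisymm ?_ |>.trans Ioc_ae_eq_Icc.symm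
    exact Ioo_ae_eq_Icc.symm.le.trans (LE.le.eventuallyLE h1)
  rw [setIntegral_congr_set hae, ← intervalIntegral.integral_of_le hle,
    intervalIntegral.integral_deriv_eq_sub (fun s _ => hf.differentiable one_ne_zero s)
    ((hf.continuous_deriv le_rfl).intervalIntegrable _ _)]
  have h3 := abs_le.1 (hf1 (sSup I))
  have h4 := abs_le.1 (hf1 (sInf I))
  rw [abs_le]; constructor <;> linarith

theorem exists_unit_perp (k : Fin 2) : ∃ ν : Plane, ‖ν‖ = 1 ∧ perp ν = unitVec k := by
  fin_cases k
  · refine ⟨-unitVec 1, by simp [unitVec], plane_ext ?_ ?_⟩ <;> simp [unitVec]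
  · refine ⟨unitVec 0, by simp [unitVec], plane_ext ?_ ?_⟩ <;> simp [unitVec]

/-- A perimeter bound for convex sets without boundary integrals: every line in direction k meets P
in an interval, which contributes at most 2, and the lines that meet P fill a length at most 2D. -/
theorem abs_setIntegral_fderiv_le {P : Set Plane} (hP : Convex ℝ P) (hPm : MeasurableSet P) {D : ℝ}
    (hD0 : 0 ≤ D) (hD : ∀ x ∈ P, ‖x‖ ≤ D) {φ : Plane → ℝ} (hφ : IsTest univ φ)
    (h1 : ∀ x, |φ x| ≤ 1) (k : Fin 2) : |∫ x in P, fderiv ℝ φ x (unitVec k)| ≤ 4 * D := by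
  obtain ⟨ν, hν, hk⟩ := exists_unit_perp k
  set F : Plane → ℝ := fun x => fderiv ℝ φ x (unitVec k) with hF
  have hFi : Integrable (P.indicator F) :=
    ((hφ.fderiv_apply (unitVec k)).integrable volume).indicator hPm
  have hi2 : Integrable (fun p => P.indicator F (framePt 0 ν p)) :=
    (measurePreserving_framePt (x₀ := 0) hν).integrable_comp_of_integrable hFi
  have hadd : ∀ s h : ℝ, framePt 0 ν (s, h) = h • ν + s • perp ν := fun s h => by
    simp [framePt, add_comm]
  rw [← integral_indicator hPm, ← integral_framePt (x₀ := 0) hν, Measure.volume_eq_prod,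
    integral_prod_symm _ hi2]
  have hslice : ∀ h : ℝ, ‖∫ s, P.indicator F (framePt 0 ν (s, h))‖ ≤
      (Icc (-D) D).indicator (fun _ => 2) h := by
    intro h
    set I : Set ℝ := {s | framePt 0 ν (s, h) ∈ P} with hI
    have hIm : MeasurableSet I := hPm.preimage (by
      have := continuous_framePt (x₀ := 0) (ν := ν)
      fun_prop)
    have hcoord : ∀ s ∈ I, |s| ≤ D ∧ |h| ≤ D := by
      intro s hs
      have h2 := hD _ hs
      have h3 := abs_tanC_sub_le (x₀ := 0) hν (framePt 0 ν (s, h)) 0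
      have h4 := abs_norC_sub_le (x₀ := 0) hν (framePt 0 ν (s, h)) 0
      rw [tanC_framePt hν, tanC_self, sub_zero, sub_zero] at h3
      rw [norC_framePt hν, norC_self, sub_zero, sub_zero] at h4
      exact ⟨h3.trans h2, h4.trans h2⟩
    have hIc : Convex ℝ I := by
      intro s hs t ht a b ha hb hab
      have := hP hs ht ha hb hab
      have e : a • framePt 0 ν (s, h) + b • framePt 0 ν (t, h) = framePt 0 ν (a • s + b • t, h) := by
        obtain rfl : b = 1 - a := by linarith
        simp only [hadd, smul_eq_mul]
        module
      rwa [e] at this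
    set f : ℝ → ℝ := fun s => φ (framePt 0 ν (s, h)) with hf
    have hfe : f = fun s => φ (h • ν + s • perp ν) := by funext s; rw [hf]; simp only [hadd]
    have hfc : ContDiff ℝ 1 f := by
      rw [hfe]; exact (hφ.smooth.of_le (by simp)).comp (by fun_prop)
    have hfd : ∀ s, deriv f s = F (framePt 0 ν (s, h)) := by
      intro s
      have h2 : HasDerivAt (fun s : ℝ => h • ν + s • perp ν) (perp ν) s := by
        have := ((hasDerivAt_id s).smul_const (perp ν)).const_add (h • ν)
        simpa using this
      have h3 := (hφ.smooth.differentiable (by simp) (h • ν + s • perp ν)).hasFDerivAt.comp_hasDerivAt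
        s h2
      rw [hfe, hF]
      simp only [hadd, ← hk]
      exact h3.deriv
    have he : ∫ s, P.indicator F (framePt 0 ν (s, h)) = ∫ s in I, deriv f s := by
      rw [← integral_indicator hIm]
      refine integral_congr_ae (Eventually.of_forall fun s => ?_)
      simp only [indicator, hfd]
      rfl
    rw [he, Real.norm_eq_abs]
    by_cases hh : h ∈ Icc (-D) D
    · rw [indicator_of_mem hh]
      exact abs_setIntegral_deriv_le hIc (fun s hs => (hcoord s hs).1) hfc fun s => h1 _
    · rw [indicator_of_notMem hh]
      have : I = ∅ := eq_empty_of_forall_notMem fun s hs => hh (abs_le.1 (hcoord s hs).2)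
      rw [this]; simp
  have hI2 : Integrable ((Icc (-D) D).indicator fun _ => (2 : ℝ)) volume :=
    (integrable_indicator_iff measurableSet_Icc).2
      (integrableOn_const (isCompact_Icc (a := -D) (b := D)).measure_lt_top.ne)
  have h5 := norm_integral_le_of_norm_le hI2 (Eventually.of_forall hslice)
  rw [integral_indicator measurableSet_Icc, setIntegral_const, smul_eq_mul, Measure.real,
    Real.volume_Icc, ENNReal.toReal_ofReal (by linarith)] at h5
  rw [← Real.norm_eq_abs]
  refine h5.trans (le_of_eq (by ring))

theorem IsTestField.abs_le_one {Ω : Set Plane} {Φ : Plane → Fin 2 → Fin 2 → Fin 2 → ℝ}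
    (hΦ : IsTestField Ω Φ) (x : Plane) (i j k : Fin 2) : |Φ x i j k| ≤ 1 := by
  have h := hΦ.le_one x
  rw [← sq_le_one_iff_abs_le_one]
  refine le_trans ?_ h
  refine le_trans ?_ (Finset.single_le_sum (f := fun i => ∑ j, ∑ k, Φ x i j k ^ 2)
    (fun _ _ => by positivity) (Finset.mem_univ i))
  refine le_trans ?_ (Finset.single_le_sum (f := fun j => ∑ k, Φ x i j k ^ 2)
    (fun _ _ => by positivity) (Finset.mem_univ j))
  exact Finset.single_le_sum (f := fun k => Φ x i j k ^ 2)
    (fun _ _ => by positivity) (Finset.mem_univ k)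

/-- For a gradient that is constant on finitely many bounded convex pieces, each piece is bounded
separately through its perimeter. The jumps need not be computed; any finite bound is enough for the
scaling. -/
theorem integral_field_le {ι : Type*} [Fintype ι] {P : ι → Set Plane} (hP : ∀ a, Convex ℝ (P a))
    (hPm : ∀ a, MeasurableSet (P a)) {D : ℝ} (hD0 : 0 ≤ D) (hD : ∀ a, ∀ x ∈ P a, ‖x‖ ≤ D)
    (hd : Pairwise fun a b => Disjoint (P a) (P b)) {A : ι → Mat} {G : Plane → Mat}
    (hG : ∀ a, ∀ x ∈ P a, G x = A a) (hG0 : ∀ᵐ x, (∀ a, x ∉ P a) → G x = 0)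
    {Φ : Plane → Fin 2 → Fin 2 → Fin 2 → ℝ} (hΦ : IsTestField univ Φ) :
    ∫ x, ∑ i, ∑ j, ∑ k, G x i j * fderiv ℝ (fun y => Φ y i j k) x (unitVec k) ≤
      ∑ a, ∑ i, ∑ j, ∑ _k : Fin 2, |A a i j| * (4 * D) := by
  have he : (fun x => ∑ i, ∑ j, ∑ k, G x i j * fderiv ℝ (fun y => Φ y i j k) x (unitVec k))
      =ᵐ[volume] fun x => ∑ a, ∑ i, ∑ j, ∑ k,
        (P a).indicator (fun x => A a i j * fderiv ℝ (fun y => Φ y i j k) x (unitVec k)) x := by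
    filter_upwards [hG0] with x hx
    by_cases h : ∃ a, x ∈ P a
    · obtain ⟨a, ha⟩ := h
      rw [Finset.sum_eq_single a]
      · simp only [indicator_of_mem ha, hG a x ha]
      · intro b _ hb
        have : x ∉ P b := fun hxb => disjoint_left.1 (hd hb) hxb ha
        simp only [indicator_of_notMem this, Finset.sum_const_zero]
      · intro h; exact absurd (Finset.mem_univ a) h
    · push Not at h
      rw [hx h, Finset.sum_eq_zero (s := (Finset.univ : Finset ι))]
      · simp
      · intro a _
        simp only [indicator_of_notMem (h a), Finset.sum_const_zero]
  have hint : ∀ a i j k, Integrable ((P a).indicator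
      (fun x => A a i j * fderiv ℝ (fun y => Φ y i j k) x (unitVec k))) := fun a i j k =>
    ((((hΦ.isTest i j k).fderiv_apply (unitVec k)).integrable volume).const_mul _).indicator (hPm a)
  rw [integral_congr_ae he, integral_finsetSum _ fun a _ => integrable_finsetSum _ fun i _ =>
    integrable_finsetSum _ fun j _ => integrable_finsetSum _ fun k _ => hint a i j k]
  refine Finset.sum_le_sum fun a _ => ?_
  rw [integral_finsetSum _ fun i _ => integrable_finsetSum _ fun j _ =>
    integrable_finsetSum _ fun k _ => hint a i j k]
  refine Finset.sum_le_sum fun i _ => ?_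
  rw [integral_finsetSum _ fun j _ => integrable_finsetSum _ fun k _ => hint a i j k]
  refine Finset.sum_le_sum fun j _ => ?_
  rw [integral_finsetSum _ fun k _ => hint a i j k]
  refine Finset.sum_le_sum fun k _ => ?_
  rw [integral_indicator (hPm a), integral_const_mul]
  refine (le_abs_self _).trans ?_
  rw [abs_mul]
  gcongr
  exact abs_setIntegral_fderiv_le (hP a) (hPm a) hD0 (hD a) (hΦ.isTest i j k)
    (fun x => hΦ.abs_le_one x i j k) k

theorem integral_apply_mul_fderiv {u : Plane → Plane} {L : NNReal} (hu : LipschitzWith L u)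
    {φ : Plane → ℝ} (hφ : IsTest univ φ) (i j : Fin 2) :
    ∫ x, u x i * fderiv ℝ φ x (unitVec j) = -∫ x, gradMat u x i j * φ x := by
  have hui : LipschitzWith (1 * L) fun x => u x i :=
    (LipschitzWith.of_dist_le_mul (K := 1) (f := fun p : Plane => p i) fun p q => by
        rw [NNReal.coe_one, one_mul, dist_eq_norm, dist_eq_norm]
        exact PiLp.norm_apply_le (p - q) i).comp hu
  obtain ⟨L', hφL⟩ := ContDiff.lipschitzWith_of_hasCompactSupport (n := ∞) hφ.compact hφ.smooth (by simp)
  have h1 := hui.integral_lineDeriv_mul_eq (μ := volume) hφL hφ.compact (unitVec j)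
  have h2 : ∫ x, lineDeriv ℝ (fun x => u x i) x (unitVec j) * φ x = ∫ x, gradMat u x i j * φ x := by
    refine integral_congr_ae ?_
    filter_upwards [hu.ae_differentiableAt] with x hx
    have h3 := (PiLp.hasFDerivAt_apply (𝕜 := ℝ) 2 (u x) i).comp x hx.hasFDerivAt
    have h4 : ((fun p : Plane => p i) ∘ u) = fun x => u x i := rfl
    rw [h4] at h3
    rw [h3.differentiableAt.lineDeriv_eq_fderiv, h3.fderiv]
    rfl
  rw [← h2, h1, ← integral_neg]
  refine integral_congr_ae (Eventually.of_forall fun x => ?_)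
  simp only
  rw [(hφ.smooth.differentiable (by simp) x).lineDeriv_eq_fderiv, map_neg]
  ring

theorem isPatch_of_lipschitz {u : Plane → Plane} {L : NNReal} (hu : LipschitzWith L u) {V : ℝ}
    (hV : ∀ Φ : Plane → Fin 2 → Fin 2 → Fin 2 → ℝ, IsTestField univ Φ →
      ∫ x, ∑ i, ∑ j, ∑ k, gradMat u x i j * fderiv ℝ (fun y => Φ y i j k) x (unitVec k) ≤ V) :
    IsPatch u (gradMat u) V where
  continuous := hu.continuous
  measurable i j := by
    have h1 := measurable_fderiv_apply_const ℝ u (unitVec j)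
    have h2 : Continuous fun p : Plane => p i := by fun_prop
    exact h2.measurable.comp h1
  bounded := ⟨L, fun x i j => by
    have h1 : ‖fderiv ℝ u x (unitVec j)‖ ≤ L := by
      refine (ContinuousLinearMap.le_opNorm _ _).trans ?_
      rw [show ‖unitVec j‖ = 1 by simp [unitVec], mul_one]
      exact norm_fderiv_le_of_lipschitz ℝ hu
    exact (PiLp.norm_apply_le (fderiv ℝ u x (unitVec j)) i).trans h1⟩
  weak φ hφ i j := integral_apply_mul_fderiv hu hφ i j
  var := hV

end HexRhombic

namespace HexRhombic

/-! ### The building block: barycentric pieces -/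

/-- The constant `b = 1 + √3`. -/
noncomputable def bb : ℝ := 1 + √3

/-- The open pieces of a triangle, in its barycentric coordinates. -/
def InPiece (x : Fin 3 → ℝ) : Option (Bool × Fin 3) → Prop
  | none => ∀ i, x i < bb
  | some (true, j) => 0 < x j ∧ bb * x j < x (j + 1) ∧ bb * x j < x (j + 2)
  | some (false, j) => bb < x j ∧ x (j + 1) < bb * x (j + 2) ∧ x (j + 2) < bb * x (j + 1)

theorem one_lt_bb : 1 < bb := by
  unfold bb
  have : 0 < √3 := by positivity
  linarith

theorem bb_facts (y : ℝ) : (0 < y → y < bb * y) ∧ (1 < y → bb < bb * y) ∧ (y < 1 → bb * y < bb) := by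
  have := one_lt_bb
  refine ⟨fun h => by nlinarith, fun h => by nlinarith, fun h => by nlinarith⟩

theorem InPiece.unique {x : Fin 3 → ℝ} (hx : x 0 + x 1 + x 2 = 1 + 2 * bb)
    {a a' : Option (Bool × Fin 3)} (h : InPiece x a) (h' : InPiece x a') : a = a' := by
  have hb := one_lt_bb
  have f0 := bb_facts (x 0)
  have f1 := bb_facts (x 1)
  have f2 := bb_facts (x 2)
  rcases a with _ | ⟨_ | _, j⟩ <;> rcases a' with _ | ⟨_ | _, j'⟩ <;>
    simp only [InPiece, Fin.forall_fin_succ] at h h' <;> 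
    (try fin_cases j) <;> (try fin_cases j') <;> simp [Fin.ext_iff] at h h' ⊢ <;> grind

/-- The excluded equalities describe lines containing the edges between the pieces, so the lemma
will hold almost everywhere in the triangle. If some coordinate exceeds b, the ratio of the other
two decides between the vertex piece and the two adjacent side pieces. -/
theorem exists_inPiece {x : Fin 3 → ℝ} (hx : x 0 + x 1 + x 2 = 1 + 2 * bb) (h0 : ∀ i, 0 < x i)
    (hb : ∀ i, x i ≠ bb) (hne : ∀ i j, i ≠ j → bb * x i ≠ x j) : ∃ a, InPiece x a := by
  have h1 := one_lt_bb
  have f0 := bb_facts (x 0)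
  have f1 := bb_facts (x 1)
  have f2 := bb_facts (x 2)
  have p0 := h0 0
  have p1 := h0 1
  have p2 := h0 2
  by_cases hall : ∀ i, x i < bb
  · exact ⟨none, hall⟩
  push Not at hall
  obtain ⟨j, hj⟩ := hall
  have hj' := lt_of_le_of_ne hj (hb j).symm
  have e1 := hne (j + 1) (j + 2) (by fin_cases j <;> decide)
  have e2 := hne (j + 2) (j + 1) (by fin_cases j <;> decide)
  rcases lt_or_gt_of_ne e1 with h2 | h2
  · refine ⟨some (true, j + 1), ?_⟩
    fin_cases j <;> simp [InPiece] at hj' h2 ⊢ <;> grind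
  · rcases lt_or_gt_of_ne e2 with h3 | h3
    · refine ⟨some (true, j + 2), ?_⟩
      fin_cases j <;> simp [InPiece] at hj' h3 ⊢ <;> grind
    · exact ⟨some (false, j), hj', h3, h2⟩

/-- The slope `1 / (b² - 1)`. -/
noncomputable def pp : ℝ := (2 * √3 - 3) / 3

theorem pp_pos : 0 < pp := by
  have h1 : √3 ^ 2 = 3 := Real.sq_sqrt (by norm_num)
  have h0 : 0 < √3 := by positivity
  unfold pp
  nlinarith

theorem pp_mul : pp * (bb ^ 2 - 1) = 1 := by
  have h1 : √3 ^ 2 = 3 := Real.sq_sqrt (by norm_num)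
  have h0 : 0 < √3 := by positivity
  unfold pp bb
  nlinarith

/-- The tent over one side of the triangle. -/
noncomputable def tent (x y z : ℝ) : ℝ :=
  max 0 (min (min x (pp * (bb + 1) * (bb - x))) (min (pp * (bb * y - x)) (pp * (bb * z - x))))

theorem tent_comm (x y z : ℝ) : tent x y z = tent x z y := by
  unfold tent
  rw [min_comm (pp * (bb * y - x))]

theorem tent_eq_zero {x y z : ℝ} (h : x ≤ 0 ∨ bb ≤ x ∨ bb * y ≤ x ∨ bb * z ≤ x) :
    tent x y z = 0 := by
  have hp := pp_pos
  have hb := one_lt_bb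
  refine max_eq_left ?_
  rcases h with h | h | h | h
  · exact (min_le_left _ _).trans ((min_le_left _ _).trans h)
  · refine (min_le_left _ _).trans ((min_le_right _ _).trans ?_)
    exact mul_nonpos_of_nonneg_of_nonpos (by positivity) (by linarith)
  · refine (min_le_right _ _).trans ((min_le_left _ _).trans ?_)
    exact mul_nonpos_of_nonneg_of_nonpos hp.le (by linarith)
  · refine (min_le_right _ _).trans ((min_le_right _ _).trans ?_)
    exact mul_nonpos_of_nonneg_of_nonpos hp.le (by linarith)

theorem tent_eq_zero_of_nonpos {x y z : ℝ} (h : x ≤ 0 ∨ y ≤ 0 ∨ z ≤ 0) : tent x y z = 0 := by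
  have hb := one_lt_bb
  rcases le_or_gt x 0 with hx | hx
  · exact tent_eq_zero (Or.inl hx)
  rcases h with h | h | h
  · linarith
  · exact tent_eq_zero (Or.inr (Or.inr (Or.inl (by nlinarith))))
  · exact tent_eq_zero (Or.inr (Or.inr (Or.inr (by nlinarith))))

/-- On each piece the active branch of the minimum is found by factoring the differences of the
branches, by means of p(b² − 1) = 1 where needed. The signs of the factors follow from the
inequalities that define the piece. -/
theorem tent_eq_self {x y z : ℝ} (hs : x + y + z = 1 + 2 * bb) (h0 : 0 < x) (hy : bb * x < y)
    (hz : bb * x < z) : tent x y z = x := by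
  have hp := pp_pos
  have hb := one_lt_bb
  have hm := pp_mul
  have h1 : pp * (bb + 1) * (bb - x) - x = pp * (bb + 1) * bb * (1 - x) := by
    linear_combination x * hm
  have h2 : ∀ y, pp * (bb * y - x) - x = pp * bb * (y - bb * x) := by
    intro y; linear_combination x * hm
  have h3 : 0 ≤ pp * (bb + 1) * bb * (1 - x) :=
    mul_nonneg (by positivity) (by nlinarith)
  have h4 : 0 ≤ pp * bb * (y - bb * x) := mul_nonneg (by positivity) (by linarith)
  have h5 : 0 ≤ pp * bb * (z - bb * x) := mul_nonneg (by positivity) (by linarith)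
  rw [tent, min_eq_left (a := x) (b := pp * (bb + 1) * (bb - x)) (by linarith),
    min_eq_left (le_min (by linarith [h2 y]) (by linarith [h2 z])),
    max_eq_right h0.le]

theorem tent_eq_outer {x y z : ℝ} (hs : x + y + z = 1 + 2 * bb) (hy : bb < y) (hz : z < bb * x)
    (hx : x < bb * z) : tent x y z = pp * (bb * z - x) := by
  have hp := pp_pos
  have hb := one_lt_bb
  have hm := pp_mul
  have hzb : z < bb := by nlinarith
  have h1 : x - pp * (bb * z - x) = pp * bb * (bb * x - z) := by linear_combination (-x) * hm
  have h2 : pp * (bb + 1) * (bb - x) - pp * (bb * z - x) = pp * bb * (bb + 1 - x - z) := by ring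
  have h3 : pp * (bb * y - x) - pp * (bb * z - x) = pp * bb * (y - z) := by ring
  have h4 : 0 ≤ pp * bb * (bb * x - z) := mul_nonneg (by positivity) (by linarith)
  have h5 : 0 ≤ pp * bb * (bb + 1 - x - z) := mul_nonneg (by positivity) (by linarith)
  have h6 : 0 ≤ pp * bb * (y - z) := mul_nonneg (by positivity) (by linarith)
  have h7 : 0 ≤ pp * (bb * z - x) := mul_nonneg hp.le (by linarith)
  rw [tent, min_eq_right (a := pp * (bb * y - x)) (by linarith),
    min_eq_right (le_min (by linarith) (by linarith)), max_eq_right h7]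

theorem tent_eq_inner {x y z : ℝ} (hs : x + y + z = 1 + 2 * bb) (hx : x < bb) (hy : y < bb)
    (hz : z < bb) : tent x y z = pp * (bb + 1) * (bb - x) := by
  have hp := pp_pos
  have hb := one_lt_bb
  have hm := pp_mul
  have h1 : x - pp * (bb + 1) * (bb - x) = pp * (bb + 1) * bb * (x - 1) := by
    linear_combination (-x) * hm
  have h2 : ∀ y, pp * (bb * y - x) - pp * (bb + 1) * (bb - x) = pp * bb * (y + x - bb - 1) := by
    intro y; ring
  have h4 : 0 ≤ pp * (bb + 1) * bb * (x - 1) := mul_nonneg (by positivity) (by linarith)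
  have h5 : 0 ≤ pp * bb * (y + x - bb - 1) := mul_nonneg (by positivity) (by linarith)
  have h6 : 0 ≤ pp * bb * (z + x - bb - 1) := mul_nonneg (by positivity) (by linarith)
  have h7 : 0 ≤ pp * (bb + 1) * (bb - x) := mul_nonneg (by positivity) (by linarith)
  rw [tent, min_eq_right (a := x) (by linarith),
    min_eq_left (le_min (by linarith [h2 y]) (by linarith [h2 z])), max_eq_right h7]

/-- The constant terms of the tents on the pieces. -/
noncomputable def pieceConst : Option (Bool × Fin 3) → ℝ
  | none => pp * (bb + 1) * bb
  | some _ => 0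

/-- The linear coefficients of the tents on the pieces. -/
noncomputable def pieceCoef : Option (Bool × Fin 3) → Fin 3 → Fin 3 → ℝ
  | none, i, k => if i = k then -(pp * (bb + 1)) else 0
  | some (true, j), i, k => if i = j ∧ k = j then 1 else 0
  | some (false, j), i, k => if i = j ∨ k = j then 0 else if i = k then -pp else pp * bb

theorem tent_eq {x : Fin 3 → ℝ} (hx : x 0 + x 1 + x 2 = 1 + 2 * bb) {a : Option (Bool × Fin 3)}
    (ha : InPiece x a) (i : Fin 3) :
    tent (x i) (x (i + 1)) (x (i + 2)) = pieceConst a + ∑ k, pieceCoef a i k * x k := by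
  have hs : ∀ i, x i + x (i + 1) + x (i + 2) = 1 + 2 * bb := by
    intro i; fin_cases i <;> simp <;> linarith
  have hs' : ∀ i, x i + x (i + 2) + x (i + 1) = 1 + 2 * bb := fun i => by linarith [hs i]
  have e1 : ∀ j : Fin 3, j + 1 + 1 = j + 2 := by decide
  have e2 : ∀ j : Fin 3, j + 1 + 2 = j := by decide
  have e3 : ∀ j : Fin 3, j + 2 + 1 = j := by decide
  have e4 : ∀ j : Fin 3, j + 2 + 2 = j + 1 := by decide
  have hj3 : ∀ j : Fin 3, i = j ∨ i = j + 1 ∨ i = j + 2 := by revert i; decide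
  have d1 : ∀ j : Fin 3, j + 1 ≠ j := by decide
  have d2 : ∀ j : Fin 3, j + 2 ≠ j := by decide
  have d3 : ∀ j : Fin 3, j + 1 ≠ j + 2 := by decide
  have hsum : ∀ (j : Fin 3) (f : Fin 3 → ℝ), ∑ k, f k = f j + f (j + 1) + f (j + 2) := by
    intro j f
    fin_cases j <;> simp [Fin.sum_univ_three] <;> ring
  rcases a with _ | ⟨_ | _, j⟩
  · rw [tent_eq_inner (hs i) (ha _) (ha _) (ha _)]
    simp [pieceConst, pieceCoef]
    ring
  · obtain ⟨h1, h2, h3⟩ := ha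
    rw [hsum j]
    rcases hj3 j with rfl | rfl | rfl
    · rw [tent_eq_zero (Or.inr (Or.inl h1.le))]
      simp [pieceConst, pieceCoef]
    · rw [e1, e2, tent_comm, tent_eq_outer (by linarith [hs j]) h1 h3 h2]
      simp [pieceConst, pieceCoef, d1, d2, d3]
      ring
    · rw [e3, e4, tent_eq_outer (by linarith [hs j]) h1 h2 h3]
      simp [pieceConst, pieceCoef, d1, d2, (d3 _).symm]
      ring
  · obtain ⟨h1, h2, h3⟩ := ha
    rw [hsum j]
    rcases hj3 j with rfl | rfl | rfl
    · rw [tent_eq_self (hs i) h1 h2 h3]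
      simp [pieceConst, pieceCoef, d1, d2]
    · rw [e1, e2, tent_eq_zero (Or.inr (Or.inr (Or.inr h2.le)))]
      simp [pieceConst, pieceCoef, d1]
    · rw [e3, e4, tent_eq_zero (Or.inr (Or.inr (Or.inl h3.le)))]
      simp [pieceConst, pieceCoef, d2]

end HexRhombic

/-! ### The triangle and its seven convex pieces -/

namespace HexRhombic

/-- The barycentric coordinates of the triangle with outer normals `amN σ j`. -/
noncomputable def bary (σ : ℝ) (z : Plane) (j : Fin 3) : ℝ :=
  1 + 2 * √3 / 3 - inner ℝ (amN σ j) z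

/-- The open triangle. -/
def tri (σ : ℝ) : Set Plane := {z | ∀ j, 0 < bary σ z j}

theorem amN_coords (σ : ℝ) : (amN σ 0 0 = 1 ∧ amN σ 0 1 = σ) ∧
    (amN σ 1 0 = -1 / 2 - σ * (√3 / 2) ∧ amN σ 1 1 = √3 / 2 - σ / 2) ∧
    (amN σ 2 0 = -1 / 2 + σ * (√3 / 2) ∧ amN σ 2 1 = -(√3 / 2) - σ / 2) := by
  simp only [amN_zero_coord, amN_one_coord]
  refine ⟨⟨?_, ?_⟩, ⟨?_, ?_⟩, ⟨?_, ?_⟩⟩ <;> simp <;> ring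

theorem sum_bary (σ : ℝ) (z : Plane) : bary σ z 0 + bary σ z 1 + bary σ z 2 = 1 + 2 * bb := by
  obtain ⟨⟨h1, h2⟩, ⟨h3, h4⟩, ⟨h5, h6⟩⟩ := amN_coords σ
  simp only [bary, inner_plane, h1, h2, h3, h4, h5, h6, bb]
  ring

theorem bary_convex (σ : ℝ) {x y : Plane} {a c : ℝ} (h : a + c = 1) (j : Fin 3) :
    bary σ (a • x + c • y) j = a * bary σ x j + c * bary σ y j := by
  obtain rfl : c = 1 - a := by linarith
  simp only [bary, inner_plane, PiLp.add_apply, PiLp.smul_apply, smul_eq_mul]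
  ring

theorem continuous_bary (σ : ℝ) (j : Fin 3) : Continuous fun z => bary σ z j := by
  unfold bary; fun_prop

theorem convex_comb_lt {a c u v u' v' : ℝ} (ha : 0 ≤ a) (hc : 0 ≤ c) (hac : a + c = 1) (h : u < v)
    (h' : u' < v') : a * u + c * u' < a * v + c * v' := by
  rcases ha.eq_or_lt with rfl | ha
  · obtain rfl : c = 1 := by linarith
    linarith
  · nlinarith

theorem isOpen_tri (σ : ℝ) : IsOpen (tri σ) := by
  simp only [tri, ofPred_forall]
  exact isOpen_iInter_of_finite fun j => isOpen_lt continuous_const (continuous_bary σ j)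

theorem convex_tri (σ : ℝ) : Convex ℝ (tri σ) := by
  intro x hx y hy a c ha hc hac j
  rw [bary_convex σ hac]
  have := convex_comb_lt ha hc hac (hx j) (hy j)
  linarith

/-- The three normals are vectors of length √2 at mutual angles 2π/3, a tight frame: the sum of
n_j⊗n_j is 3 times the identity. -/
theorem norm_sq_eq_bary {σ : ℝ} (hσ : σ ^ 2 = 1) (z : Plane) :
    3 * ‖z‖ ^ 2 = ∑ j, inner ℝ (amN σ j) z ^ 2 := by
  obtain ⟨⟨h1, h2⟩, ⟨h3, h4⟩, ⟨h5, h6⟩⟩ := amN_coords σ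
  have h7 : √3 ^ 2 = 3 := Real.sq_sqrt (by norm_num)
  rw [norm_sq_plane, Fin.sum_univ_three]
  simp only [inner_plane, h1, h2, h3, h4, h5, h6]
  linear_combination (-(3 / 2 * z 0 ^ 2 + 3 / 2 * z 1 ^ 2)) * hσ -
    (z 0 ^ 2 * σ ^ 2 / 2 + z 1 ^ 2 / 2 - z 0 * z 1 * σ) * h7

/-- The open pieces of the triangle. -/
def piece (σ : ℝ) (a : Option (Bool × Fin 3)) : Set Plane := {z | InPiece (bary σ z) a}

theorem isOpen_piece (σ : ℝ) (a : Option (Bool × Fin 3)) : IsOpen (piece σ a) := by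
  have h := continuous_bary σ
  rcases a with _ | ⟨_ | _, j⟩
  · simp only [piece, InPiece, ofPred_forall]
    exact isOpen_iInter_of_finite fun j => isOpen_lt (h j) continuous_const
  · exact (isOpen_lt continuous_const (h _)).inter ((isOpen_lt (h _) ((h _).const_mul _)).inter
      (isOpen_lt (h _) ((h _).const_mul _)))
  · exact (isOpen_lt continuous_const (h _)).inter ((isOpen_lt ((h _).const_mul _) (h _)).inter
      (isOpen_lt ((h _).const_mul _) (h _)))

theorem convex_piece (σ : ℝ) (p : Option (Bool × Fin 3)) : Convex ℝ (piece σ p) := by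
  intro x hx y hy a c ha hc hac
  have h := fun j => bary_convex σ (x := x) (y := y) hac j
  have hl := fun {u v u' v' : ℝ} => convex_comb_lt (u := u) (v := v) (u' := u') (v' := v') ha hc hac
  rcases p with _ | ⟨_ | _, j⟩
  · intro j
    rw [h]
    have := hl (hx j) (hy j)
    rwa [← add_mul, hac, one_mul] at this
  · obtain ⟨h1, h2, h3⟩ := hx
    obtain ⟨k1, k2, k3⟩ := hy
    refine ⟨?_, ?_, ?_⟩
    · rw [h]
      have := hl h1 k1
      rwa [← add_mul, hac, one_mul] at this
    · rw [h, h]; linarith [hl h2 k2]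
    · rw [h, h]; linarith [hl h3 k3]
  · obtain ⟨h1, h2, h3⟩ := hx
    obtain ⟨k1, k2, k3⟩ := hy
    refine ⟨?_, ?_, ?_⟩
    · rw [h]; linarith [hl h1 k1]
    · rw [h, h]; linarith [hl h2 k2]
    · rw [h, h]; linarith [hl h3 k3]

theorem piece_subset_tri (σ : ℝ) (a : Option (Bool × Fin 3)) : piece σ a ⊆ tri σ := by
  intro z hz
  have hs := sum_bary σ z
  have hb := one_lt_bb
  have f0 := bb_facts (bary σ z 0)
  have f1 := bb_facts (bary σ z 1)
  have f2 := bb_facts (bary σ z 2)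
  have g : ∀ i, bary σ z i ≤ 0 → bb * bary σ z i ≤ bary σ z i := fun i hi => by nlinarith
  have g0 := g 0
  have g1 := g 1
  have g2 := g 2
  clear g
  change InPiece (bary σ z) a at hz
  suffices h : 0 < bary σ z 0 ∧ 0 < bary σ z 1 ∧ 0 < bary σ z 2 by
    intro j
    fin_cases j
    exacts [h.1, h.2.1, h.2.2]
  generalize bary σ z = x at *
  rcases a with _ | ⟨_ | _, j⟩ <;> simp only [InPiece, Fin.forall_fin_succ] at hz <;>
    (try fin_cases j) <;> simp at hz ⊢
  all_goals grind

theorem ae_inner_ne {n : Plane} (hn : n ≠ 0) (c : ℝ) : ∀ᵐ z : Plane, inner ℝ n z ≠ c := by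
  have hn' : 0 < ‖n‖ := norm_pos_iff.2 hn
  have hν : ‖(‖n‖⁻¹ • n)‖ = 1 := by
    rw [norm_smul, norm_inv, norm_norm, inv_mul_cancel₀ hn'.ne']
  have h1 := volume_coords (x₀ := 0) hν (univ ×ˢ {‖n‖⁻¹ * c})
  rw [Measure.volume_eq_prod, Measure.prod_prod, Real.volume_singleton, mul_zero] at h1
  rw [ae_iff]
  refine measure_mono_null (fun z hz => ?_) h1
  have hz : inner ℝ n z = c := by simpa using hz
  refine ⟨mem_univ _, ?_⟩
  rw [mem_singleton_iff, norC, sub_zero, inner_smul_right, real_inner_comm, hz]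

theorem ae_bary {σ : ℝ} (hσ : σ ^ 2 = 1) : ∀ᵐ z : Plane, (∀ i, bary σ z i ≠ 0) ∧
    (∀ i, bary σ z i ≠ bb) ∧ ∀ i j, i ≠ j → bb * bary σ z i ≠ bary σ z j := by
  have hn0 : ∀ j, amN σ j ≠ 0 := fun j h => by
    have := norm_sq_amN hσ j
    rw [h] at this; simp at this
  have hne : ∀ i j, i ≠ j → bb • amN σ i - amN σ j ≠ 0 := by
    intro i j hij h
    have h1 : bb • amN σ i = amN σ j := sub_eq_zero.1 h
    have h2 := congrArg (fun v : Plane => ‖v‖ ^ 2) h1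
    simp only [norm_smul, mul_pow, norm_sq_amN hσ, Real.norm_eq_abs, sq_abs] at h2
    have := one_lt_bb
    nlinarith
  have h1 : ∀ i, ∀ᵐ z : Plane, bary σ z i ≠ 0 := fun i => by
    filter_upwards [ae_inner_ne (hn0 i) (1 + 2 * √3 / 3)] with z hz h
    exact hz (by unfold bary at h; linarith)
  have h2 : ∀ i, ∀ᵐ z : Plane, bary σ z i ≠ bb := fun i => by
    filter_upwards [ae_inner_ne (hn0 i) (1 + 2 * √3 / 3 - bb)] with z hz h
    exact hz (by unfold bary at h; linarith)
  have h3 : ∀ i j, ∀ᵐ z : Plane, i ≠ j → bb * bary σ z i ≠ bary σ z j := fun i j => by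
    by_cases hij : i = j
    · exact Eventually.of_forall fun z h => absurd hij h
    filter_upwards [ae_inner_ne (hne i j hij) ((bb - 1) * (1 + 2 * √3 / 3))] with z hz _ h
    refine hz ?_
    rw [inner_sub_left, inner_smul_left]
    unfold bary at h
    simp only [conj_trivial]
    linarith
  filter_upwards [ae_all_iff.2 h1, ae_all_iff.2 h2, ae_all_iff.2 fun i => ae_all_iff.2 (h3 i)] with
    z k1 k2 k3 using ⟨k1, k2, k3⟩

end HexRhombic

/-! ### The building block: gradients and strains -/

namespace HexRhombic

/-- The gradient of the building block on its pieces. -/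
noncomputable def pieceMat (σ : ℝ) (a : Option (Bool × Fin 3)) : Mat :=
  Matrix.of fun r s => σ * ∑ i, ∑ k, pieceCoef a i k * perp (amN σ i) r * amN σ k s

/-- On the core the gradient is a multiple of the sum of n_i^⊥⊗n_i, which by the tight frame
property is 3 times the quarter turn, hence skew. -/
theorem symPart_pieceMat_none (σ : ℝ) : symPart (pieceMat σ none) = 0 := by
  obtain ⟨⟨h1, h2⟩, ⟨h3, h4⟩, ⟨h5, h6⟩⟩ := amN_coords σ
  have h7 : √3 ^ 2 = 3 := Real.sq_sqrt (by norm_num)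
  generalize √3 = t at *
  ext r s
  fin_cases r <;> fin_cases s <;>
    simp [symPart, pieceMat, pieceCoef, Fin.sum_univ_three, h1, h2, h3, h4, h5, h6] <;> grind

/-- On a side piece the gradient is σ n_j^⊥⊗n_j, whose symmetric part is the well. On a vertex
piece, n_0 + n_1 + n_2 = 0 reduces the strain to p(2b + 1) times the same well; the choice b = 1 +
√3 gives b² = 2b + 2, so that this factor is 1. -/
theorem symPart_pieceMat_some {σ : ℝ} (hσ : σ ^ 2 = 1) (c : Bool) (j : Fin 3) :
    symPart (pieceMat σ (some (c, j))) = wellOf j := by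
  obtain ⟨⟨h1, h2⟩, ⟨h3, h4⟩, ⟨h5, h6⟩⟩ := amN_coords σ
  have h7 : √3 ^ 2 = 3 := Real.sq_sqrt (by norm_num)
  have hp : pp = (2 * √3 - 3) / 3 := rfl
  have hb : bb = 1 + √3 := rfl
  have hw : ∀ j, wellOf j = ![!![-1, 0; 0, 1], (1 / 2 : ℝ) • !![1, √3; √3, -1],
    (1 / 2 : ℝ) • !![1, -√3; -√3, -1]] j := fun _ => rfl
  generalize √3 = t at *
  ext r s
  rcases c with _ | _ <;> fin_cases j <;> fin_cases r <;> fin_cases s <;>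
    simp [symPart, pieceMat, pieceCoef, Fin.sum_univ_three, hw, h1, h2, h3, h4,
      h5, h6, hp, hb] <;> grind

/-- The building block: a Lipschitz field supported in the triangle. -/
noncomputable def baseField (σ : ℝ) (z : Plane) : Plane :=
  ∑ i, (-(σ * tent (bary σ z i) (bary σ z (i + 1)) (bary σ z (i + 2)))) • perp (amN σ i)

theorem baseField_eq_zero {σ : ℝ} {z : Plane} (h : ∃ j, bary σ z j ≤ 0) : baseField σ z = 0 := by
  obtain ⟨j, hj⟩ := h
  refine Finset.sum_eq_zero fun i _ => ?_
  have h3 : ∀ j i : Fin 3, j = i ∨ j = i + 1 ∨ j = i + 2 := by decide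
  rw [tent_eq_zero_of_nonpos, mul_zero, neg_zero, zero_smul]
  rcases h3 j i with rfl | rfl | rfl
  · exact Or.inl hj
  · exact Or.inr (Or.inl hj)
  · exact Or.inr (Or.inr hj)

theorem gradMat_baseField_eq_zero {σ : ℝ} {z : Plane} (h : ∃ j, bary σ z j < 0) :
    gradMat (baseField σ) z = 0 := by
  obtain ⟨j, hj⟩ := h
  have h1 : baseField σ =ᶠ[𝓝 z] fun _ => 0 := by
    filter_upwards [(isOpen_lt (continuous_bary σ j) continuous_const).mem_nhds hj] with y hy
    exact baseField_eq_zero ⟨j, le_of_lt hy⟩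
  ext r s
  simp [gradMat, h1.fderiv_eq]

theorem hasFDerivAt_bary (σ : ℝ) (j : Fin 3) (z : Plane) :
    HasFDerivAt (fun z => bary σ z j) (-innerSL ℝ (amN σ j)) z :=
  (innerSL ℝ (amN σ j)).hasFDerivAt.const_sub _

theorem gradMat_baseField {σ : ℝ} {z : Plane} {a : Option (Bool × Fin 3)} (hz : z ∈ piece σ a) :
    gradMat (baseField σ) z = pieceMat σ a := by
  have h1 : baseField σ =ᶠ[𝓝 z] fun y =>
      ∑ i, (-(σ * (pieceConst a + ∑ k, pieceCoef a i k * bary σ y k))) • perp (amN σ i) := by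
    filter_upwards [(isOpen_piece σ a).mem_nhds hz] with y hy
    exact Finset.sum_congr rfl fun i _ => by rw [tent_eq (sum_bary σ y) hy i]
  have h2 : HasFDerivAt (fun y =>
      ∑ i, (-(σ * (pieceConst a + ∑ k, pieceCoef a i k * bary σ y k))) • perp (amN σ i))
      (∑ i, (-(σ • ∑ k, pieceCoef a i k • -innerSL ℝ (amN σ k))).smulRight (perp (amN σ i))) z :=
    HasFDerivAt.fun_sum fun i _ => (((HasFDerivAt.fun_sum fun k _ =>
      (hasFDerivAt_bary σ k z).const_mul _).const_add _).const_mul _).neg.smul_const _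
  have hu : ∀ (w : Plane) (s : Fin 2), inner ℝ w (unitVec s) = w s := by
    intro w s; simp [unitVec, EuclideanSpace.inner_single_right]
  ext r s
  simp only [gradMat, Matrix.of_apply, h1.fderiv_eq, h2.fderiv, pieceMat]
  simp only [_root_.sum_apply, ContinuousLinearMap.smulRight_apply, WithLp.ofLp_sum, Finset.sum_apply,
    _root_.neg_apply, _root_.smul_apply, innerSL_apply_apply, hu, PiLp.smul_apply, smul_eq_mul,
    Finset.mul_sum, Finset.sum_mul, mul_neg, Finset.sum_neg_distrib, neg_neg]
  refine Finset.sum_congr rfl fun i _ => Finset.sum_congr rfl fun k _ => ?_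
  ring

theorem exists_lipschitz_bary (σ : ℝ) (j : Fin 3) : ∃ L, LipschitzWith L fun z => bary σ z j :=
  ⟨_, LipschitzWith.of_dist_le_mul (K := ‖amN σ j‖₊) fun x y => by
    rw [Real.dist_eq, bary, bary, sub_sub_sub_cancel_left, ← inner_sub_right, dist_comm,
      dist_eq_norm, coe_nnnorm]
    exact abs_real_inner_le_norm _ _⟩

theorem exists_lipschitz_baseField (σ : ℝ) : ∃ L, LipschitzWith L (baseField σ) := by
  have hlin : ∀ (f g : Plane → ℝ) (c d e : ℝ), (∃ L, LipschitzWith L f) → (∃ L, LipschitzWith L g) →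
      ∃ L, LipschitzWith L fun z => c * f z + d * g z + e := by
    rintro f g c d e ⟨L, hf⟩ ⟨M, hg⟩
    have h := (((lipschitzWith_smul c).comp hf).add ((lipschitzWith_smul d).comp hg)).add
      (LipschitzWith.const e)
    exact ⟨_, h⟩
  have ht : ∀ i, ∃ L, LipschitzWith L fun z =>
      (-(σ * tent (bary σ z i) (bary σ z (i + 1)) (bary σ z (i + 2)))) • perp (amN σ i) := by
    intro i
    obtain ⟨L₀, h0⟩ := exists_lipschitz_bary σ i
    obtain ⟨L₁, h1⟩ := hlin _ _ (-(pp * (bb + 1))) 0 (pp * (bb + 1) * bb)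
      (exists_lipschitz_bary σ i) (exists_lipschitz_bary σ i)
    obtain ⟨L₂, h2⟩ := hlin _ _ (pp * bb) (-pp) 0
      (exists_lipschitz_bary σ (i + 1)) (exists_lipschitz_bary σ i)
    obtain ⟨L₃, h3⟩ := hlin _ _ (pp * bb) (-pp) 0
      (exists_lipschitz_bary σ (i + 2)) (exists_lipschitz_bary σ i)
    obtain ⟨L, F, hF, e⟩ : ∃ L, ∃ F : Plane → ℝ, LipschitzWith L F ∧ ∀ z,
        tent (bary σ z i) (bary σ z (i + 1)) (bary σ z (i + 2)) = F z :=
      ⟨_, _, ((h0.min h1).min (h2.min h3)).const_max 0, fun z => by unfold tent; ring_nf⟩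
    have h5 := (LipschitzWith.of_dist_le_mul (K := ‖(-σ) • perp (amN σ i)‖₊)
      (f := fun t : ℝ => t • (-σ) • perp (amN σ i)) fun x y => by
        rw [dist_eq_norm, ← sub_smul, norm_smul, mul_comm]; rfl).comp hF
    have e' : (fun z => (-(σ * tent (bary σ z i) (bary σ z (i + 1)) (bary σ z (i + 2)))) •
        perp (amN σ i)) = (fun t : ℝ => t • (-σ) • perp (amN σ i)) ∘ F := by
      funext z
      rw [Function.comp_apply, e, smul_smul]
      congr 1
      ring
    rw [e']
    exact ⟨_, h5⟩
  choose L hL using ht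
  refine ⟨L 0 + L 1 + L 2, ?_⟩
  have h := ((hL 0).add (hL 1)).add (hL 2)
  have e : baseField σ = _ := funext fun z => Fin.sum_univ_three _
  rw [e]
  exact h

end HexRhombic

/-! ### Nested triangles: exact strain up to a small area -/

namespace HexRhombic

/-- The closed triangle. -/
def ctri (σ : ℝ) : Set Plane := {z | ∀ j, 0 ≤ bary σ z j}

theorem norm_le_of_mem_ctri {σ : ℝ} (hσ : σ ^ 2 = 1) {z : Plane} (hz : z ∈ ctri σ) : ‖z‖ ≤ 10 := by
  have hs := sum_bary σ z
  have h0 := hz 0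
  have h1 := hz 1
  have h2 := hz 2
  have hn := norm_sq_eq_bary hσ z
  have ht : √3 < 2 := by
    have h7 : √3 ^ 2 = 3 := Real.sq_sqrt (by norm_num)
    nlinarith
  have ht0 : 0 ≤ √3 := by positivity
  rw [Fin.sum_univ_three] at hn
  have hb : bb = 1 + √3 := rfl
  have hi : ∀ j, inner ℝ (amN σ j) z = 1 + 2 * √3 / 3 - bary σ z j := fun j => by
    unfold bary; ring
  rw [hi, hi, hi] at hn
  generalize bary σ z 0 = x at *
  generalize bary σ z 1 = y at *
  generalize bary σ z 2 = w at *
  have hb7 : 1 + 2 * bb ≤ 7 := by linarith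
  have key : ∀ s, 0 ≤ s → s ≤ 7 → (1 + 2 * √3 / 3 - s) ^ 2 ≤ 49 := fun s hs hs' => by nlinarith
  have k1 := key x h0 (by linarith)
  have k2 := key y h1 (by linarith)
  have k3 := key w h2 (by linarith)
  nlinarith [norm_nonneg z]

theorem isCompact_ctri {σ : ℝ} (hσ : σ ^ 2 = 1) : IsCompact (ctri σ) := by
  refine Metric.isCompact_of_isClosed_isBounded ?_
    ((isBounded_iff_forall_norm_le).2 ⟨10, fun z hz => norm_le_of_mem_ctri hσ hz⟩)
  simp only [ctri, ofPred_forall]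
  exact isClosed_iInter fun j => isClosed_le continuous_const (continuous_bary σ j)

theorem tri_subset_ctri (σ : ℝ) : tri σ ⊆ ctri σ := fun _ hz j => (hz j).le

theorem exists_neg_of_notMem_ctri {σ : ℝ} {z : Plane} (hz : z ∉ ctri σ) : ∃ j, bary σ z j < 0 := by
  by_contra! h
  exact hz h

theorem ae_mem_piece {σ : ℝ} (hσ : σ ^ 2 = 1) : ∀ᵐ z : Plane, z ∈ tri σ → ∃ a, z ∈ piece σ a := by
  filter_upwards [ae_bary hσ] with z hz hzt
  exact exists_inPiece (sum_bary σ z) hzt hz.2.1 hz.2.2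

theorem ae_mem_tri {σ : ℝ} (hσ : σ ^ 2 = 1) : ∀ᵐ z : Plane, z ∈ ctri σ → z ∈ tri σ := by
  filter_upwards [ae_bary hσ] with z hz hzt j
  exact lt_of_le_of_ne (hzt j) (hz.1 j).symm

theorem exists_isPatch_baseField {σ : ℝ} (hσ : σ ^ 2 = 1) :
    ∃ V, 0 ≤ V ∧ IsPatch (baseField σ) (gradMat (baseField σ)) V := by
  obtain ⟨L, hL⟩ := exists_lipschitz_baseField σ
  refine ⟨_, ?_, isPatch_of_lipschitz hL fun Φ hΦ => integral_field_le (P := piece σ) (D := 10)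
    (fun a => convex_piece σ a) (fun a => (isOpen_piece σ a).measurableSet) (by norm_num)
    (fun a x hx => norm_le_of_mem_ctri hσ (tri_subset_ctri σ (piece_subset_tri σ a hx)))
    (fun a b hab => disjoint_left.2 fun x hx hx' => hab (InPiece.unique (sum_bary σ x) hx hx'))
    (A := pieceMat σ) (fun a x hx => gradMat_baseField hx) ?_ hΦ⟩
  · positivity
  · filter_upwards [ae_mem_piece hσ, ae_mem_tri hσ] with x hx hx' hxp
    by_contra hne
    have : x ∈ ctri σ := by
      by_contra hn
      exact hne (gradMat_baseField_eq_zero (exists_neg_of_notMem_ctri hn))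
    obtain ⟨a, ha⟩ := hx (hx' this)
    exact hxp a ha

theorem ae_comp_affine {p : Plane → Prop} (hp : ∀ᵐ z, p z) (a : Plane) {r : ℝ} (hr : r ≠ 0) :
    ∀ᵐ z, p (r⁻¹ • (z - a)) := by
  rw [ae_iff] at hp ⊢
  have h1 : {z | ¬p (r⁻¹ • (z - a))} = (fun z => z - a) ⁻¹' ((fun z => r⁻¹ • z) ⁻¹' {z | ¬p z}) := rfl
  rw [h1]
  simp only [sub_eq_add_neg]
  rw [measure_preimage_add_right, Measure.addHaar_preimage_smul _ (inv_ne_zero hr), hp, mul_zero]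

theorem symPart_add (A B : Mat) : symPart (A + B) = symPart A + symPart B := by
  simp only [symPart, Matrix.transpose_add, ← smul_add]
  congr 1
  abel

theorem symPart_zero : symPart (0 : Mat) = 0 := by simp [symPart]

/-- The ratio `2 - √3` between a triangle and its core. -/
noncomputable def lam : ℝ := 2 - √3

theorem lam_pos : 0 < lam := by
  have h7 : √3 ^ 2 = 3 := Real.sq_sqrt (by norm_num)
  unfold lam
  nlinarith [Real.sqrt_nonneg 3]

theorem lam_lt_one : lam < 1 := by
  have h7 : √3 ^ 2 = 3 := Real.sq_sqrt (by norm_num)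
  unfold lam
  nlinarith [Real.sqrt_nonneg 3]

/-- The core, where all coordinates are below b, is thus the triangle multiplied by −`lam`. The
identity rests on (1 + `lam`)(1 + 2√3/3) = b. -/
theorem lam_mul_bary (σ : ℝ) (z : Plane) (j : Fin 3) :
    lam * bary σ ((-lam)⁻¹ • z) j = bb - bary σ z j := by
  have h7 : √3 ^ 2 = 3 := Real.sq_sqrt (by norm_num)
  have h1 := lam_pos.ne'
  simp only [bary, inner_smul_right]
  rw [mul_sub, ← mul_assoc, inv_neg, mul_neg, mul_inv_cancel₀ h1]
  unfold lam bb
  linear_combination (-2 / 3) * h7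

theorem exists_lt_of_inPiece_some {x : Fin 3 → ℝ} (hx : x 0 + x 1 + x 2 = 1 + 2 * bb) {c : Bool}
    {j : Fin 3} (h : InPiece x (some (c, j))) : ∃ i, bb < x i := by
  by_contra! hn
  have hb := one_lt_bb
  have f0 := bb_facts (x 0)
  have f1 := bb_facts (x 1)
  have f2 := bb_facts (x 2)
  have n0 := hn 0
  have n1 := hn 1
  have n2 := hn 2
  have g : ∀ i, 1 ≤ x i → bb ≤ bb * x i := fun i hi => by nlinarith
  have g0 := g 0
  have g1 := g 1
  have g2 := g 2
  clear g
  rcases c with _ | _ <;> simp only [InPiece] at h <;> fin_cases j <;> simp at h <;> grind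

theorem notMem_ctri_of_bb_lt {σ : ℝ} {z : Plane} {i : Fin 3} (h : bb < bary σ z i) :
    (-lam)⁻¹ • z ∉ ctri σ := by
  intro hc
  have h1 := hc i
  have h2 := lam_mul_bary σ z i
  have := lam_pos
  nlinarith

/-- The core has zero strain, so a copy rescaled by −`lam` can be added inside it: strains add, and
the copy vanishes on the other pieces. After m steps the strain fails to be a well only in the m-th
core. Variation scales like length, so the total is a geometric series bounded independently of m.
-/
theorem exists_nested_patch {σ : ℝ} (hσ : σ ^ 2 = 1) : ∃ V, 0 ≤ V ∧ ∀ m : ℕ, ∃ u G,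
    IsPatch u G V ∧ (∀ z ∉ ctri σ, u z = 0 ∧ G z = 0) ∧
    ∀ᵐ z, z ∈ tri σ → symPart (G z) ∈ wells ∨
      (((-lam) ^ m)⁻¹ • z ∈ tri σ ∧ symPart (G z) = 0) := by
  obtain ⟨V₀, hV₀, h0⟩ := exists_isPatch_baseField hσ
  have hl := lam_pos
  have hl1 : 0 < 1 - lam := by linarith [lam_lt_one]
  have hln : -lam ≠ 0 := by linarith
  refine ⟨V₀ / (1 - lam), by positivity, fun m => ?_⟩
  induction m with
  | zero =>
    refine ⟨_, _, IsPatch.zero.mono (by positivity), fun z _ => ⟨rfl, rfl⟩,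
      Eventually.of_forall fun z hz => Or.inr ⟨by simpa using hz, symPart_zero⟩⟩
  | succ m ih =>
    obtain ⟨u, G, hu, hu0, hae⟩ := ih
    refine ⟨_, _, (h0.add (hu.rescale 0 hln)).mono (le_of_eq ?_), fun z hz => ?_, ?_⟩
    -- The fixed point equation V₀ + `lam` · V₀/(1 − `lam`) = V₀/(1 − `lam`).
    · rw [abs_neg, abs_of_pos hl]; field_simp; ring
    · obtain ⟨j, hj⟩ := exists_neg_of_notMem_ctri hz
      have hw : (-lam)⁻¹ • (z - 0) ∉ ctri σ := by
        rw [sub_zero]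
        have hs := sum_bary σ z
        by_contra hc
        have h1 : ∀ i, bary σ z i ≤ bb := fun i => by
          by_contra! hlt
          exact notMem_ctri_of_bb_lt hlt hc
        have h2 := h1 0
        have h3 := h1 1
        have h4 := h1 2
        have := one_lt_bb
        fin_cases j <;> simp at hj <;> linarith
      rw [baseField_eq_zero ⟨j, hj.le⟩, gradMat_baseField_eq_zero ⟨j, hj⟩, (hu0 _ hw).1, (hu0 _ hw).2]
      simp
    · filter_upwards [ae_mem_piece hσ, ae_comp_affine hae 0 hln] with z hz hz' hzt
      rw [sub_zero] at hz' ⊢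
      rw [symPart_add]
      obtain ⟨a, ha⟩ := hz hzt
      rw [gradMat_baseField ha]
      rcases a with _ | ⟨c, j⟩
      · rw [symPart_pieceMat_none, zero_add]
        have hw : (-lam)⁻¹ • z ∈ tri σ := by
          intro i
          have h1 := lam_mul_bary σ z i
          have h2 : bary σ z i < bb := ha i
          have h3 : 0 < lam * bary σ ((-lam)⁻¹ • z) i := by linarith
          exact (mul_pos_iff_of_pos_left hl).1 h3
        rcases hz' hw with h1 | ⟨h1, h2⟩
        · exact Or.inl h1
        · refine Or.inr ⟨?_, h2⟩
          rwa [smul_smul, ← mul_inv, ← pow_succ] at h1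
      · obtain ⟨i, hi⟩ := exists_lt_of_inPiece_some (sum_bary σ z) ha
        rw [(hu0 _ (notMem_ctri_of_bb_lt hi)).2, symPart_zero, add_zero, symPart_pieceMat_some hσ]
        exact Or.inl (mem_wells.2 ⟨j, rfl⟩)

/-- The m-th core has area `lam`^(2m) times that of the triangle, so the bad area becomes
arbitrarily small while the variation bound V does not depend on δ. -/
theorem exists_tri_patch {σ : ℝ} (hσ : σ ^ 2 = 1) : ∃ V, 0 ≤ V ∧ ∀ δ : ℝ, 0 < δ → ∃ u G A,
    IsPatch u G V ∧ (∀ z ∉ ctri σ, u z = 0 ∧ G z = 0) ∧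
    (∀ᵐ z, z ∈ tri σ → symPart (G z) ∈ wells ∨ (z ∈ A ∧ symPart (G z) = 0)) ∧
    volume A ≤ ENNReal.ofReal δ := by
  obtain ⟨V, hV, h⟩ := exists_nested_patch hσ
  refine ⟨V, hV, fun δ hδ => ?_⟩
  have hvol : volume (tri σ) ≠ ⊤ :=
    measure_ne_top_of_subset (tri_subset_ctri σ) (isCompact_ctri hσ).measure_lt_top.ne
  have hl := lam_pos
  have hl1 := lam_lt_one
  set M := (volume (tri σ)).toReal with hM
  have hM0 : 0 ≤ M := ENNReal.toReal_nonneg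
  obtain ⟨m, hm⟩ := exists_pow_lt_of_lt_one (show 0 < δ / (M + 1) by positivity) hl1
  obtain ⟨u, G, h1, h2, h3⟩ := h m
  refine ⟨u, G, _, h1, h2, h3, ?_⟩
  have hne : ((-lam) ^ m)⁻¹ ≠ 0 := inv_ne_zero (pow_ne_zero _ (by linarith))
  change volume ((fun z => ((-lam) ^ m)⁻¹ • z) ⁻¹' tri σ) ≤ _
  rw [Measure.addHaar_preimage_smul _ hne, ← ENNReal.ofReal_toReal hvol,
    ← ENNReal.ofReal_mul (abs_nonneg _)]
  refine ENNReal.ofReal_le_ofReal ?_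
  rw [finrank_euclideanSpace, Fintype.card_fin, inv_pow, inv_inv, ← pow_mul, abs_pow, abs_neg,
    abs_of_pos hl, ← hM]
  rw [lt_div_iff₀ (by positivity)] at hm
  have h4 : lam ^ (m * 2) ≤ lam ^ m := pow_le_pow_of_le_one hl.le hl1.le (by lia)
  have h5 : 0 < lam ^ m := by positivity
  nlinarith

end HexRhombic

namespace HexRhombic

/-! ### Collars of Lipschitz domains -/

theorem volume_graph_collar {x₀ ν : Plane} (hν : ‖ν‖ = 1) {g : ℝ → ℝ} (hg : Continuous g) {r c : ℝ}
    (hr : 0 ≤ r) :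
    volume {y : Plane | tanC x₀ ν y ∈ Ioo (-r) r ∧
      norC x₀ ν y ∈ Ioo (g (tanC x₀ ν y) - c) (g (tanC x₀ ν y))} ≤ ENNReal.ofReal (2 * r * c) := by
  have h1 := volume_coords (x₀ := x₀) hν (regionBetween (fun s => g s - c) g (Ioo (-r) r))
  have h2 := volume_regionBetween_eq_lintegral (μ := (volume : Measure ℝ))
    (f := fun s => g s - c) (g := g) (s := Ioo (-r) r)
    (hg.sub continuous_const).aemeasurable hg.aemeasurable measurableSet_Ioo
  rw [Measure.volume_eq_prod, h2] at h1
  refine le_of_eq (Eq.trans ?_ (h1.trans ?_))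
  · rfl
  · simp only [Pi.sub_apply, sub_sub_cancel, lintegral_const, Measure.restrict_apply_univ,
      Real.volume_Ioo]
    rw [← ENNReal.ofReal_mul' (by linarith)]
    congr 1
    ring

/-- Near x the set is a subgraph of an L-Lipschitz function. A point of Ω within δ of a point on or
above the graph lies at most (L + 1)δ below it, in a region whose area is linear in δ. -/
theorem exists_local_collar {Ω : Set Plane} (hΩ : IsLipschitzDomain Ω) {x : Plane}
    (hx : x ∈ frontier Ω) : ∃ ρ C : ℝ, 0 < ρ ∧ 0 ≤ C ∧ ∀ δ : ℝ, 0 < δ → δ < ρ →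
      volume {z | z ∈ Ω ∧ ∃ p ∈ Metric.ball x ρ, p ∉ Ω ∧ ‖z - p‖ ≤ δ} ≤ ENNReal.ofReal (C * δ) := by
  obtain ⟨ν, hν, L, g, hg, r, hr, hgr⟩ := hΩ.graph x hx
  -- The radius r/2 keeps both points in the chart; L + 2 instead of L + 1 makes the depth
  -- inequality strict.
  refine ⟨r / 2, 2 * r * (L + 2), by positivity, by positivity, fun δ hδ hδr => ?_⟩
  refine (measure_mono ?_).trans ((volume_graph_collar (x₀ := x) hν hg.continuous
    (c := (L + 2) * δ) hr.le).trans (le_of_eq (by ring_nf)))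
  rintro z ⟨hz, p, hp, hpΩ, hzp⟩
  rw [Metric.mem_ball, dist_eq_norm] at hp
  have hzr : ‖z - x‖ < r := by
    calc ‖z - x‖ = ‖(z - p) + (p - x)‖ := by rw [sub_add_sub_cancel]
      _ ≤ _ := norm_add_le _ _
      _ < r := by linarith
  have h1 : norC x ν z < g (tanC x ν z) := (hgr z (by rwa [Metric.mem_ball, dist_eq_norm])).1 hz
  have h2 : g (tanC x ν p) ≤ norC x ν p := by
    by_contra! h
    exact hpΩ ((hgr p (by rw [Metric.mem_ball, dist_eq_norm]; linarith)).2 h)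
  have h3 := abs_le.1 (((abs_norC_sub_le (x₀ := x) hν p z).trans (le_of_eq (norm_sub_rev _ _))).trans hzp)
  have h4 := (abs_tanC_sub_le (x₀ := x) hν z p).trans hzp
  have h5 := hg.dist_le_mul (tanC x ν z) (tanC x ν p)
  rw [Real.dist_eq, Real.dist_eq] at h5
  have h6 : (L : ℝ) * |tanC x ν z - tanC x ν p| ≤ L * δ := by gcongr
  have h7 := (abs_le.1 (h5.trans h6)).2
  have h8 := (abs_tanC_sub_le (x₀ := x) hν z x).trans_lt hzr
  rw [tanC_self, sub_zero] at h8
  exact ⟨abs_lt.1 h8, by linarith [h3.2], h1⟩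

/-- The points of `Ω` at distance at most `δ` from the complement. -/
def collar (Ω : Set Plane) (δ : ℝ) : Set Plane := {z | z ∈ Ω ∧ ∃ y ∉ Ω, ‖z - y‖ ≤ δ}

/-- Finitely many charts cover the compact frontier. For δ beyond the smallest chart radius r, the
area of Ω itself is at most (M/r)δ. -/
theorem exists_volume_collar_le {Ω : Set Plane} (hΩ : IsLipschitzDomain Ω) :
    ∃ C : ℝ, 0 < C ∧ ∀ δ : ℝ, 0 < δ → volume (collar Ω δ) ≤ ENNReal.ofReal (C * δ) := by
  have hvol := measure_ne_top_of_isBounded hΩ.isBounded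
  have hcomp : IsCompact (frontier Ω) :=
    hΩ.isBounded.isCompact_closure.of_isClosed_subset isClosed_frontier frontier_subset_closure
  choose ρ C hρ hC hle using fun x : frontier Ω => exists_local_collar hΩ x.2
  obtain ⟨t, ht⟩ := hcomp.elim_finite_subcover (fun x : frontier Ω => Metric.ball (x : Plane) (ρ x))
    (fun x => Metric.isOpen_ball) fun x hx => mem_iUnion.2 ⟨⟨x, hx⟩, Metric.mem_ball_self (hρ _)⟩
  obtain ⟨r, hr, hrt⟩ : ∃ r > 0, ∀ x ∈ t, r ≤ ρ x := by
    rcases t.eq_empty_or_nonempty with rfl | hne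
    · exact ⟨1, one_pos, by simp⟩
    · obtain ⟨x, hx, hmin⟩ := t.exists_min_image ρ hne
      exact ⟨ρ x, hρ x, hmin⟩
  have hS : 0 ≤ ∑ x ∈ t, C x := Finset.sum_nonneg fun x _ => hC x
  set M := (volume Ω).toReal with hM
  have hM0 : 0 ≤ M := ENNReal.toReal_nonneg
  refine ⟨∑ x ∈ t, C x + M / r + 1, by positivity, fun δ hδ => ?_⟩
  rcases lt_or_ge δ r with hlt | hge
  · have hsub : collar Ω δ ⊆
        ⋃ x ∈ t, {z | z ∈ Ω ∧ ∃ p ∈ Metric.ball (x : Plane) (ρ x), p ∉ Ω ∧ ‖z - p‖ ≤ δ} := by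
      rintro z ⟨hz, y, hy, hzy⟩
      -- The segment from z to the outside point y crosses the frontier, at a point no farther from
      -- z than y is; that point lies in one of the charts.
      obtain ⟨p, hp, hpf⟩ : ∃ p ∈ segment ℝ z y, p ∈ frontier Ω := by
        by_contra! hn
        refine hy ((convex_segment (𝕜 := ℝ) z y).isPreconnected.subset_of_closure_inter_subset
          hΩ.isOpen ⟨z, left_mem_segment ℝ z y, hz⟩ (fun p hp => ?_) (right_mem_segment ℝ z y))
        by_contra hpn
        exact hn p hp.2 (by rw [hΩ.isOpen.frontier_eq]; exact ⟨hp.1, hpn⟩)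
      have hpb : p ∈ Metric.closedBall z δ :=
        (convex_closedBall z δ).segment_subset (Metric.mem_closedBall_self hδ.le)
          (by rwa [Metric.mem_closedBall, dist_comm, dist_eq_norm]) hp
      obtain ⟨x, hx, hpx⟩ := mem_iUnion₂.1 (ht hpf)
      refine mem_iUnion₂.2 ⟨x, hx, hz, p, hpx, ?_, ?_⟩
      · rw [hΩ.isOpen.frontier_eq] at hpf; exact hpf.2
      · rwa [Metric.mem_closedBall, dist_comm, dist_eq_norm] at hpb
    refine (measure_mono hsub).trans ((measure_biUnion_finset_le _ _).trans ?_)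
    refine (Finset.sum_le_sum fun x hx => hle x δ hδ (hlt.trans_le (hrt x hx))).trans ?_
    rw [← ENNReal.ofReal_sum_of_nonneg fun x _ => mul_nonneg (hC x) hδ.le, ← Finset.sum_mul]
    refine ENNReal.ofReal_le_ofReal ?_
    have : 0 ≤ M / r := by positivity
    gcongr
    linarith
  · refine (measure_mono fun z hz => hz.1).trans ?_
    rw [← ENNReal.ofReal_toReal hvol]
    refine ENNReal.ofReal_le_ofReal ?_
    rw [← hM]
    have h1 : M ≤ M / r * δ := by
      rw [div_mul_eq_mul_div, le_div_iff₀ hr]; gcongr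
    nlinarith

end HexRhombic

namespace HexRhombic

/-! ### The unit cell -/

/-- The side length, in the coordinates `lat`, of the unit cell. -/
noncomputable def side : ℝ := 3 + 2 * √3

/-- The lattice coordinates of a point. -/
noncomputable def lat (z : Plane) (l : Fin 2) : ℝ := inner ℝ (amN 1 l.succ) z / side

/-- The point with given lattice coordinates. -/
noncomputable def pt (v : Fin 2 → ℝ) : Plane :=
  (side / 3) • ((2 * v 0 + v 1) • amN 1 1 + (v 0 + 2 * v 1) • amN 1 2)

theorem side_pos : 0 < side := by unfold side; positivity

theorem side_bounds : 6 < side ∧ side < 7 := by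
  have h7 : √3 ^ 2 = 3 := Real.sq_sqrt (by norm_num)
  unfold side
  constructor <;> nlinarith [Real.sqrt_nonneg 3]

theorem lat_pt (v : Fin 2 → ℝ) (l : Fin 2) : lat (pt v) l = v l := by
  have h7 : √3 ^ 2 = 3 := Real.sq_sqrt (by norm_num)
  obtain ⟨⟨h1, h2⟩, ⟨h3, h4⟩, ⟨h5, h6⟩⟩ := amN_coords 1
  rw [lat, div_eq_iff side_pos.ne']
  fin_cases l <;> simp only [pt, inner_plane, PiLp.add_apply, PiLp.smul_apply, smul_eq_mul, h3, h4,
    h5, h6, Fin.succ_zero_eq_one, Fin.zero_eta, Fin.mk_one, Fin.succ_one_eq_two]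
  · linear_combination (side * (v 0 - v 1) / 6) * h7
  · linear_combination (side * (v 1 - v 0) / 6) * h7

theorem lat_sub (z w : Plane) (l : Fin 2) : lat (z - w) l = lat z l - lat w l := by
  rw [lat, lat, lat, inner_sub_right, sub_div]

theorem lat_smul (r : ℝ) (z : Plane) (l : Fin 2) : lat (r • z) l = r * lat z l := by
  rw [lat, lat, inner_smul_right, mul_div_assoc]

theorem continuous_lat (l : Fin 2) : Continuous fun z => lat z l := by
  unfold lat; fun_prop

theorem norm_le_of_abs_lat_le {z : Plane} {M : ℝ} (h : ∀ l, |lat z l| ≤ M) : ‖z‖ ≤ 10 * M := by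
  have hn := norm_sq_eq_bary (σ := 1) (by norm_num) z
  have hM : 0 ≤ M := (abs_nonneg _).trans (h 0)
  have h1 := sq_le_sq' (abs_le.1 (h 0)).1 (abs_le.1 (h 0)).2
  have h2 := sq_le_sq' (abs_le.1 (h 1)).1 (abs_le.1 (h 1)).2
  have e1 : inner ℝ (amN 1 1) z = side * lat z 0 := by
    rw [lat, mul_div_cancel₀ _ side_pos.ne']; rfl
  have e2 : inner ℝ (amN 1 2) z = side * lat z 1 := by
    rw [lat, mul_div_cancel₀ _ side_pos.ne']; rfl
  have e0 : inner ℝ (amN 1 0) z = -(side * lat z 0) - side * lat z 1 := by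
    have := sum_bary 1 z
    simp only [bary, e1, e2, bb] at this
    linarith
  rw [Fin.sum_univ_three, e0, e1, e2] at hn
  have hs : side ^ 2 ≤ 49 := by nlinarith [side_bounds.1, side_bounds.2]
  have hS : lat z 0 ^ 2 + lat z 1 ^ 2 + (lat z 0 + lat z 1) ^ 2 ≤ 6 * M ^ 2 := by
    nlinarith [sq_nonneg (lat z 0 - lat z 1)]
  have h3 : 3 * ‖z‖ ^ 2 ≤ 49 * (6 * M ^ 2) := by
    calc 3 * ‖z‖ ^ 2 = side ^ 2 * (lat z 0 ^ 2 + lat z 1 ^ 2 + (lat z 0 + lat z 1) ^ 2) := by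
          rw [hn]; ring
      _ ≤ _ := by gcongr
  refine abs_le_of_sq_le_sq' ?_ (by positivity) |>.2
  nlinarith [sq_nonneg M]

theorem abs_lat_le (z : Plane) (l : Fin 2) : |lat z l| ≤ ‖z‖ := by
  rw [lat, abs_div, abs_of_pos side_pos, div_le_iff₀ side_pos]
  have h1 := abs_real_inner_le_norm (amN 1 l.succ) z
  have h2 : ‖amN 1 l.succ‖ ≤ 2 := by
    have := norm_sq_amN (σ := 1) (by norm_num) l.succ
    nlinarith [norm_nonneg (amN 1 l.succ)]
  nlinarith [norm_nonneg z, side_bounds.1]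

/-- The closed unit cell. -/
def ucell : Set Plane := {z | ∀ l, 0 ≤ lat z l ∧ lat z l ≤ 1}

/-- The open unit cell. -/
def ocell : Set Plane := {z | ∀ l, 0 < lat z l ∧ lat z l < 1}

theorem isOpen_ocell : IsOpen ocell := by
  simp only [ocell, ofPred_forall]
  exact isOpen_iInter_of_finite fun l => (isOpen_lt continuous_const (continuous_lat l)).inter
    (isOpen_lt (continuous_lat l) continuous_const)

theorem isCompact_ucell : IsCompact ucell := by
  refine Metric.isCompact_of_isClosed_isBounded ?_ ((isBounded_iff_forall_norm_le).2
    ⟨10 * 1, fun z hz => norm_le_of_abs_lat_le fun l => abs_le.2 ⟨by linarith [(hz l).1], (hz l).2⟩⟩)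
  simp only [ucell, ofPred_forall]
  exact isClosed_iInter fun l => (isClosed_le continuous_const (continuous_lat l)).inter
    (isClosed_le (continuous_lat l) continuous_const)

theorem volume_ocell_pos : 0 < volume ocell :=
  isOpen_ocell.measure_pos _ ⟨pt fun _ => 1 / 2, fun l => by rw [lat_pt]; norm_num⟩

theorem volume_ocell_ne_top : volume ocell ≠ ⊤ :=
  measure_ne_top_of_subset (show ocell ⊆ ucell from fun _ hz l => ⟨(hz l).1.le, (hz l).2.le⟩)
    isCompact_ucell.measure_lt_top.ne

theorem bary_eq_lat (z : Plane) : bary 1 z 1 = side * (1 / 3 - lat z 0) ∧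
    bary 1 z 2 = side * (1 / 3 - lat z 1) ∧
    bary 1 z 0 = side * (1 / 3 + lat z 0 + lat z 1) := by
  have e1 : inner ℝ (amN 1 1) z = side * lat z 0 := by
    rw [lat, mul_div_cancel₀ _ side_pos.ne']; rfl
  have e2 : inner ℝ (amN 1 2) z = side * lat z 1 := by
    rw [lat, mul_div_cancel₀ _ side_pos.ne']; rfl
  have h1 : bary 1 z 1 = side * (1 / 3 - lat z 0) := by
    rw [bary, e1]; unfold side; ring
  have h2 : bary 1 z 2 = side * (1 / 3 - lat z 1) := by
    rw [bary, e2]; unfold side; ring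
  refine ⟨h1, h2, ?_⟩
  have := sum_bary 1 z
  rw [h1, h2] at this
  have hs : 1 + 2 * bb = side := by unfold bb side; ring
  linear_combination this + hs

theorem forall_bary_iff (p : ℝ → Prop) (z : Plane) : (∀ j, p (bary 1 z j)) ↔
    p (side * (1 / 3 - lat z 0)) ∧ p (side * (1 / 3 - lat z 1)) ∧
      p (side * (1 / 3 + lat z 0 + lat z 1)) := by
  obtain ⟨h1, h2, h3⟩ := bary_eq_lat z
  rw [← h1, ← h2, ← h3, Fin.forall_fin_succ, Fin.forall_fin_succ, Fin.forall_fin_succ]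
  simp only [Fin.succ_zero_eq_one, IsEmpty.forall_iff, and_true, Fin.succ_one_eq_two]
  tauto

theorem mem_ctri_one_iff (z : Plane) : z ∈ ctri 1 ↔
    lat z 0 ≤ 1 / 3 ∧ lat z 1 ≤ 1 / 3 ∧ 0 ≤ 1 / 3 + lat z 0 + lat z 1 := by
  change (∀ j, 0 ≤ bary 1 z j) ↔ _
  rw [forall_bary_iff (fun t => 0 ≤ t)]
  simp only [mul_nonneg_iff_of_pos_left side_pos, sub_nonneg]

theorem ae_lat_ne (l : Fin 2) (c : ℝ) : ∀ᵐ z : Plane, lat z l ≠ c := by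
  have hn0 : amN 1 l.succ ≠ 0 := fun h => by
    have := norm_sq_amN (σ := 1) (by norm_num) l.succ
    rw [h] at this; simp at this
  filter_upwards [ae_inner_ne hn0 (c * side)] with z hz h
  exact hz ((div_eq_iff side_pos.ne').1 h)

theorem ae_lat_add_ne (c : ℝ) : ∀ᵐ z : Plane, lat z 0 + lat z 1 ≠ c := by
  have hn0 : amN 1 0 ≠ 0 := fun h => by
    have := norm_sq_amN (σ := 1) (by norm_num) 0
    rw [h] at this; simp at this
  filter_upwards [ae_inner_ne hn0 (-(c * side))] with z hz h
  refine hz ?_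
  have := (bary_eq_lat z).2.2
  rw [add_assoc, h] at this
  unfold bary at this
  have h2 : side = 3 + 2 * √3 := rfl
  linarith

theorem volume_preimage_affine (A : Set Plane) (a : Plane) {r : ℝ} (hr : r ≠ 0) :
    volume ((fun z => r⁻¹ • (z - a)) ⁻¹' A) = ENNReal.ofReal (r ^ 2) * volume A := by
  have h1 : (fun z => r⁻¹ • (z - a)) ⁻¹' A = (fun z => z + -a) ⁻¹' ((fun z => r⁻¹ • z) ⁻¹' A) := by
    ext z; simp [sub_eq_add_neg]
  rw [h1, measure_preimage_add_right, Measure.addHaar_preimage_smul _ (inv_ne_zero hr)]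
  rw [finrank_euclideanSpace, Fintype.card_fin, inv_pow, inv_inv, abs_of_nonneg (sq_nonneg r)]

/-- The diagonal where the lattice coordinates sum to 1 cuts the cell into a translate of the
triangle and a point reflection of one. Each carries its own patch, the reflected one through
rescaling by −1. -/
theorem exists_cell_patch : ∃ V, 0 ≤ V ∧ ∀ δ : ℝ, 0 < δ → ∃ u G A, IsPatch u G V ∧
    (∀ z ∉ ucell, u z = 0 ∧ G z = 0) ∧
    (∀ᵐ z, z ∈ ucell → symPart (G z) ∈ wells ∨ (z ∈ A ∧ symPart (G z) = 0)) ∧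
    volume A ≤ ENNReal.ofReal δ := by
  obtain ⟨V, hV, h⟩ := exists_tri_patch (σ := 1) (by norm_num)
  refine ⟨V + V, by positivity, fun δ hδ => ?_⟩
  obtain ⟨u, G, A, h1, h2, h3, h4⟩ := h (δ / 2) (by positivity)
  have hn : (-1 : ℝ) ≠ 0 := by norm_num
  -- The centres of the two halves: in lattice coordinates the triangle is given by both coordinates
  -- at most 1/3 and sum at least −1/3.
  set a := pt fun _ => 2 / 3
  set b := pt fun _ => 1 / 3
  have hla : ∀ z l, lat ((1 : ℝ)⁻¹ • (z - a)) l = lat z l - 2 / 3 := fun z l => by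
    rw [lat_smul, lat_sub, lat_pt]; ring
  have hlb : ∀ z l, lat ((-1 : ℝ)⁻¹ • (z - b)) l = 1 / 3 - lat z l := fun z l => by
    rw [lat_smul, lat_sub, lat_pt]; ring
  have hct : ∀ z, (1 : ℝ)⁻¹ • (z - a) ∈ ctri 1 ↔
      lat z 0 ≤ 1 ∧ lat z 1 ≤ 1 ∧ 1 ≤ lat z 0 + lat z 1 := fun z => by
    rw [mem_ctri_one_iff, hla, hla]
    constructor <;> rintro ⟨k1, k2, k3⟩ <;> refine ⟨?_, ?_, ?_⟩ <;> linarith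
  have hct' : ∀ z, (-1 : ℝ)⁻¹ • (z - b) ∈ ctri 1 ↔
      0 ≤ lat z 0 ∧ 0 ≤ lat z 1 ∧ lat z 0 + lat z 1 ≤ 1 := fun z => by
    rw [mem_ctri_one_iff, hlb, hlb]
    constructor <;> rintro ⟨k1, k2, k3⟩ <;> refine ⟨?_, ?_, ?_⟩ <;> linarith
  refine ⟨_, _, (fun z => (1 : ℝ)⁻¹ • (z - a)) ⁻¹' A ∪ (fun z => (-1 : ℝ)⁻¹ • (z - b)) ⁻¹' A,
    ((h1.rescale a one_ne_zero).add (h1.rescale b hn)).mono (by simp), fun z hz => ?_, ?_, ?_⟩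
  · have k1 : (1 : ℝ)⁻¹ • (z - a) ∉ ctri 1 := fun hc => hz fun l => by
      obtain ⟨c1, c2, c3⟩ := (hct z).1 hc
      fin_cases l <;> constructor <;> simp only [Fin.zero_eta, Fin.mk_one] <;> linarith
    have k2 : (-1 : ℝ)⁻¹ • (z - b) ∉ ctri 1 := fun hc => hz fun l => by
      obtain ⟨c1, c2, c3⟩ := (hct' z).1 hc
      fin_cases l <;> constructor <;> simp only [Fin.zero_eta, Fin.mk_one] <;> linarith
    rw [(h2 _ k1).1, (h2 _ k1).2, (h2 _ k2).1, (h2 _ k2).2]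
    simp
  · filter_upwards [ae_comp_affine h3 a one_ne_zero, ae_comp_affine h3 b hn,
      ae_comp_affine (ae_mem_tri (σ := 1) (by norm_num)) a one_ne_zero,
      ae_comp_affine (ae_mem_tri (σ := 1) (by norm_num)) b hn,
      ae_lat_add_ne 1] with z k1 k2 m1 m2 k3 hz
    have c0 := hz 0
    have c1 := hz 1
    rcases lt_or_gt_of_ne k3 with hlt | hgt
    · rw [(h2 _ fun hc => by linarith [((hct z).1 hc).2.2]).2, zero_add]
      rcases k2 (m2 ((hct' z).2 ⟨c0.1, c1.1, hlt.le⟩)) with k | ⟨k, k'⟩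
      · exact Or.inl k
      · exact Or.inr ⟨Or.inr k, k'⟩
    · rw [(h2 ((-1 : ℝ)⁻¹ • (z - b)) fun hc => by linarith [((hct' z).1 hc).2.2]).2,
        add_zero]
      rcases k1 (m1 ((hct z).2 ⟨c0.2, c1.2, hgt.le⟩)) with k | ⟨k, k'⟩
      · exact Or.inl k
      · exact Or.inr ⟨Or.inl k, k'⟩
  · refine (measure_union_le _ _).trans ?_
    rw [volume_preimage_affine _ _ one_ne_zero, volume_preimage_affine _ _ hn]
    norm_num
    refine (add_le_add h4 h4).trans (le_of_eq ?_)
    rw [← ENNReal.ofReal_add (by positivity) (by positivity), add_halves]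

end HexRhombic

namespace HexRhombic

/-! ### Whitney decompositions -/

/-- The closed dyadic cell of generation `k` with index `p`. -/
def cell (k : ℕ) (p : Fin 2 → ℤ) : Set Plane :=
  {z | ∀ l, (p l : ℝ) ≤ 2 ^ k * lat z l ∧ 2 ^ k * lat z l ≤ p l + 1}

/-- The change of variables which maps the cell with corner `p` to the unit cell. -/
noncomputable def corner (k : ℕ) (p : Fin 2 → ℤ) : Plane := pt fun l => (2⁻¹ : ℝ) ^ k * p l

theorem half_pow_inv (k : ℕ) : ((2⁻¹ : ℝ) ^ k)⁻¹ = 2 ^ k := by rw [inv_pow, inv_inv]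

theorem lat_corner (k : ℕ) (p : Fin 2 → ℤ) (z : Plane) (l : Fin 2) :
    lat (((2⁻¹ : ℝ) ^ k)⁻¹ • (z - corner k p)) l = 2 ^ k * lat z l - p l := by
  rw [lat_smul, lat_sub, corner, lat_pt, half_pow_inv, mul_sub, ← mul_assoc, inv_pow,
    mul_inv_cancel₀ (by positivity), one_mul]

theorem mem_cell_iff (k : ℕ) (p : Fin 2 → ℤ) (z : Plane) :
    z ∈ cell k p ↔ ((2⁻¹ : ℝ) ^ k)⁻¹ • (z - corner k p) ∈ ucell := by
  change (∀ l, _) ↔ ∀ l, _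
  simp only [lat_corner, sub_nonneg, sub_le_iff_le_add']

theorem isClosed_cell (k : ℕ) (p : Fin 2 → ℤ) : IsClosed (cell k p) := by
  simp only [cell, ofPred_forall]
  refine isClosed_iInter fun l => ?_
  have h : Continuous fun z => 2 ^ k * lat z l := (continuous_lat l).const_mul _
  exact (isClosed_le continuous_const h).inter (isClosed_le h continuous_const)

theorem norm_sub_le_of_mem_cell {k : ℕ} {p : Fin 2 → ℤ} {z w : Plane} (hz : z ∈ cell k p)
    (hw : w ∈ cell k p) : ‖z - w‖ ≤ 10 * 2⁻¹ ^ k := by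
  refine norm_le_of_abs_lat_le fun l => ?_
  have h2 : (0 : ℝ) < 2 ^ k := by positivity
  rw [lat_sub, inv_pow, ← one_div, le_div_iff₀ h2, ← abs_of_pos h2, ← abs_mul]
  have h3 := hz l
  have h4 := hw l
  exact abs_le.2 ⟨by linarith, by linarith⟩

theorem isCompact_cell (k : ℕ) (p : Fin 2 → ℤ) : IsCompact (cell k p) := by
  refine Metric.isCompact_of_isClosed_isBounded (isClosed_cell k p)
    (Metric.isBounded_iff.2 ⟨10 * 2⁻¹ ^ k, fun z hz w hw => ?_⟩)
  rw [dist_eq_norm]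
  exact norm_sub_le_of_mem_cell hz hw

theorem corner_mem_cell (k : ℕ) (p : Fin 2 → ℤ) : corner k p ∈ cell k p := by
  rw [mem_cell_iff, sub_self, smul_zero]
  intro l
  simp [lat]

theorem cell_succ_subset (k : ℕ) (p : Fin 2 → ℤ) : cell (k + 1) p ⊆ cell k fun l => p l / 2 := by
  intro z hz l
  have h1 := hz l
  have h2 : (2 : ℤ) * (p l / 2) ≤ p l := Int.mul_ediv_self_le (by norm_num)
  have h3 : p l + 1 ≤ 2 * (p l / 2) + 2 := by lia
  have h4 : (2 : ℝ) * (p l / 2 : ℤ) ≤ p l := by exact_mod_cast h2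
  have h5 : (p l : ℝ) + 1 ≤ 2 * (p l / 2 : ℤ) + 2 := by exact_mod_cast h3
  rw [pow_succ] at h1
  constructor <;> linarith

/-- The index of a cell of generation `k` which contains a point. -/
noncomputable def index (k : ℕ) (z : Plane) (l : Fin 2) : ℤ := ⌊2 ^ k * lat z l⌋

theorem mem_cell_index (k : ℕ) (z : Plane) : z ∈ cell k (index k z) := fun _ =>
  ⟨Int.floor_le _, (Int.lt_floor_add_one _).le⟩

theorem index_succ (k : ℕ) (z : Plane) : (fun l => index (k + 1) z l / 2) = index k z := by
  funext l
  unfold index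
  have h := Int.floor_div_natCast (2 ^ (k + 1) * lat z l) 2
  have h2 : (2 : ℝ) ^ (k + 1) * lat z l / ((2 : ℕ) : ℝ) = 2 ^ k * lat z l := by
    push_cast; rw [pow_succ]; ring
  rw [h2] at h
  rw [h]; rfl

theorem cell_index_anti {k m : ℕ} (h : k ≤ m) (z : Plane) :
    cell m (index m z) ⊆ cell k (index k z) := by
  induction m, h using Nat.le_induction with
  | base => exact Subset.rfl
  | succ m _ ih => exact (cell_succ_subset m _).trans (by rw [index_succ]; exact ih)

theorem eq_index {k : ℕ} {p : Fin 2 → ℤ} {z : Plane} (hz : ∀ (l : Fin 2) (n : ℤ), 2 ^ k * lat z l ≠ n)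
    (h : z ∈ cell k p) : p = index k z := by
  funext l
  refine (Int.floor_eq_iff.2 ⟨(h l).1, lt_of_le_of_ne (h l).2 ?_⟩).symm
  have := hz l (p l + 1)
  push_cast at this
  exact this

theorem ae_lat_notMem_int : ∀ᵐ z : Plane, ∀ (k : ℕ) (l : Fin 2) (n : ℤ), 2 ^ k * lat z l ≠ n := by
  refine ae_all_iff.2 fun k => ae_all_iff.2 fun l => ae_all_iff.2 fun n => ?_
  filter_upwards [ae_lat_ne l ((2 ^ k)⁻¹ * n)] with z hz h
  exact hz (by rw [← h, inv_mul_cancel_left₀ (by positivity)])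

/-- The indices of the cells of generation `k` in the Whitney decomposition of `Ω`. -/
def whitney (Ω : Set Plane) : ℕ → Set (Fin 2 → ℤ)
  | 0 => {p | cell 0 p ⊆ Ω}
  | k + 1 => {p | cell (k + 1) p ⊆ Ω ∧ ¬ cell k (fun l => p l / 2) ⊆ Ω}

theorem cell_subset_of_mem_whitney {Ω : Set Plane} {k : ℕ} {p : Fin 2 → ℤ} (h : p ∈ whitney Ω k) :
    cell k p ⊆ Ω := by
  cases k with
  | zero => exact h
  | succ k => exact h.1

theorem finite_whitney {Ω : Set Plane} (hb : Bornology.IsBounded Ω) (k : ℕ) : (whitney Ω k).Finite := by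
  obtain ⟨R, hR⟩ := isBounded_iff_forall_norm_le.1 hb
  refine Set.Finite.subset (Set.Finite.pi' fun _ : Fin 2 => Set.finite_Icc (-⌈2 ^ k * R⌉) ⌈2 ^ k * R⌉)
    fun p hp l => ?_
  have h1 := (abs_lat_le (corner k p) l).trans
    (hR _ (cell_subset_of_mem_whitney hp (corner_mem_cell k p)))
  have h2 : lat (corner k p) l = (2 ^ k)⁻¹ * p l := by rw [corner, lat_pt, inv_pow]
  rw [h2, abs_mul, abs_of_pos (by positivity), inv_mul_le_iff₀ (by positivity)] at h1
  have h3 := abs_le.1 (h1.trans (Int.le_ceil _))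
  constructor
  · exact_mod_cast h3.1
  · exact_mod_cast h3.2

theorem disjoint_cells (k : ℕ) {p q : Fin 2 → ℤ} (h : p ≠ q) :
    Disjoint ((fun z => ((2⁻¹ : ℝ) ^ k)⁻¹ • (z - corner k p)) ⁻¹' ocell)
      ((fun z => ((2⁻¹ : ℝ) ^ k)⁻¹ • (z - corner k q)) ⁻¹' ocell) := by
  refine disjoint_left.2 fun z hz hz' => h (funext fun l => ?_)
  have h1 := hz l
  have h2 := hz' l
  rw [lat_corner] at h1 h2
  have h3 : (p l : ℝ) < q l + 1 := by linarith
  have h4 : (q l : ℝ) < p l + 1 := by linarith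
  have h5 : p l < q l + 1 := by exact_mod_cast h3
  have h6 : q l < p l + 1 := by exact_mod_cast h4
  lia

/-- A Whitney cell of generation k + 1 has a parent, of diameter at most 10 · 2^(-k), that leaves Ω;
so it lies in a collar of area of order 2^(-k). The open cells are disjoint with area of order
4^(-k), which leaves room for at most C 2^k of them. -/
theorem exists_card_whitney_le {Ω : Set Plane} (hΩ : IsLipschitzDomain Ω) : ∃ C : ℝ, 0 < C ∧
    ∀ k, ((finite_whitney hΩ.isBounded k).toFinset.card : ℝ) ≤ C * 2 ^ k := by
  obtain ⟨C, hC, hle⟩ := exists_volume_collar_le hΩ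
  have hv : 0 < (volume ocell).toReal := ENNReal.toReal_pos volume_ocell_pos.ne' volume_ocell_ne_top
  set v := (volume ocell).toReal with hvdef
  set N := fun k => (finite_whitney hΩ.isBounded k).toFinset
  have key : ∀ k, ((N (k + 1)).card : ℝ) * v ≤ 40 * C * 2 ^ k := fun k => by
    have hr : (2⁻¹ : ℝ) ^ (k + 1) ≠ 0 := by positivity
    have hsub : (⋃ p ∈ N (k + 1), (fun z => ((2⁻¹ : ℝ) ^ (k + 1))⁻¹ • (z - corner (k + 1) p)) ⁻¹' ocell) ⊆
        collar Ω (10 * 2⁻¹ ^ k) := by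
      refine iUnion₂_subset fun p hp z hz => ?_
      have hp : p ∈ whitney Ω (k + 1) := (Set.Finite.mem_toFinset _).1 hp
      have hzc : z ∈ cell (k + 1) p := (mem_cell_iff _ _ _).2 fun l => ⟨(hz l).1.le, (hz l).2.le⟩
      obtain ⟨y, hy, hyn⟩ := not_subset.1 hp.2
      exact ⟨hp.1 hzc, y, hyn, norm_sub_le_of_mem_cell (cell_succ_subset k p hzc) hy⟩
    have h1 := (measure_mono hsub).trans (hle _ (by positivity))
    rw [measure_biUnion_finset (fun p _ q _ hpq => disjoint_cells (k + 1) hpq) fun p _ =>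
      (isOpen_ocell.preimage (by fun_prop)).measurableSet] at h1
    simp only [volume_preimage_affine _ _ hr, Finset.sum_const, nsmul_eq_mul] at h1
    rw [← ENNReal.ofReal_toReal volume_ocell_ne_top, ← hvdef, ← ENNReal.ofReal_natCast,
      ← ENNReal.ofReal_mul (by positivity), ← ENNReal.ofReal_mul (by positivity),
      ENNReal.ofReal_le_ofReal_iff (by positivity)] at h1
    have h2 : ((2⁻¹ : ℝ) ^ (k + 1)) ^ 2 = (4 * 2 ^ k * 2 ^ k)⁻¹ := by
      rw [inv_pow, inv_pow]; congr 1; ring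
    have h3 : (2⁻¹ : ℝ) ^ k = (2 ^ k)⁻¹ := inv_pow _ _
    have h4 : (0 : ℝ) < 2 ^ k := by positivity
    rw [h2, h3] at h1
    generalize (2 : ℝ) ^ k = x at *
    field_simp at h1
    linarith
  refine ⟨(N 0).card + 40 * C / v + 1, by positivity, fun k => ?_⟩
  change ((N k).card : ℝ) ≤ _
  have hcv : 0 < 40 * C / v := by positivity
  cases k with
  | zero => simp only [pow_zero, mul_one]; linarith
  | succ k =>
    have h1 := key k
    rw [← le_div_iff₀ hv] at h1
    have h4 : (0 : ℝ) < 2 ^ k := by positivity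
    have h5 : 40 * C * 2 ^ k / v = 40 * C / v * 2 ^ k := by ring
    have h6 : (0 : ℝ) ≤ (N 0).card := Nat.cast_nonneg _
    rw [h5] at h1
    rw [pow_succ]
    nlinarith [mul_pos hcv h4, mul_nonneg h6 h4.le]

end HexRhombic

/-! ### The logarithmic upper bound -/

namespace HexRhombic

theorem exists_nat_two_pow {ε : ℝ} (hε : 0 < ε) :
    ∃ K : ℕ, (2⁻¹ : ℝ) ^ K ≤ ε ∧ (K : ℝ) ≤ 2 * |Real.log ε| + 1 := by
  refine ⟨⌈2 * |Real.log ε|⌉₊, ?_, (Nat.ceil_lt_add_one (by positivity)).le⟩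
  have h1 : |Real.log ε| ≤ ⌈2 * |Real.log ε|⌉₊ * Real.log 2 := by
    have h2 := Nat.le_ceil (2 * |Real.log ε|)
    have h3 := Real.log_two_gt_d9
    have h4 := abs_nonneg (Real.log ε)
    have h5 : (⌈2 * |Real.log ε|⌉₊ : ℝ) * (1 / 2) ≤ ⌈2 * |Real.log ε|⌉₊ * Real.log 2 := by
      gcongr; linarith
    linarith
  rw [← Real.log_le_log_iff (by positivity) hε, Real.log_pow, Real.log_inv]
  have := neg_abs_le (Real.log ε)
  linarith

/-- A cell of generation k costs variation 2^(-k) V and there are at most C 2^k of them, so each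
generation costs at most C V and K + 1 generations cost C V (K + 1). Points not covered up to
generation K are within 10 · 2^(-K) of the complement. -/
theorem exists_whitney_patch {Ω : Set Plane} (hΩ : IsLipschitzDomain Ω) : ∃ C : ℝ, 0 < C ∧
    ∀ (K : ℕ) (δ : ℝ), 0 < δ → ∃ u G A D, IsPatch u G (C * (K + 1)) ∧ IsCompact D ∧ D ⊆ Ω ∧
      (∀ z ∉ D, u z = 0) ∧
      (∀ᵐ z, z ∈ Ω → symPart (G z) ∈ wells ∨
        (z ∈ A ∪ collar Ω (10 * 2⁻¹ ^ K) ∧ symPart (G z) = 0)) ∧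
      volume A ≤ ENNReal.ofReal δ := by
  classical
  obtain ⟨C, hC, hcard⟩ := exists_card_whitney_le hΩ
  obtain ⟨V, hV, hcell⟩ := exists_cell_patch
  refine ⟨C * (V + 1), by positivity, fun K δ hδ => ?_⟩
  set N := fun k => (finite_whitney hΩ.isBounded k).toFinset with hN
  have hmem : ∀ k p, p ∈ N k ↔ p ∈ whitney Ω k := fun k p => Set.Finite.mem_toFinset _
  set I : Finset (Σ _ : ℕ, Fin 2 → ℤ) := (Finset.range (K + 1)).sigma N with hI
  have hmemI : ∀ q : Σ _ : ℕ, Fin 2 → ℤ, q ∈ I ↔ q.1 < K + 1 ∧ q.2 ∈ whitney Ω q.1 := fun q => by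
    rw [hI, Finset.mem_sigma, Finset.mem_range, hmem]
  -- One unit-cell patch serves all cells. The bad areas only shrink under rescaling, so dividing δ
  -- by the number of cells bounds their sum.
  obtain ⟨u, G, A, h1, h2, h3, h4⟩ := hcell (δ / (I.card + 1)) (by positivity)
  have hr : ∀ k : ℕ, (2⁻¹ : ℝ) ^ k ≠ 0 := fun k => by positivity
  have hsum := IsPatch.sum I (fun q _ => h1.rescale (corner q.1 q.2) (hr q.1))
  have hzero : ∀ (q : Σ _ : ℕ, Fin 2 → ℤ) z, z ∉ cell q.1 q.2 →
      u (((2⁻¹ : ℝ) ^ q.1)⁻¹ • (z - corner q.1 q.2)) = 0 ∧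
      G (((2⁻¹ : ℝ) ^ q.1)⁻¹ • (z - corner q.1 q.2)) = 0 := fun q z hz =>
    h2 _ fun hc => hz ((mem_cell_iff _ _ _).2 hc)
  refine ⟨_, _, ⋃ q ∈ I, (fun z => ((2⁻¹ : ℝ) ^ q.1)⁻¹ • (z - corner q.1 q.2)) ⁻¹' A,
    ⋃ q ∈ I, cell q.1 q.2, hsum.mono ?_, I.isCompact_biUnion fun q _ => isCompact_cell _ _,
    iUnion₂_subset fun q hq => cell_subset_of_mem_whitney ((hmemI q).1 hq).2, fun z hz => ?_, ?_, ?_⟩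
  · rw [Finset.sum_sigma]
    have hk : ∀ k ∈ Finset.range (K + 1), ∑ p ∈ N k, |(2⁻¹ : ℝ) ^ k| * V ≤ C * V := fun k _ => by
      rw [Finset.sum_const, nsmul_eq_mul, abs_of_pos (by positivity)]
      have h5 : (2 : ℝ) ^ k * 2⁻¹ ^ k = 1 := by
        rw [← mul_pow, mul_inv_cancel₀ two_ne_zero, one_pow]
      calc ((N k).card : ℝ) * (2⁻¹ ^ k * V) ≤ C * 2 ^ k * (2⁻¹ ^ k * V) := by
            gcongr; exact hcard k
        _ = C * V * (2 ^ k * 2⁻¹ ^ k) := by ring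
        _ = C * V := by rw [h5, mul_one]
    refine (Finset.sum_le_sum hk).trans ?_
    rw [Finset.sum_const, Finset.card_range, nsmul_eq_mul]
    push_cast
    have : 0 ≤ C * ((K : ℝ) + 1) := by positivity
    nlinarith
  · refine Finset.sum_eq_zero fun q hq => ?_
    rw [(hzero q z fun hc => hz (mem_iUnion₂.2 ⟨q, hq, hc⟩)).1, smul_zero]
  · have hae : ∀ᵐ z, ∀ q : Σ _ : ℕ, Fin 2 → ℤ,
        ((2⁻¹ : ℝ) ^ q.1)⁻¹ • (z - corner q.1 q.2) ∈ ucell →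
        symPart (G (((2⁻¹ : ℝ) ^ q.1)⁻¹ • (z - corner q.1 q.2))) ∈ wells ∨
        (((2⁻¹ : ℝ) ^ q.1)⁻¹ • (z - corner q.1 q.2) ∈ A ∧
          symPart (G (((2⁻¹ : ℝ) ^ q.1)⁻¹ • (z - corner q.1 q.2))) = 0) :=
      ae_all_iff.2 fun q => ae_comp_affine h3 (corner q.1 q.2) (hr q.1)
    filter_upwards [hae, ae_lat_notMem_int] with z hz hint hzΩ
    -- For almost every z the cell of each generation containing it is unique. The first one
    -- contained in Ω is its Whitney cell.
    by_cases hex : ∃ k, k ≤ K ∧ cell k (index k z) ⊆ Ω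
    · have hm := Nat.find_spec hex
      have hmin := fun k (hk : k < Nat.find hex) => Nat.find_min hex hk
      set m := Nat.find hex
      have hmI : (⟨m, index m z⟩ : Σ _ : ℕ, Fin 2 → ℤ) ∈ I := by
        refine (hmemI _).2 ⟨Nat.lt_succ_of_le hm.1, ?_⟩
        rcases hm0 : m with _ | k
        · rw [hm0] at hm; exact hm.2
        · rw [hm0] at hm
          refine ⟨hm.2, fun hc => hmin k (by lia) ⟨by lia, ?_⟩⟩
          simpa only [index_succ] using hc
      -- A Whitney cell of an earlier generation contradicts minimality; one of a later generation
      -- has a parent inside the first cell, hence inside Ω, contrary to the definition.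
      have huniq : ∀ q ∈ I, q ≠ ⟨m, index m z⟩ → z ∉ cell q.1 q.2 := by
        rintro ⟨k, p⟩ hq hne hc
        obtain rfl : p = index k z := eq_index (hint k) hc
        have hq' := (hmemI _).1 hq
        have hkm : m ≤ k := by
          by_contra! hlt
          exact hmin k hlt ⟨Nat.le_of_lt_succ hq'.1, cell_subset_of_mem_whitney hq'.2⟩
        rcases hkm.eq_or_lt with rfl | hlt
        · exact hne rfl
        obtain ⟨j, rfl⟩ : ∃ j, k = j + 1 := ⟨k - 1, by lia⟩
        refine hq'.2.2 ?_
        simp only [index_succ]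
        exact (cell_index_anti (Nat.le_of_lt_succ hlt) z).trans hm.2
      rw [Finset.sum_eq_single_of_mem _ hmI fun q hq hne => (hzero q z (huniq q hq hne)).2]
      rcases hz ⟨m, index m z⟩ ((mem_cell_iff _ _ _).1 (mem_cell_index m z)) with h | ⟨h, h'⟩
      · exact Or.inl h
      · exact Or.inr ⟨Or.inl (mem_iUnion₂.2 ⟨_, hmI, h⟩), h'⟩
    · push Not at hex
      obtain ⟨y, hy, hyn⟩ := not_subset.1 (hex K le_rfl)
      refine Or.inr ⟨Or.inr ⟨hzΩ, y, hyn, norm_sub_le_of_mem_cell (mem_cell_index K z) hy⟩, ?_⟩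
      rw [Finset.sum_eq_zero, symPart_zero]
      rintro ⟨k, p⟩ hq
      refine (hzero _ z fun hc => ?_).2
      obtain rfl : p = index k z := eq_index (hint k) hc
      have hq' := (hmemI _).1 hq
      exact hex k (Nat.le_of_lt_succ hq'.1) (cell_subset_of_mem_whitney hq'.2)
  · refine (measure_biUnion_finset_le _ _).trans ?_
    have hA : ∀ q ∈ I, volume ((fun z => ((2⁻¹ : ℝ) ^ q.1)⁻¹ • (z - corner q.1 q.2)) ⁻¹' A) ≤
        ENNReal.ofReal (δ / (I.card + 1)) := fun q _ => by
      rw [volume_preimage_affine _ _ (hr q.1)]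
      refine (mul_le_mul' (b := 1) ?_ h4).trans (le_of_eq (one_mul _))
      rw [ENNReal.ofReal_le_one, ← pow_mul]
      exact pow_le_one₀ (by norm_num) (by norm_num)
    refine (Finset.sum_le_sum hA).trans ?_
    rw [Finset.sum_const, nsmul_eq_mul, ← ENNReal.ofReal_natCast, ← ENNReal.ofReal_mul (by positivity)]
    refine ENNReal.ofReal_le_ofReal ?_
    rw [mul_div_assoc', div_le_iff₀ (by positivity)]
    nlinarith

/-- The number K of generations is chosen with 2^(-K) ≤ ε and K ≤ 2|log ε| + 1, and the bad area
inside the cells is taken at most ε; the collar then also costs order ε. When ε(|log ε| + 1) exceeds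
1 the zero field is the competitor. -/
theorem minEnergy_le_log {Ω : Set Plane} (hΩ : IsLipschitzDomain Ω) (Γ : Set Plane) :
    ∃ C : ℝ, 0 < C ∧ ∀ ε : ℝ, 0 < ε →
      minEnergy Ω Γ ε ≤ ENNReal.ofReal (C * min 1 (ε * (|Real.log ε| + 1))) := by
  have hvol := measure_ne_top_of_isBounded hΩ.isBounded
  obtain ⟨C₁, hC₁, h1⟩ := exists_volume_collar_le hΩ
  obtain ⟨C₂, hC₂, h2⟩ := exists_whitney_patch hΩ
  set M := (volume Ω).toReal with hM
  have hM0 : 0 ≤ M := ENNReal.toReal_nonneg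
  refine ⟨4 * M + (4 + 40 * C₁ + 2 * C₂), by positivity, fun ε hε => ?_⟩
  obtain ⟨K, hK, hK'⟩ := exists_nat_two_pow hε
  have hL := abs_nonneg (Real.log ε)
  obtain ⟨u, G, A, D, k1, k2, k3, k4, k5, k6⟩ := h2 K ε hε
  have hle := k1.minEnergy_le (Γ := Γ) k2 hΩ.isOpen hvol k3 k4 k5 hε
  have hbad : volume ((A ∪ collar Ω (10 * 2⁻¹ ^ K)) ∩ Ω) ≤ ENNReal.ofReal (ε + 10 * C₁ * ε) := by
    refine (measure_mono inter_subset_left).trans ((measure_union_le _ _).trans ?_)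
    refine (add_le_add k6 (h1 _ (by positivity))).trans ?_
    rw [← ENNReal.ofReal_add hε.le (by positivity)]
    refine ENNReal.ofReal_le_ofReal ?_
    have : C₁ * (10 * 2⁻¹ ^ K) ≤ C₁ * (10 * ε) := by gcongr
    linarith
  rcases le_total 1 (ε * (|Real.log ε| + 1)) with h | h
  · rw [min_eq_left h, mul_one]
    refine (minEnergy_le_volume hΩ.isOpen hvol Γ hε).trans ?_
    rw [← ENNReal.ofReal_toReal hvol, ← hM, show (4 : ℝ≥0∞) = ENNReal.ofReal 4 by norm_num,
      ← ENNReal.ofReal_mul (by norm_num)]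
    exact ENNReal.ofReal_le_ofReal (by linarith)
  · rw [min_eq_right h]
    refine hle.trans ((add_le_add_left (mul_le_mul_right hbad 4) _).trans ?_)
    rw [show (4 : ℝ≥0∞) = ENNReal.ofReal 4 by norm_num, ← ENNReal.ofReal_mul (by norm_num),
      ← ENNReal.ofReal_add (by positivity) (by positivity)]
    refine ENNReal.ofReal_le_ofReal ?_
    have e1 : ε * (C₂ * (K + 1)) ≤ ε * (C₂ * (2 * |Real.log ε| + 1 + 1)) := by gcongr
    have e2 : 0 ≤ ε * |Real.log ε| := by positivity
    have e3 : 0 ≤ C₁ * (ε * |Real.log ε|) := by positivity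
    have e4 : 0 ≤ M * (ε * (|Real.log ε| + 1)) := by positivity
    nlinarith

end HexRhombic

namespace HexRhombic

/-! ### Triangles as polygonal domains -/

theorem amN_add_one (σ : ℝ) (i : Fin 3) :
    amN σ (i + 1) = (-(1 / 2) : ℝ) • amN σ i + (√3 / 2) • perp (amN σ i) := by
  have h7 : √3 * √3 = 3 := Real.mul_self_sqrt (by norm_num)
  obtain ⟨⟨h1, h2⟩, ⟨h3, h4⟩, ⟨h5, h6⟩⟩ := amN_coords σ
  ext k
  fin_cases k <;> fin_cases i <;> simp [h1, h2, h3, h4, h5, h6] <;> grind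

theorem amN_add_two (σ : ℝ) (i : Fin 3) :
    amN σ (i + 2) = (-(1 / 2) : ℝ) • amN σ i - (√3 / 2) • perp (amN σ i) := by
  have h7 : √3 * √3 = 3 := Real.mul_self_sqrt (by norm_num)
  obtain ⟨⟨h1, h2⟩, ⟨h3, h4⟩, ⟨h5, h6⟩⟩ := amN_coords σ
  ext k
  fin_cases k <;> fin_cases i <;> simp [h1, h2, h3, h4, h5, h6] <;> grind

theorem norm_amN {σ : ℝ} (hσ : σ ^ 2 = 1) (i : Fin 3) : ‖amN σ i‖ = √2 := by
  rw [← norm_sq_amN hσ i, Real.sqrt_sq (norm_nonneg _)]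

theorem bary_eq_sub (σ : ℝ) (x y : Plane) (j : Fin 3) :
    bary σ y j = bary σ x j - inner ℝ (amN σ j) (y - x) := by
  rw [inner_sub_right]; unfold bary; ring

theorem forall_iff_add (i : Fin 3) (p : Fin 3 → Prop) :
    (∀ j, p j) ↔ p i ∧ p (i + 1) ∧ p (i + 2) := by
  fin_cases i <;> simp [Fin.forall_fin_succ] <;> tauto

theorem sum_bary' (σ : ℝ) (z : Plane) (i : Fin 3) :
    bary σ z i + bary σ z (i + 1) + bary σ z (i + 2) = 1 + 2 * bb := by
  rw [← sum_bary σ z]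
  fin_cases i <;> simp <;> ring

theorem zero_mem_tri (σ : ℝ) : (0 : Plane) ∈ tri σ := fun j => by
  rw [bary, inner_zero_right, sub_zero]; positivity

theorem bary_smul (σ t : ℝ) (z : Plane) (j : Fin 3) :
    bary σ (t • z) j = (1 - t) * (1 + 2 * √3 / 3) + t * bary σ z j := by
  rw [bary, bary, inner_smul_right]; ring

theorem closure_tri (σ : ℝ) : closure (tri σ) = ctri σ := by
  refine Subset.antisymm (closure_minimal (tri_subset_ctri σ) ?_) fun z hz => ?_
  · simp only [ctri, ofPred_forall]
    exact isClosed_iInter fun j => isClosed_le continuous_const (continuous_bary σ j)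
  · have h1 : Tendsto (fun t : ℝ => t • z) (𝓝[<] 1) (𝓝 z) := by
      have : Tendsto (fun t : ℝ => t • z) (𝓝 1) (𝓝 ((1 : ℝ) • z)) :=
        (continuous_id.smul continuous_const).tendsto 1
      rw [one_smul] at this
      exact this.mono_left nhdsWithin_le_nhds
    refine mem_closure_of_tendsto h1 ?_
    filter_upwards [Ioo_mem_nhdsLT (zero_lt_one (α := ℝ))] with t ht j
    rw [bary_smul]
    have h2 := hz j
    have h3 : 0 < (1 - t) * (1 + 2 * √3 / 3) := mul_pos (by linarith [ht.2]) (by positivity)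
    nlinarith [mul_nonneg ht.1.le h2]

theorem mem_frontier_tri {σ : ℝ} {x : Plane} :
    x ∈ frontier (tri σ) ↔ x ∈ ctri σ ∧ ∃ i, bary σ x i = 0 := by
  rw [(isOpen_tri σ).frontier_eq, closure_tri]
  refine and_congr_right fun h => ⟨fun hn => ?_, fun ⟨i, hi⟩ hc => (hc i).ne' hi⟩
  by_contra! hne
  exact hn fun j => lt_of_le_of_ne (h j) (hne j).symm

theorem exists_ball_bary_pos {σ : ℝ} {x : Plane} : ∃ r > 0, ∀ y ∈ Metric.ball x r,
    ∀ i, 0 < bary σ x i → 0 < bary σ y i := by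
  have h : ∀ᶠ y in 𝓝 x, ∀ i, 0 < bary σ x i → 0 < bary σ y i :=
    eventually_all.2 fun i => by
      by_cases hi : 0 < bary σ x i
      · filter_upwards [(continuous_bary σ i).continuousAt.eventually (lt_mem_nhds hi)] with y hy _
          using hy
      · exact Eventually.of_forall fun y h => absurd h hi
  exact Metric.eventually_nhds_iff_ball.1 h

theorem exists_ball_mem_tri_iff {σ : ℝ} (hσ : σ ^ 2 = 1) {x : Plane} {i : Fin 3}
    (h0 : bary σ x i = 0) (h1 : 0 < bary σ x (i + 1)) (h2 : 0 < bary σ x (i + 2)) :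
    ∃ r > 0, ∀ y ∈ Metric.ball x r,
      (y ∈ tri σ ↔ inner ℝ (y - x) (‖amN σ i‖⁻¹ • amN σ i) < 0) := by
  have hn : 0 < ‖amN σ i‖ := by rw [norm_amN hσ]; positivity
  obtain ⟨r, hr, hb⟩ := exists_ball_bary_pos (σ := σ) (x := x)
  refine ⟨r, hr, fun y hy => ?_⟩
  change (∀ j, 0 < bary σ y j) ↔ _
  rw [forall_iff_add i, and_iff_left ⟨hb y hy _ h1, hb y hy _ h2⟩, bary_eq_sub σ x y, h0, zero_sub,
    neg_pos, inner_smul_right, real_inner_comm, ← not_le, ← not_le,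
    mul_nonneg_iff_of_pos_left (inv_pos.2 hn)]

theorem norm_normalize_amN {σ : ℝ} (hσ : σ ^ 2 = 1) (i : Fin 3) :
    ‖(‖amN σ i‖⁻¹ • amN σ i)‖ = 1 := by
  have hn : 0 < ‖amN σ i‖ := by rw [norm_amN hσ]; positivity
  rw [norm_smul, norm_inv, norm_norm, inv_mul_cancel₀ hn.ne']

/-- At the vertex opposite side i the triangle is a sector of angle π/3, symmetric about n_i. In the
frame with outer direction −n_i it is the region below −√3 |t|. -/
theorem exists_graph_tri_of_vertex {σ : ℝ} (hσ : σ ^ 2 = 1) {x : Plane} {i : Fin 3}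
    (h0 : 0 < bary σ x i) (h1 : bary σ x (i + 1) = 0) (h2 : bary σ x (i + 2) = 0) :
    ∃ ν : Plane, ‖ν‖ = 1 ∧ ∃ (L : NNReal) (g : ℝ → ℝ), LipschitzWith L g ∧
    ∃ r > 0, ∀ y ∈ Metric.ball x r,
      (y ∈ tri σ ↔ inner ℝ (y - x) ν < g (inner ℝ (y - x) (perp ν))) := by
  have hn : 0 < ‖amN σ i‖ := by rw [norm_amN hσ]; positivity
  obtain ⟨r, hr, hb⟩ := exists_ball_bary_pos (σ := σ) (x := x)
  have hlip : LipschitzWith 2 fun t : ℝ => -(√3 * |t|) := by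
    refine LipschitzWith.of_dist_le_mul fun s t => ?_
    have h3 : √3 ≤ 2 := by rw [Real.sqrt_le_left (by norm_num)]; norm_num
    have h4 := abs_abs_sub_abs_le_abs_sub t s
    rw [Real.dist_eq, Real.dist_eq, show -(√3 * |s|) - -(√3 * |t|) = √3 * (|t| - |s|) by ring, abs_mul,
      abs_of_nonneg (Real.sqrt_nonneg 3), abs_sub_comm s t]
    have h5 : ((2 : NNReal) : ℝ) = 2 := rfl
    rw [h5]
    gcongr
  refine ⟨-(‖amN σ i‖⁻¹ • amN σ i), by rw [norm_neg, norm_normalize_amN hσ], 2, _, hlip, r, hr, fun y hy => ?_⟩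
  change (∀ j, 0 < bary σ y j) ↔ _
  have hp : perp (-(‖amN σ i‖⁻¹ • amN σ i)) = -(‖amN σ i‖⁻¹ • perp (amN σ i)) := by
    ext k; fin_cases k <;> simp
  have hinv : 0 < ‖amN σ i‖⁻¹ := inv_pos.2 hn
  rw [forall_iff_add i, and_iff_right (hb y hy i h0), bary_eq_sub σ x y, bary_eq_sub σ x y, h1, h2, hp,
    amN_add_one, amN_add_two, inner_add_left, inner_sub_left, inner_smul_left, inner_smul_left,
    inner_neg_right, inner_neg_right, inner_smul_right, inner_smul_right, real_inner_comm (amN σ i),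
    real_inner_comm (perp (amN σ i)), abs_neg, abs_mul, abs_of_pos hinv]
  simp only [conj_trivial]
  generalize inner ℝ (amN σ i) (y - x) = p
  generalize inner ℝ (perp (amN σ i)) (y - x) = q
  generalize ‖amN σ i‖⁻¹ = c at *
  rw [neg_lt_neg_iff, show √3 * (c * |q|) = c * (√3 * |q|) by ring, mul_lt_mul_iff_right₀ hinv,
    ← abs_of_nonneg (Real.sqrt_nonneg 3), ← abs_mul, abs_lt, abs_of_nonneg (Real.sqrt_nonneg 3)]
  constructor <;> rintro ⟨k1, k2⟩ <;> constructor <;> linarith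

theorem isLipschitzDomain_tri {σ : ℝ} (hσ : σ ^ 2 = 1) : IsLipschitzDomain (tri σ) where
  isOpen := isOpen_tri σ
  isConnected := (convex_tri σ).isConnected ⟨0, zero_mem_tri σ⟩
  isBounded := (isCompact_ctri hσ).isBounded.subset (tri_subset_ctri σ)
  graph x hx := by
    obtain ⟨hc, i, hi⟩ := mem_frontier_tri.1 hx
    have hs := sum_bary' σ x i
    have hb := one_lt_bb
    rcases (hc (i + 1)).eq_or_lt with h1 | h1
    · refine exists_graph_tri_of_vertex hσ (i := i + 2) (by linarith) ?_ ?_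
      · rw [show i + 2 + 1 = i by clear * -; revert i; decide]; exact hi
      · rw [show i + 2 + 2 = i + 1 by clear * -; revert i; decide]; exact h1.symm
    · rcases (hc (i + 2)).eq_or_lt with h2 | h2
      · refine exists_graph_tri_of_vertex hσ (i := i + 1) h1 ?_ ?_
        · rw [show i + 1 + 1 = i + 2 by clear * -; revert i; decide]; exact h2.symm
        · rw [show i + 1 + 2 = i by clear * -; revert i; decide]; exact hi
      · exact ⟨_, norm_normalize_amN hσ i, 0, fun _ => 0, LipschitzWith.const _,
          exists_ball_mem_tri_iff hσ hi h1 h2⟩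

/-- The vertices of the triangle. -/
noncomputable def vertex (σ : ℝ) (i : Fin 3) : Plane := (-(1 + 2 * √3 / 3)) • amN σ i

theorem bary_vertex {σ : ℝ} (hσ : σ ^ 2 = 1) (i : Fin 3) :
    bary σ (vertex σ i) i = 1 + 2 * bb ∧ bary σ (vertex σ i) (i + 1) = 0 ∧
      bary σ (vertex σ i) (i + 2) = 0 := by
  have h1 : inner ℝ (amN σ i) (amN σ i) = (2 : ℝ) := by
    rw [real_inner_self_eq_norm_sq, norm_sq_amN hσ]
  have h2 : inner ℝ (perp (amN σ i)) (amN σ i) = (0 : ℝ) := inner_perp_self _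
  simp only [bary, vertex, inner_smul_right, amN_add_one, amN_add_two, inner_add_left, inner_sub_left,
    inner_smul_left, h1, h2, conj_trivial, bb]
  refine ⟨?_, ?_, ?_⟩ <;> ring

theorem eq_of_bary_eq {σ : ℝ} (hσ : σ ^ 2 = 1) {x y : Plane} (h : ∀ j, bary σ x j = bary σ y j) :
    x = y := by
  have h1 := norm_sq_eq_bary hσ (y - x)
  have h2 : ∀ j, inner ℝ (amN σ j) (y - x) = (0 : ℝ) := fun j => by
    have := bary_eq_sub σ x y j
    have := h j
    linarith
  simp only [h2] at h1
  have h3 : ‖y - x‖ = 0 := by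
    have : ‖y - x‖ ^ 2 = 0 := by simpa using h1
    exact pow_eq_zero_iff two_ne_zero |>.1 this
  exact (sub_eq_zero.1 (norm_eq_zero.1 h3)).symm

theorem bary_side {σ : ℝ} (hσ : σ ^ 2 = 1) (i : Fin 3) {a c : ℝ} (h : a + c = 1) :
    bary σ (a • vertex σ (i + 1) + c • vertex σ (i + 2)) i = 0 ∧
    bary σ (a • vertex σ (i + 1) + c • vertex σ (i + 2)) (i + 1) = a * (1 + 2 * bb) ∧
    bary σ (a • vertex σ (i + 1) + c • vertex σ (i + 2)) (i + 2) = c * (1 + 2 * bb) := by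
  obtain ⟨h1, h2, h3⟩ := bary_vertex hσ (i + 1)
  obtain ⟨k1, k2, k3⟩ := bary_vertex hσ (i + 2)
  rw [show i + 1 + 1 = i + 2 by clear * -; revert i; decide] at h2
  rw [show i + 1 + 2 = i by clear * -; revert i; decide] at h3
  rw [show i + 2 + 1 = i by clear * -; revert i; decide] at k2
  rw [show i + 2 + 2 = i + 1 by clear * -; revert i; decide] at k3
  simp only [bary_convex σ h, h1, h2, h3, k1, k2, k3]
  refine ⟨?_, ?_, ?_⟩ <;> ring

theorem mem_segment_vertex_iff {σ : ℝ} (hσ : σ ^ 2 = 1) (i : Fin 3) {x : Plane} :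
    x ∈ segment ℝ (vertex σ (i + 1)) (vertex σ (i + 2)) ↔ x ∈ ctri σ ∧ bary σ x i = 0 := by
  have hb := one_lt_bb
  have hb' : 0 < 1 + 2 * bb := by linarith
  constructor
  · rintro ⟨a, c, ha, hc, hac, rfl⟩
    obtain ⟨h1, h2, h3⟩ := bary_side hσ i hac
    refine ⟨(forall_iff_add i fun j => 0 ≤ bary σ _ j).2 ⟨h1.ge, ?_, ?_⟩, h1⟩
    · rw [h2]; positivity
    · rw [h3]; positivity
  · rintro ⟨hx, hi⟩
    have hs := sum_bary' σ x i
    rw [hi, zero_add] at hs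
    have hac : bary σ x (i + 1) / (1 + 2 * bb) + bary σ x (i + 2) / (1 + 2 * bb) = 1 := by
      rw [← add_div, hs, div_self hb'.ne']
    refine ⟨_, _, div_nonneg (hx (i + 1)) hb'.le, div_nonneg (hx (i + 2)) hb'.le, hac, ?_⟩
    obtain ⟨h1, h2, h3⟩ := bary_side hσ i hac
    refine eq_of_bary_eq hσ ((forall_iff_add i fun j => bary σ _ j = bary σ x j).2 ⟨?_, ?_, ?_⟩)
    · rw [h1, hi]
    · rw [h2, div_mul_cancel₀ _ hb'.ne']
    · rw [h3, div_mul_cancel₀ _ hb'.ne']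

theorem isPolygonalDomain_tri {σ : ℝ} (hσ : σ ^ 2 = 1) : IsPolygonalDomain (tri σ) where
  toIsLipschitzDomain := isLipschitzDomain_tri hσ
  frontier_eq := by
    refine ⟨range fun i => (vertex σ (i + 1), vertex σ (i + 2)), finite_range _, ?_⟩
    ext x
    simp only [biUnion_range, mem_iUnion, mem_segment_vertex_iff hσ, mem_frontier_tri,
      exists_and_left]

theorem hasSideWithNormal_tri {σ : ℝ} (hσ : σ ^ 2 = 1) (i : Fin 3) :
    HasSideWithNormal (tri σ) (amN σ i) := by
  have hb := one_lt_bb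
  have hb' : 0 < 1 + 2 * bb := by linarith
  refine ⟨vertex σ (i + 1), vertex σ (i + 2), fun h => ?_, fun x hx => ?_, ?_⟩
  · have h1 := (bary_vertex hσ (i + 1)).1
    have h2 := (bary_vertex hσ (i + 2)).2.2
    rw [show i + 2 + 2 = i + 1 by clear * -; revert i; decide, ← h, h1] at h2
    linarith
  · have h1 := (mem_segment_vertex_iff hσ i).1 hx
    exact mem_frontier_tri.2 ⟨h1.1, i, h1.2⟩
  · rintro x ⟨a, c, ha, hc, hac, rfl⟩
    obtain ⟨h1, h2, h3⟩ := bary_side hσ i hac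
    exact ⟨norm_normalize_amN hσ i, fun _ => 0, contDiff_const, rfl, by simp,
      exists_ball_mem_tri_iff hσ h1 (by rw [h2]; positivity) (by rw [h3]; positivity)⟩

/-! ### Scaling of the energy on triangles -/

/-- Because the patch variation does not depend on the bad area, δ = ε costs only order ε. A
contraction by 1/(1 + ε) makes the support compact in the open triangle, and the gap so created is a
collar of width of order ε. -/
theorem minEnergy_tri_le {σ : ℝ} (hσ : σ ^ 2 = 1) (Γ : Set Plane) : ∃ C : ℝ, 0 < C ∧
    ∀ ε : ℝ, 0 < ε → minEnergy (tri σ) Γ ε ≤ ENNReal.ofReal (C * min ε 1) := by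
  have hΩ := isLipschitzDomain_tri hσ
  have hvol := measure_ne_top_of_isBounded hΩ.isBounded
  obtain ⟨C₁, hC₁, h1⟩ := exists_volume_collar_le hΩ
  obtain ⟨V, hV, h2⟩ := exists_tri_patch hσ
  set M := (volume (tri σ)).toReal with hM
  have hM0 : 0 ≤ M := ENNReal.toReal_nonneg
  refine ⟨4 * M + (4 + 40 * C₁ + V), by positivity, fun ε hε => ?_⟩
  obtain ⟨u, G, A, k1, k2, k3, k4⟩ := h2 ε hε
  have hr : 0 < (1 + ε)⁻¹ := by positivity
  have hr1 : (1 + ε)⁻¹ ≤ 1 := inv_le_one_of_one_le₀ (by linarith)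
  have hpre : (fun z : Plane => ((1 + ε)⁻¹)⁻¹ • (z - 0)) ⁻¹' ctri σ ⊆ tri σ := fun z hz j => by
    have h3 : 0 ≤ bary σ (((1 + ε)⁻¹)⁻¹ • (z - 0)) j := hz j
    have h4 := bary_smul σ (1 + ε)⁻¹ (((1 + ε)⁻¹)⁻¹ • (z - 0)) j
    rw [smul_inv_smul₀ hr.ne', sub_zero] at h4
    rw [sub_zero] at h3
    have h5 : (1 + ε)⁻¹ < 1 := inv_lt_one_of_one_lt₀ (by linarith)
    have h6 : 0 < (1 - (1 + ε)⁻¹) * (1 + 2 * √3 / 3) := mul_pos (by linarith) (by positivity)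
    have h7 := mul_nonneg hr.le h3
    linarith
  have hclosed : IsClosed ((fun z : Plane => ((1 + ε)⁻¹)⁻¹ • (z - 0)) ⁻¹' ctri σ) :=
    (isCompact_ctri hσ).isClosed.preimage (by fun_prop)
  have hK : IsCompact ((fun z : Plane => ((1 + ε)⁻¹)⁻¹ • (z - 0)) ⁻¹' ctri σ) :=
    (isCompact_ctri hσ).of_isClosed_subset hclosed (hpre.trans (tri_subset_ctri σ))
  have hae : ∀ᵐ z, z ∈ tri σ → symPart (G (((1 + ε)⁻¹)⁻¹ • (z - 0))) ∈ wells ∨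
      (z ∈ (fun z : Plane => ((1 + ε)⁻¹)⁻¹ • (z - 0)) ⁻¹' A ∪ collar (tri σ) (10 * ε) ∧
        symPart (G (((1 + ε)⁻¹)⁻¹ • (z - 0))) = 0) := by
    filter_upwards [ae_comp_affine k3 0 hr.ne', ae_comp_affine (ae_mem_tri hσ) 0 hr.ne'] with z h3 h4 hz
    by_cases hc : ((1 + ε)⁻¹)⁻¹ • (z - 0) ∈ ctri σ
    · rcases h3 (h4 hc) with h | ⟨h, h'⟩
      · exact Or.inl h
      · exact Or.inr ⟨Or.inl h, h'⟩
    -- The point (1 + ε)z is outside the triangle and at distance ε|z| ≤ 10ε from z.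
    · refine Or.inr ⟨Or.inr ⟨hz, _, fun h => hc (tri_subset_ctri σ h), ?_⟩, ?_⟩
      · have h5 := norm_le_of_mem_ctri hσ (tri_subset_ctri σ hz)
        rw [sub_zero, inv_inv, add_smul, one_smul, sub_add_cancel_left, norm_neg, norm_smul,
          Real.norm_of_nonneg hε.le]
        nlinarith
      · rw [(k2 _ hc).2, symPart_zero]
  have hle := (k1.rescale 0 hr.ne').minEnergy_le (Γ := Γ) hK hΩ.isOpen hvol hpre
    (fun z hz => by rw [(k2 _ hz).1, smul_zero]) hae hε
  have hbad : volume (((fun z : Plane => ((1 + ε)⁻¹)⁻¹ • (z - 0)) ⁻¹' A ∪ collar (tri σ) (10 * ε)) ∩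
      tri σ) ≤ ENNReal.ofReal (ε + C₁ * (10 * ε)) := by
    refine (measure_mono inter_subset_left).trans ((measure_union_le _ _).trans ?_)
    rw [volume_preimage_affine _ _ hr.ne', ENNReal.ofReal_add hε.le (by positivity)]
    refine add_le_add ((mul_le_mul' (b := 1) ?_ k4).trans (le_of_eq (one_mul _)))
      (h1 _ (by positivity))
    rw [ENNReal.ofReal_le_one]
    exact pow_le_one₀ hr.le hr1
  rcases le_total ε 1 with h | h
  · rw [min_eq_left h]
    refine hle.trans ((add_le_add_left (mul_le_mul_right hbad 4) _).trans ?_)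
    rw [show (4 : ℝ≥0∞) = ENNReal.ofReal 4 by norm_num, ← ENNReal.ofReal_mul (by norm_num),
      abs_of_pos hr, ← ENNReal.ofReal_add (by positivity) (by positivity)]
    refine ENNReal.ofReal_le_ofReal ?_
    have e1 : ε * ((1 + ε)⁻¹ * V) ≤ ε * (1 * V) := by gcongr
    have e2 : 0 ≤ M * ε := by positivity
    nlinarith
  · rw [min_eq_right h, mul_one]
    refine (minEnergy_le_volume hΩ.isOpen hvol Γ hε).trans ?_
    rw [← ENNReal.ofReal_toReal hvol, ← hM, show (4 : ℝ≥0∞) = ENNReal.ofReal 4 by norm_num,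
      ← ENNReal.ofReal_mul (by norm_num)]
    exact ENNReal.ofReal_le_ofReal (by linarith)

/-- Chords in direction e₁ work for both triangles: the wells take the values 1/2, −1, 1/2 there, so
c₀ = 1/2. -/
theorem le_minEnergy_tri {σ : ℝ} (hσ : σ ^ 2 = 1) : ∃ c : ℝ, 0 < c ∧ ∀ ε : ℝ, 0 < ε →
    ENNReal.ofReal (c * min ε 1) ≤ minEnergy (tri σ) (frontier (tri σ)) ε := by
  have hΩ := isLipschitzDomain_tri hσ
  obtain ⟨ν, hν, hp⟩ := exists_unit_perp 0
  refine minEnergy_ge_linear (c₀ := 1 / 2) hΩ.isOpen (convex_tri σ) hΩ.isBounded ⟨0, zero_mem_tri σ⟩ hν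
    (by norm_num) (by norm_num) ?_
  rw [hp]
  rintro k (rfl | rfl | rfl) <;> norm_num [quad, unitVec]

end HexRhombic

theorem mainTheorem3 :
    (∀ Ω Γ : Set HexRhombic.Plane,
      HexRhombic.IsPiecewiseC3Domain Ω →
      HexRhombic.IsRelOpenBoundary Ω Γ → Γ.Nonempty →
      (∀ x ∈ Γ, ∀ ν : HexRhombic.Plane, HexRhombic.IsRegularWithNormal Ω x ν →
        ∀ n ∈ HexRhombic.amNormals, ∀ t : ℝ, ν ≠ t • n) →
      HexRhombic.ScalesLike (HexRhombic.minEnergy Ω Γ)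
        (fun ε => min 1 (ε * (|Real.log ε| + 1)))) ∧
    (∀ n ∈ HexRhombic.amNormals, ∃ Ω : Set HexRhombic.Plane,
      HexRhombic.IsPolygonalDomain Ω ∧ HexRhombic.HasSideWithNormal Ω n ∧
      HexRhombic.ScalesLike (HexRhombic.minEnergy Ω (frontier Ω))
        (fun ε => min ε 1)) := by
  refine ⟨fun Ω Γ hΩ hΓ hne hnor => ?_, fun n hn => ?_⟩
  · obtain ⟨c, hc, hlow⟩ := HexRhombic.minEnergy_ge_log hΩ hΓ hne hnor
    obtain ⟨C, hC, hup⟩ := HexRhombic.minEnergy_le_log hΩ.toIsLipschitzDomain Γ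
    exact ⟨c, C, hc, hC, fun ε hε => ⟨hlow ε hε, hup ε hε⟩⟩
  -- The six normals form two triples, indexed by σ = ±1, and the triangle of each triple has a side
  -- for every one of its normals.
  · obtain ⟨σ, hσ, j, rfl⟩ : ∃ σ : ℝ, σ ^ 2 = 1 ∧ ∃ j, n = HexRhombic.amN σ j := by
      obtain ⟨j, h | h⟩ := HexRhombic.mem_amNormals.1 hn
      · exact ⟨1, by norm_num, j, h⟩
      · exact ⟨-1, by norm_num, j, h⟩
    obtain ⟨c, hc, hlow⟩ := HexRhombic.le_minEnergy_tri hσ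
    obtain ⟨C, hC, hup⟩ := HexRhombic.minEnergy_tri_le hσ (frontier (HexRhombic.tri σ))
    exact ⟨HexRhombic.tri σ, HexRhombic.isPolygonalDomain_tri hσ,
      HexRhombic.hasSideWithNormal_tri hσ j, c, C, hc, hC, fun ε hε => ⟨hlow ε hε, hup ε hε⟩⟩
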